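/- Let $n\ge 1$, $N=n+2$, let $\delta>0$, let $X\subset\mathbb{R}^n$ be a bounded open set, and put $\mathbb{M}=(0,\delta)\times(0,\delta)\times X$ with points $x=(x_1,x_2,x')$. Write $$\nabla_{\mathbb{M}}=(x_1\partial_{x_1},\,x_1x_2\partial_{x_2},\,\partial_{x'_1},\dots,\partial_{x'_n}),\qquad d\sigma=\frac{dx_1}{x_1}\,\frac{dx_2}{x_1x_2}\,dx'.$$ Let $p,q,\lambda$ be real numbers with $2<p<N$, $p<q<p^*=\frac{Np}{N-p}$, $q<p(p+1)$ and $\lambda>0$. Let $H=\mathcal{H}^{1,(\frac{N-1}{p},\frac{N}{p})}_{p,0}(\mathbb{M})$ be the closure of $C_0^\infty(\mathbb{M})$ in the weighted Sobolev space of all $u$ with weak gradient $\nabla_{\mathbb{M}}u$ and finite norm $$\|u\|=\Big(\int_{\mathbb{M}}x_1|u|^p\,d\sigma+\int_{\mathbb{M}}x_1|\nabla_{\mathbb{M}}u|^p\,d\sigma\Big)^{1/p},$$ and let $$J(u)=\frac1p\int_{\mathbb{M}}x_1|\nabla_{\mathbb{M}}u|^p\,d\sigma-\frac{\lambda}{q}\int_{\mathbb{M}}x_1(x_1x_2)^p|u|^q\,d\sigma,\qquad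 u\in H.$$ Let $B$ be the closed unit ball of $H$ and $\partial B$ its unit sphere, let $A_0=\{u\in H: 0\le J(u)<\infty\}$, and let $\Gamma$ be the set of all odd homeomorphisms $h$ of $H$ onto $H$ with $h(0)=0$ and $h(B)\subset A_0$. Let $E_0\subset E_1\subset E_2\subset\cdots$ be subspaces of $H$ with $\dim E_m=m$ whose union spans a dense subspace of $H$, and for each $m$ let $E_m^c$ be an algebraic and topological complement of $E_m$ in $H$. For $m\ge1$ define, in the extended reals, $$c_m=\sup_{h\in\Gamma}\ \inf_{u\in\partial B\cap E_{m-1}^c}J(h(u)).$$ Then $c_m\to\infty$ as $m\to\infty$. -/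

import Mathlib

open MeasureTheory Filter Topology Set
open scoped ENNReal ContDiff

/-- Points `(x₁, x₂, x')` of the coordinate space `ℝ × ℝ × ℝⁿ`, of dimension `N = n + 2`. -/
abbrev CornerPt (n : ℕ) : Type := ℝ × ℝ × EuclideanSpace ℝ (Fin n)

/-- The finite stretched corner `𝕄 = (0,δ) × (0,δ) × X`. -/
def cornerSet {n : ℕ} (δ : ℝ) (X : Set (EuclideanSpace ℝ (Fin n))) : Set (CornerPt n) :=
  Ioo 0 δ ×ˢ Ioo 0 δ ×ˢ X

/-- The coordinate directions of `∂_{x₁}, ∂_{x₂}, ∂_{x'₁}, …, ∂_{x'ₙ}`. -/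
noncomputable def cornerDir (n : ℕ) : Fin (n + 2) → CornerPt n :=
  Fin.cons (1, 0, 0) (Fin.cons (0, 1, 0) fun i => (0, 0, EuclideanSpace.single i 1))

/-- The coefficients `x₁, x₁ x₂, 1, …, 1` of `∇_𝕄 = (x₁ ∂_{x₁}, x₁ x₂ ∂_{x₂}, ∂_{x'₁}, …, ∂_{x'ₙ})`. -/
def cornerCoef {n : ℕ} (x : CornerPt n) : Fin (n + 2) → ℝ :=
  Fin.cons x.1 (Fin.cons (x.1 * x.2.1) fun _ => 1)

/-- The corner gradient `∇_𝕄 φ` of a differentiable function. -/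
noncomputable def cornerGrad {n : ℕ} (φ : CornerPt n → ℝ) (x : CornerPt n) :
    EuclideanSpace ℝ (Fin (n + 2)) :=
  WithLp.toLp 2 fun i => cornerCoef x i * fderiv ℝ φ x (cornerDir n i)

/-- `φ ∈ C₀^∞(int 𝕄)`: smooth with compact support contained in `𝕄`. -/
structure IsCornerTest {n : ℕ} (δ : ℝ) (X : Set (EuclideanSpace ℝ (Fin n)))
    (φ : CornerPt n → ℝ) : Prop where
  smooth : ContDiff ℝ ∞ φ
  compact : HasCompactSupport φ
  subset : tsupport φ ⊆ cornerSet δ X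

/-- The measure `dσ = (dx₁ / x₁) (dx₂ / (x₁ x₂)) dx'` on `𝕄`. -/
noncomputable def cornerVol {n : ℕ} (δ : ℝ) (X : Set (EuclideanSpace ℝ (Fin n))) :
    Measure (CornerPt n) :=
  (volume.restrict (cornerSet δ X)).withDensity
    fun x => ENNReal.ofReal (x.1⁻¹ * (x.1 * x.2.1)⁻¹)

/-- The measure `|x₁^{N/p-γ₁} x₂^{N/p-γ₂}|^p dσ` with `N = n + 2`; the `L^p` space of it is the
weighted space `L_p^{γ₁,γ₂}(𝕄)`, with the same norm. -/
noncomputable def weightedVol {n : ℕ} (δ : ℝ) (X : Set (EuclideanSpace ℝ (Fin n)))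
    (p γ₁ γ₂ : ℝ) : Measure (CornerPt n) :=
  (cornerVol δ X).withDensity fun x => ENNReal.ofReal
    ((x.1 ^ (((n : ℝ) + 2) / p - γ₁) * x.2.1 ^ (((n : ℝ) + 2) / p - γ₂)) ^ p)

/-- `G` is the weak corner gradient of `u` on `𝕄`: the weak partial derivative of `u` in the
`i`-th coordinate is `G i` divided by the `i`-th coefficient of `∇_𝕄`. -/
def IsWeakCornerGrad {n : ℕ} (δ : ℝ) (X : Set (EuclideanSpace ℝ (Fin n)))
    (u : CornerPt n → ℝ) (G : CornerPt n → EuclideanSpace ℝ (Fin (n + 2))) : Prop :=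
  ∀ φ : CornerPt n → ℝ, IsCornerTest δ X φ → ∀ i : Fin (n + 2),
    ∫ x in cornerSet δ X, u x * fderiv ℝ φ x (cornerDir n i) =
      -∫ x in cornerSet δ X, G x i / cornerCoef x i * φ x

instance fact_one_le_ofReal (p : ℝ) [h : Fact (1 ≤ p)] : Fact (1 ≤ ENNReal.ofReal p) :=
  ⟨by simpa using ENNReal.ofReal_le_ofReal h.out⟩

/-- Pairs `(u, G)` with `u ∈ L_p^{γ₁,γ₂}(𝕄)` and `G ∈ L_p^{γ₁,γ₂}(𝕄; ℝᴺ)`, normed by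
`(‖u‖^p + ‖G‖^p)^{1/p}`. -/
abbrev CornerPair {n : ℕ} (δ : ℝ) (X : Set (EuclideanSpace ℝ (Fin n))) (p γ₁ γ₂ : ℝ) : Type :=
  WithLp (ENNReal.ofReal p)
    (Lp ℝ (ENNReal.ofReal p) (weightedVol δ X p γ₁ γ₂) ×
      Lp (EuclideanSpace ℝ (Fin (n + 2))) (ENNReal.ofReal p) (weightedVol δ X p γ₁ γ₂))

section Integrability

/-- A density that is continuous and positive on a compact set `K` is bounded from both sides
there. -/
theorem withDensity_restrict_compact {α : Type*} [TopologicalSpace α] [MeasurableSpace α]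
    [T2Space α] [BorelSpace α] (ν : Measure α) {K : Set α} (hK : IsCompact K) (hν : ν K < (⊤ : ℝ≥0∞))
    {g : α → ℝ} (hg : ContinuousOn g K) (hpos : ∀ x ∈ K, 0 < g x) :
    (ν.withDensity fun x => ENNReal.ofReal (g x)) K < (⊤ : ℝ≥0∞) ∧
      ∃ C : ℝ≥0∞, C ≠ (⊤ : ℝ≥0∞) ∧
        ν.restrict K ≤ C • (ν.withDensity fun x => ENNReal.ofReal (g x)).restrict K := by
  have hKm := hK.measurableSet
  rcases K.eq_empty_or_nonempty with rfl | hne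
  · exact ⟨by simp, 0, by simp, by simp⟩
  obtain ⟨a, ha, hmin⟩ := hK.exists_isMinOn hne hg
  obtain ⟨b, hb, hmax⟩ := hK.exists_isMaxOn hne hg
  constructor
  · rw [withDensity_apply _ hKm]
    calc ∫⁻ x in K, ENNReal.ofReal (g x) ∂ν ≤ ∫⁻ _ in K, ENNReal.ofReal (g b) ∂ν :=
          setLIntegral_mono' hKm fun x hx => ENNReal.ofReal_le_ofReal (hmax hx)
      _ = ENNReal.ofReal (g b) * ν K := by simp
      _ < (⊤ : ℝ≥0∞) := ENNReal.mul_lt_top ENNReal.ofReal_lt_top hν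
  · have h0 : ENNReal.ofReal (g a) ≠ 0 := by simpa using hpos a ha
    refine ⟨(ENNReal.ofReal (g a))⁻¹, by simpa using h0, ?_⟩
    refine Measure.le_iff.2 fun s hs => ?_
    rw [Measure.smul_apply, Measure.restrict_apply hs, Measure.restrict_apply hs, smul_eq_mul,
      withDensity_apply _ (hs.inter hKm)]
    calc ν (s ∩ K)
        = (ENNReal.ofReal (g a))⁻¹ * (ENNReal.ofReal (g a) * ν (s ∩ K)) := by
          rw [← mul_assoc, ENNReal.inv_mul_cancel h0 ENNReal.ofReal_ne_top, one_mul]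
      _ = (ENNReal.ofReal (g a))⁻¹ * ∫⁻ _ in s ∩ K, ENNReal.ofReal (g a) ∂ν := by simp
      _ ≤ _ := by
          gcongr 1
          exact setLIntegral_mono' (hs.inter hKm)
            fun x hx => ENNReal.ofReal_le_ofReal (hmin hx.2)

/-- On a compact subset of `𝕄` the weighted measure is finite and dominates Lebesgue measure. -/
theorem weightedVol_compact {n : ℕ} {δ : ℝ} {X : Set (EuclideanSpace ℝ (Fin n))}
    (p γ₁ γ₂ : ℝ) {K : Set (CornerPt n)} (hK : IsCompact K) (hKM : K ⊆ cornerSet δ X) :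
    weightedVol δ X p γ₁ γ₂ K < (⊤ : ℝ≥0∞) ∧ ∃ C : ℝ≥0∞, C ≠ (⊤ : ℝ≥0∞) ∧
      volume.restrict K ≤ C • (weightedVol δ X p γ₁ γ₂).restrict K := by
  have hKm := hK.measurableSet
  have hx1 : ∀ x ∈ K, 0 < x.1 := fun x hx => (hKM hx).1.1
  have hx2 : ∀ x ∈ K, 0 < x.2.1 := fun x hx => (hKM hx).2.1.1
  have hrr : (volume.restrict (cornerSet δ X)).restrict K = volume.restrict K := by
    rw [Measure.restrict_restrict hKm, inter_eq_self_of_subset_left hKM]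
  have hfin : (volume.restrict (cornerSet δ X)) K < (⊤ : ℝ≥0∞) := by
    rw [Measure.restrict_apply hKm]
    exact (measure_mono inter_subset_left).trans_lt hK.measure_lt_top
  have hc1 : ContinuousOn (fun x : CornerPt n => x.1) K := continuous_fst.continuousOn
  have hc2 : ContinuousOn (fun x : CornerPt n => x.2.1) K :=
    (continuous_fst.comp continuous_snd).continuousOn
  obtain ⟨hf1, C1, hC1, hle1⟩ := withDensity_restrict_compact
    (volume.restrict (cornerSet δ X)) hK hfin
    (g := fun x => x.1⁻¹ * (x.1 * x.2.1)⁻¹)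
    ((hc1.inv₀ fun x hx => (hx1 x hx).ne').mul
      ((hc1.mul hc2).inv₀ fun x hx => (mul_pos (hx1 x hx) (hx2 x hx)).ne'))
    (fun x hx => by have := hx1 x hx; have := hx2 x hx; positivity)
  obtain ⟨hf2, C2, hC2, hle2⟩ := withDensity_restrict_compact (cornerVol δ X) hK hf1
    (g := fun x => (x.1 ^ (((n : ℝ) + 2) / p - γ₁) * x.2.1 ^ (((n : ℝ) + 2) / p - γ₂)) ^ p)
    (by
      refine ContinuousOn.rpow_const (ContinuousOn.mul
        (hc1.rpow_const fun x hx => Or.inl (hx1 x hx).ne')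
        (hc2.rpow_const fun x hx => Or.inl (hx2 x hx).ne')) fun x hx => Or.inl ?_
      have := hx1 x hx; have := hx2 x hx; positivity)
    (fun x hx => by have := hx1 x hx; have := hx2 x hx; positivity)
  refine ⟨hf2, C1 * C2, ENNReal.mul_ne_top hC1 hC2, ?_⟩
  rw [hrr] at hle1
  refine hle1.trans ?_
  rw [mul_smul]
  refine Measure.le_iff.2 fun s _ => ?_
  exact mul_le_mul_right (hle2 s) C1

/-- Functions in the weighted `L^p` space are integrable against continuous functions with
compact support in `𝕄`. -/
theorem integrable_mul_of_compact {n : ℕ} {δ : ℝ} {X : Set (EuclideanSpace ℝ (Fin n))}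
    {p γ₁ γ₂ : ℝ} [Fact (1 ≤ p)] {f : CornerPt n → ℝ}
    (hf : MemLp f (ENNReal.ofReal p) (weightedVol δ X p γ₁ γ₂))
    {K : Set (CornerPt n)} (hK : IsCompact K) (hKM : K ⊆ cornerSet δ X)
    {ψ : CornerPt n → ℝ} (hψ : ContinuousOn ψ K) (h0 : ∀ x ∉ K, ψ x = 0) :
    IntegrableOn (fun x => f x * ψ x) (cornerSet δ X) := by
  obtain ⟨hf2, C, hC, hle⟩ := weightedVol_compact p γ₁ γ₂ hK hKM
  have : IsFiniteMeasure ((weightedVol δ X p γ₁ γ₂).restrict K) := ⟨by simpa using hf2⟩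
  have hi : Integrable f ((weightedVol δ X p γ₁ γ₂).restrict K) :=
    (hf.restrict K).integrable (fact_one_le_ofReal p).out
  have hiK : IntegrableOn f K volume := hi.of_measure_le_smul hC hle
  have hm : IntegrableOn (fun x => f x * ψ x) K volume := hiK.mul_continuousOn hψ hK
  refine ((integrableOn_iff_integrable_of_support_subset fun x hx => ?_).1 hm).integrableOn
  by_contra hxK
  exact hx (by simp [h0 x hxK])

/-- Equality almost everywhere for the weighted measure passes to Lebesgue measure on compact
subsets of `𝕄`. -/
theorem ae_of_weightedVol {n : ℕ} {δ : ℝ} {X : Set (EuclideanSpace ℝ (Fin n))} {p γ₁ γ₂ : ℝ}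
    {K : Set (CornerPt n)} (hK : IsCompact K) (hKM : K ⊆ cornerSet δ X)
    {P : CornerPt n → Prop} (h : ∀ᵐ x ∂(weightedVol δ X p γ₁ γ₂), P x) :
    ∀ᵐ x ∂(volume.restrict (cornerSet δ X)), x ∈ K → P x := by
  obtain ⟨-, C, hC, hle⟩ := weightedVol_compact p γ₁ γ₂ hK hKM
  have h1 : ∀ᵐ x ∂(volume.restrict K), P x :=
    (Measure.absolutelyContinuous_of_le_smul hle).ae_le (ae_restrict_of_ae h)
  exact ae_restrict_of_ae ((ae_restrict_iff' hK.measurableSet).1 h1)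

theorem continuous_cornerCoef {n : ℕ} (i : Fin (n + 2)) :
    Continuous fun x : CornerPt n => cornerCoef x i := by
  refine Fin.cases ?_ (fun j => Fin.cases ?_ (fun k => ?_) j) i
  · simpa [cornerCoef] using continuous_fst
  · exact continuous_fst.mul (continuous_fst.comp continuous_snd)
  · simpa [cornerCoef] using continuous_const

theorem cornerCoef_ne_zero {n : ℕ} {δ : ℝ} {X : Set (EuclideanSpace ℝ (Fin n))}
    {x : CornerPt n} (hx : x ∈ cornerSet δ X) (i : Fin (n + 2)) : cornerCoef x i ≠ 0 := by
  have h1 : x.1 ≠ 0 := hx.1.1.ne'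
  have h2 : x.2.1 ≠ 0 := hx.2.1.1.ne'
  refine Fin.cases ?_ (fun j => Fin.cases ?_ (fun k => ?_) j) i <;>
    simp [cornerCoef, h1, h2]

end Integrability

section Spaces

variable {n : ℕ} (δ : ℝ) (X : Set (EuclideanSpace ℝ (Fin n))) (p γ₁ γ₂ : ℝ) [Fact (1 ≤ p)]

theorem CornerPair.integrable_left (w : CornerPair δ X p γ₁ γ₂) {φ : CornerPt n → ℝ}
    (hφ : IsCornerTest δ X φ) (i : Fin (n + 2)) :
    IntegrableOn (fun x => w.fst x * fderiv ℝ φ x (cornerDir n i)) (cornerSet δ X) := by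
  refine integrable_mul_of_compact (Lp.memLp w.fst) hφ.compact hφ.subset
    ((hφ.smooth.continuous_fderiv (by simp)).clm_apply continuous_const).continuousOn ?_
  intro x hx
  have : x ∉ tsupport (fderiv ℝ φ) := fun h => hx (tsupport_fderiv_subset ℝ h)
  simp [image_eq_zero_of_notMem_tsupport this]

theorem CornerPair.integrable_right (w : CornerPair δ X p γ₁ γ₂) {φ : CornerPt n → ℝ}
    (hφ : IsCornerTest δ X φ) (i : Fin (n + 2)) :
    IntegrableOn (fun x => w.snd x i / cornerCoef x i * φ x) (cornerSet δ X) := by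
  have hm : MemLp (fun x => w.snd x i) (ENNReal.ofReal p) (weightedVol δ X p γ₁ γ₂) :=
    (EuclideanSpace.proj (𝕜 := ℝ) i).comp_memLp' (Lp.memLp w.snd)
  have := integrable_mul_of_compact hm hφ.compact hφ.subset
    (ψ := fun x => φ x / cornerCoef x i)
    (hφ.smooth.continuous.continuousOn.div (continuous_cornerCoef i).continuousOn
      fun x hx => cornerCoef_ne_zero (hφ.subset hx) i)
    (fun x hx => by simp [image_eq_zero_of_notMem_tsupport hx])
  refine this.congr_fun_ae (ae_of_all _ fun x => ?_)
  ring

theorem fderiv_eq_zero_of_notMem_tsupport {φ : CornerPt n → ℝ} {x : CornerPt n}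
    (hx : x ∉ tsupport φ) : fderiv ℝ φ x = 0 :=
  image_eq_zero_of_notMem_tsupport fun h => hx (tsupport_fderiv_subset ℝ h)

/-- The weighted Sobolev space `𝓗_p^{1,(γ₁,γ₂)}(𝕄)`: each `u` is stored together with its weak
corner gradient, so that the norm is `(‖u‖^p + ‖∇_𝕄 u‖^p)^{1/p}`. -/
noncomputable def cornerSobolev : Submodule ℝ (CornerPair δ X p γ₁ γ₂) where
  carrier := {w | IsWeakCornerGrad δ X w.fst w.snd}
  zero_mem' := by
    intro φ hφ i
    have h1 := ae_of_weightedVol hφ.compact hφ.subset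
      (Lp.coeFn_zero ℝ (ENNReal.ofReal p) (weightedVol δ X p γ₁ γ₂))
    have h2 := ae_of_weightedVol hφ.compact hφ.subset
      (Lp.coeFn_zero (EuclideanSpace ℝ (Fin (n + 2))) (ENNReal.ofReal p)
        (weightedVol δ X p γ₁ γ₂))
    rw [integral_eq_zero_of_ae, integral_eq_zero_of_ae, neg_zero]
    · filter_upwards [h2] with x hx
      by_cases hK : x ∈ tsupport φ
      · rw [WithLp.zero_snd, hx hK]; simp
      · simp [image_eq_zero_of_notMem_tsupport hK]
    · filter_upwards [h1] with x hx
      by_cases hK : x ∈ tsupport φ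
      · rw [WithLp.zero_fst, hx hK]; simp
      · simp [fderiv_eq_zero_of_notMem_tsupport hK]
  add_mem' := by
    intro v w hv hw φ hφ i
    have h1 := ae_of_weightedVol hφ.compact hφ.subset (Lp.coeFn_add v.fst w.fst)
    have h2 := ae_of_weightedVol hφ.compact hφ.subset (Lp.coeFn_add v.snd w.snd)
    have e1 : ∫ x in cornerSet δ X, (v + w).fst x * fderiv ℝ φ x (cornerDir n i) =
        ∫ x in cornerSet δ X, (v.fst x * fderiv ℝ φ x (cornerDir n i) +
          w.fst x * fderiv ℝ φ x (cornerDir n i)) := by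
      refine integral_congr_ae ?_
      filter_upwards [h1] with x hx
      by_cases hK : x ∈ tsupport φ
      · rw [WithLp.add_fst, hx hK, Pi.add_apply, add_mul]
      · simp [fderiv_eq_zero_of_notMem_tsupport hK]
    have e2 : ∫ x in cornerSet δ X, (v + w).snd x i / cornerCoef x i * φ x =
        ∫ x in cornerSet δ X, (v.snd x i / cornerCoef x i * φ x +
          w.snd x i / cornerCoef x i * φ x) := by
      refine integral_congr_ae ?_
      filter_upwards [h2] with x hx
      by_cases hK : x ∈ tsupport φ
      · rw [WithLp.add_snd, hx hK, Pi.add_apply, PiLp.add_apply, add_div, add_mul]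
      · simp [image_eq_zero_of_notMem_tsupport hK]
    rw [e1, e2, integral_add (v.integrable_left δ X p γ₁ γ₂ hφ i)
      (w.integrable_left δ X p γ₁ γ₂ hφ i), integral_add (v.integrable_right δ X p γ₁ γ₂ hφ i)
      (w.integrable_right δ X p γ₁ γ₂ hφ i), hv φ hφ i, hw φ hφ i]
    ring
  smul_mem' := by
    intro c w hw φ hφ i
    have h1 := ae_of_weightedVol hφ.compact hφ.subset (Lp.coeFn_smul c w.fst)
    have h2 := ae_of_weightedVol hφ.compact hφ.subset (Lp.coeFn_smul c w.snd)
    have e1 : ∫ x in cornerSet δ X, (c • w).fst x * fderiv ℝ φ x (cornerDir n i) =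
        ∫ x in cornerSet δ X, c * (w.fst x * fderiv ℝ φ x (cornerDir n i)) := by
      refine integral_congr_ae ?_
      filter_upwards [h1] with x hx
      by_cases hK : x ∈ tsupport φ
      · simp [hx hK, mul_assoc]
      · simp [fderiv_eq_zero_of_notMem_tsupport hK]
    have e2 : ∫ x in cornerSet δ X, (c • w).snd x i / cornerCoef x i * φ x =
        ∫ x in cornerSet δ X, c * (w.snd x i / cornerCoef x i * φ x) := by
      refine integral_congr_ae ?_
      filter_upwards [h2] with x hx
      by_cases hK : x ∈ tsupport φ
      · simp [hx hK, mul_div_assoc, mul_assoc]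
      · simp [image_eq_zero_of_notMem_tsupport hK]
    rw [e1, e2, integral_const_mul, integral_const_mul, hw φ hφ i]
    ring

/-- The elements of `𝓗_p^{1,(γ₁,γ₂)}(𝕄)` given by functions of `C₀^∞(int 𝕄)`. -/
noncomputable def cornerTestSet : Set (cornerSobolev δ X p γ₁ γ₂) :=
  {w | ∃ φ : CornerPt n → ℝ, IsCornerTest δ X φ ∧
    w.1.fst =ᵐ[weightedVol δ X p γ₁ γ₂] φ ∧ w.1.snd =ᵐ[weightedVol δ X p γ₁ γ₂] cornerGrad φ}

/-- The space `𝓗_{p,0}^{1,(γ₁,γ₂)}(𝕄)`: the closure of `C₀^∞(int 𝕄)` in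
`𝓗_p^{1,(γ₁,γ₂)}(𝕄)`. -/
noncomputable def cornerSobolevZero : Submodule ℝ (cornerSobolev δ X p γ₁ γ₂) :=
  (Submodule.span ℝ (cornerTestSet δ X p γ₁ γ₂)).topologicalClosure

/-- The space `𝓗_{p,0}^{1,((N-1)/p, N/p)}(𝕄)` with `N = n + 2`. -/
def CornerH : Type :=
  cornerSobolevZero δ X p ((((n : ℝ) + 2) - 1) / p) (((n : ℝ) + 2) / p)

noncomputable instance : NormedAddCommGroup (CornerH δ X p) :=
  inferInstanceAs (NormedAddCommGroup
    (cornerSobolevZero δ X p ((((n : ℝ) + 2) - 1) / p) (((n : ℝ) + 2) / p)))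

noncomputable instance : NormedSpace ℝ (CornerH δ X p) :=
  inferInstanceAs (NormedSpace ℝ
    (cornerSobolevZero δ X p ((((n : ℝ) + 2) - 1) / p) (((n : ℝ) + 2) / p)))

variable {δ X p}

/-- The function underlying an element of `𝓗_{p,0}^{1,((N-1)/p, N/p)}(𝕄)`. -/
noncomputable def CornerH.toFun (u : CornerH δ X p) : CornerPt n → ℝ := u.1.1.fst

/-- The weak gradient `∇_𝕄 u`. -/
noncomputable def CornerH.grad (u : CornerH δ X p) : CornerPt n → EuclideanSpace ℝ (Fin (n + 2)) := u.1.1.snd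

/-- The energy functional
`J(u) = (1/p) ∫_𝕄 x₁ |∇_𝕄 u|^p dσ - (μ/q) ∫_𝕄 x₁ (x₁ x₂)^p |u|^q dσ`. -/
noncomputable def cornerEnergy (q μ : ℝ) (u : CornerH δ X p) : ℝ :=
  1 / p * ∫ x, x.1 * ‖u.grad x‖ ^ p ∂(cornerVol δ X) -
    μ / q * ∫ x, x.1 * (x.1 * x.2.1) ^ p * |u.toFun x| ^ q ∂(cornerVol δ X)

end Spaces

/-- For a functional `I` on a normed space `E`, the class `Γ` of odd homeomorphisms `h` of `E`
onto itself with `h(0) = 0` and `h(B) ⊆ A₀`, where `B` is the closed unit ball and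
`A₀ = {u | 0 ≤ I(u) < ∞}`. -/
def oddHomeoClass {E : Type*} [NormedAddCommGroup E] (I : E → ℝ) : Set (E ≃ₜ E) :=
  {h | h 0 = 0 ∧ (∀ u, h (-u) = -h u) ∧ h '' Metric.closedBall 0 1 ⊆ {u | 0 ≤ I u}}

/-- The minimax value `sup_{h ∈ Γ} inf_{u ∈ ∂B ∩ F} I(h(u))`, in the extended reals. -/
noncomputable def minimaxValue {E : Type*} [NormedAddCommGroup E] [NormedSpace ℝ E]
    (I : E → ℝ) (F : Submodule ℝ E) : EReal :=
  ⨆ h ∈ oddHomeoClass I, ⨅ u ∈ Metric.sphere (0 : E) 1 ∩ (F : Set E), (I (h u) : EReal)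

/-! Since the minimax value is a supremum over `oddHomeoClass`, it is enough to exhibit, for every
real `M` and all large `m`, one admissible `h` with `J ∘ h > M` on the unit sphere of the
complement. This is done for any functional with `I u ≥ a‖u‖ᵖ - b S(u)^q`, `q > p`, where the
seminorm `S` is bounded and becomes arbitrarily small relative to the norm on suitable subspaces of
finite codimension (`tendsto_minimaxValue_top`).

There is a level `σ` such that `S v ≤ σ` forces `I v ≥ 0`: small `v` are handled by `q > p`, the
others by the choice of `σ`. Choose `R` with `a Rᵖ - b σ^q > M` and consider the gauge `N = max
(‖·‖/R) (S/σ)`. A radial homeomorphism carries the unit ball onto `{N ≤ 1}`, where `I ≥ 0`, so it is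
admissible. On the kernel of finitely many functionals `S ≤ (σ/R)‖·‖`, hence `N = ‖·‖/R` there. If
the complement is moved into that kernel by a linear homeomorphism, its unit sphere is sent to
vectors of norm `R` with `S ≤ σ`, and there `I > M`. Such a homeomorphism is a shear along
`E_{m-1}`; it exists for large `m` because the dense union of the `E_m` contains preimages for the
whole finite-dimensional range of the functionals.

For `J`, a Poincaré inequality in a bounded `x'` direction (`CornerH.exists_poincare`) lets the
gradient term control the norm, and `S` is the `L^q` norm for `(x₁x₂)ᵖ x₁ dσ`. Its smallness on
finite codimension replaces compactness of the embedding (`CornerH.exists_embedding`). A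
Gagliardo–Nirenberg argument gives a Sobolev inequality at `p*` with a power of `x₁` as weight.
Interpolating it with `Lᵖ` leaves the weight `x₁^{p-(q-p)/p} x₂ᵖ`, up to a positive power, on the
`Lᵖ` side. Because `q < p(p+1)`, this weight tends to zero at the faces `x₁ = 0` and `x₂ = 0`. Away
from the faces the corner gradient is comparable with the ordinary one, and a function with zero
mean on all cubes of a fine grid has `Lᵖ` norm at most a small multiple of its gradient norm. The
cube means are the finitely many functionals. -/

/-! ### Divergence of the minimax values of an abstract functional. -/

/-- A finite-rank continuous linear map on `E`, restricted to an increasing union of subspaces that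
is dense, has a section over its range with values in one of the subspaces. -/
theorem exists_section_of_dense {E ι : Type*} [NormedAddCommGroup E] [NormedSpace ℝ E] [Finite ι]
    {V : ℕ → Submodule ℝ E} (hV : Monotone V)
    (hd : Dense (Submodule.span ℝ (⋃ m, (V m : Set E)) : Set E)) (f : E →L[ℝ] (ι → ℝ)) :
    ∃ Q : E →L[ℝ] E, (∀ u, f (Q u) = f u) ∧ ∃ m₀, ∀ m ≥ m₀, ∀ u, Q u ∈ V m := by
  have hspan : Submodule.span ℝ (⋃ m, (V m : Set E)) = ⨆ m, V m := by
    simp [Submodule.span_iUnion]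
  rw [hspan] at hd
  have hrange : ∀ y ∈ LinearMap.range f.toLinearMap,
      y ∈ (⨆ m, V m).map f.toLinearMap := by
    rintro _ ⟨x, rfl⟩
    -- The image of the dense union is dense in the range of `f`; being finite-dimensional it is
    -- closed, so it is the whole range.
    have hcl : IsClosed (((⨆ m, V m).map f.toLinearMap : Submodule ℝ (ι → ℝ)) : Set (ι → ℝ)) :=
      Submodule.closed_of_finiteDimensional _
    have h1 := hd.closure_eq ▸ mem_univ x
    have h2 := image_closure_subset_closure_image f.continuous (mem_image_of_mem f h1)
    have h3 : (f '' ((⨆ m, V m : Submodule ℝ E) : Set E)) =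
      (((⨆ m, V m).map f.toLinearMap : Submodule ℝ (ι → ℝ)) : Set (ι → ℝ)) := rfl
    rw [h3, hcl.closure_eq] at h2
    exact h2
  let R := LinearMap.range f.toLinearMap
  let g : (⨆ m, V m : Submodule ℝ E) →ₗ[ℝ] R :=
    (f.toLinearMap.rangeRestrict).domRestrict _
  have hg : Function.Surjective g := by
    rintro ⟨y, hy⟩
    obtain ⟨x, hx, hxy⟩ := hrange y hy
    exact ⟨⟨x, hx⟩, Subtype.ext hxy⟩
  obtain ⟨s, hs⟩ := LinearMap.exists_rightInverse_of_surjective g (LinearMap.range_eq_top.2 hg)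
  let s' : R →ₗ[ℝ] E := (Submodule.subtype _) ∘ₗ s
  let Q : E →L[ℝ] E := (LinearMap.toContinuousLinearMap s').comp
    (f.codRestrict R fun x => ⟨x, rfl⟩)
  refine ⟨Q, fun u => ?_, ?_⟩
  · have := LinearMap.congr_fun hs ⟨f u, ⟨u, rfl⟩⟩
    exact congrArg Subtype.val this
  -- Only the finitely many preimages of a basis have to lie in a common `V m`.
  · let b := Module.finBasis ℝ R
    have hmem : ∀ i, ∃ m, s' (b i) ∈ V m := fun i =>
      (Submodule.mem_iSup_of_directed V hV.directed_le).1 (s (b i)).2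
    choose k hk using hmem
    refine ⟨Finset.univ.sup k, fun m hm u => ?_⟩
    have hle : ∀ y : R, s' y ∈ V m := by
      intro y
      rw [← b.sum_repr y, map_sum]
      refine Submodule.sum_mem _ fun i _ => ?_
      rw [map_smul]
      exact Submodule.smul_mem _ _ (hV ((Finset.le_sup (Finset.mem_univ i)).trans hm) (hk i))
    exact hle _

/-- Given a positive continuous gauge `N` comparable with the norm and a linear homeomorphism `L`,
the radial rescaling of `L` which maps the unit ball onto the unit ball of `N`. -/
theorem exists_radial_homeomorph {E : Type*} [NormedAddCommGroup E] [NormedSpace ℝ E]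
    (N : E → ℝ) (hN : Continuous N) (hhom : ∀ (c : ℝ) v, N (c • v) = |c| * N v) {c : ℝ}
    (hc : 0 < c) (hlow : ∀ v, c * ‖v‖ ≤ N v) (L : E ≃L[ℝ] E) :
    ∃ h : E ≃ₜ E, ∀ u, h u = (‖u‖ / N (L u)) • L u := by
  have hpos : ∀ v, v ≠ 0 → 0 < N v := fun v hv =>
    (mul_pos hc (norm_pos_iff.2 hv)).trans_le (hlow v)
  have hN0 : N 0 = 0 := by simpa using hhom 0 0
  -- Continuity at `0` bounds `N` by `1` on some ball, and homogeneity spreads the bound.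
  have hup : ∃ C, ∀ v, N v ≤ C * ‖v‖ := by
    have h1 : ∀ᶠ v in 𝓝 (0 : E), N v < 1 := hN.continuousAt.eventually_lt continuousAt_const
      (by simp [hN0])
    obtain ⟨r, hr, hball⟩ := Metric.eventually_nhds_iff.1 h1
    refine ⟨2 / r, fun v => ?_⟩
    rcases eq_or_ne v 0 with rfl | hv
    · simp [hN0]
    have hv' := norm_pos_iff.2 hv
    have h2 : dist ((r / 2 / ‖v‖) • v) 0 < r := by
      rw [dist_zero_right, norm_smul, Real.norm_of_nonneg (by positivity),
        div_mul_cancel₀ _ hv'.ne']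
      linarith
    have h3 := hball h2
    rw [hhom, abs_of_pos (by positivity)] at h3
    have : r * N v < 2 * ‖v‖ := by
      have := mul_lt_mul_of_pos_right h3 (by positivity : 0 < 2 * ‖v‖)
      field_simp at this
      linarith
    rw [div_mul_eq_mul_div, le_div_iff₀ hr]
    linarith
  obtain ⟨C, hC⟩ := hup
  -- The radial factors have no limit at `0` in general, but boundedness suffices there because they
  -- multiply a map that tends to `0`.
  have key : ∀ (f : E → ℝ) (A : E →L[ℝ] E), ContinuousOn f {0}ᶜ → ∀ D, (∀ u, |f u| ≤ D) →
      Continuous fun u => f u • A u := by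
    intro f A hf D hD
    refine continuous_iff_continuousAt.2 fun u => ?_
    rcases eq_or_ne u 0 with rfl | hu
    · have : Tendsto (fun u => f u • A u) (𝓝 0) (𝓝 0) := by
        refine squeeze_zero_norm (a := fun u => D * ‖A u‖) (fun u => ?_) ?_
        · rw [norm_smul]
          exact mul_le_mul_of_nonneg_right (hD u) (norm_nonneg _)
        · have : Continuous fun u => D * ‖A u‖ := by fun_prop
          simpa using this.tendsto 0
      simpa [ContinuousAt] using this
    · exact (hf.continuousAt (isOpen_compl_singleton.mem_nhds hu)).smul A.continuous.continuousAt
  have hL0 : ∀ u, u ≠ 0 → L u ≠ 0 := fun u hu => by simpa using hu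
  have hLs0 : ∀ u, u ≠ 0 → L.symm u ≠ 0 := fun u hu => by simpa using hu
  -- The image `w` of `u` satisfies `N w = ‖u‖` and `L.symm w` is a positive multiple of `u` when `u
  -- ≠ 0`, which dictates the inverse.
  refine ⟨{ toFun := fun u => (‖u‖ / N (L u)) • L u
            invFun := fun w => (N w / ‖L.symm w‖) • L.symm w
            left_inv := ?_
            right_inv := ?_
            continuous_toFun := ?_
            continuous_invFun := ?_ }, fun u => rfl⟩
  · intro u
    rcases eq_or_ne u 0 with rfl | hu
    · simp
    have h1 := norm_pos_iff.2 hu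
    have h2 := hpos _ (hL0 u hu)
    simp only [map_smul, L.symm_apply_apply, hhom, norm_smul, smul_smul, norm_div, norm_norm,
      Real.norm_of_nonneg h2.le, abs_div, abs_norm, abs_of_pos h2]
    convert one_smul ℝ u using 2
    field_simp
  · intro w
    rcases eq_or_ne w 0 with rfl | hw
    · simp
    have h1 := norm_pos_iff.2 (hLs0 w hw)
    have h2 := hpos _ hw
    simp only [map_smul, L.apply_symm_apply, hhom, norm_smul, smul_smul, norm_div, norm_norm,
      Real.norm_of_nonneg h2.le, abs_div, abs_norm, abs_of_pos h2]
    convert one_smul ℝ w using 2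
    field_simp
  · refine key (fun u => ‖u‖ / N (L u)) L ?_ (‖(L.symm : E →L[ℝ] E)‖ / c) ?_
    · exact continuous_norm.continuousOn.div (hN.comp L.continuous).continuousOn
        fun u hu => (hpos _ (hL0 u hu)).ne'
    · intro u
      rcases eq_or_ne u 0 with rfl | hu
      · simp; positivity
      have h2 := hpos _ (hL0 u hu)
      rw [abs_of_nonneg (by positivity), div_le_div_iff₀ h2 hc]
      have h3 : ‖u‖ ≤ ‖(L.symm : E →L[ℝ] E)‖ * ‖L u‖ := by
        simpa using (L.symm : E →L[ℝ] E).le_opNorm (L u)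
      calc ‖u‖ * c ≤ ‖(L.symm : E →L[ℝ] E)‖ * (c * ‖L u‖) := by nlinarith
        _ ≤ _ := by gcongr; exact hlow _
  · refine key (fun w => N w / ‖L.symm w‖) L.symm ?_ (|C| * ‖(L : E →L[ℝ] E)‖) ?_
    · exact hN.continuousOn.div (L.symm.continuous.norm).continuousOn
        fun u hu => (norm_pos_iff.2 (hLs0 u hu)).ne'
    · intro w
      rcases eq_or_ne w 0 with rfl | hw
      · simp; positivity
      have h1 := norm_pos_iff.2 (hLs0 w hw)
      have h2 := hpos _ hw
      rw [abs_of_nonneg (by positivity), div_le_iff₀ h1]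
      have h3 : ‖w‖ ≤ ‖(L : E →L[ℝ] E)‖ * ‖L.symm w‖ := by
        simpa using (L : E →L[ℝ] E).le_opNorm (L.symm w)
      calc N w ≤ C * ‖w‖ := hC w
        _ ≤ |C| * ‖w‖ := by gcongr; exact le_abs_self C
        _ ≤ _ := by rw [mul_assoc]; gcongr

/-- A linear homeomorphism that moves a complement of `V` into the kernel of `f`, provided that
`f` has a section with values in `V`. -/
theorem exists_equiv_mapsTo_ker {E F : Type*} [NormedAddCommGroup E] [NormedSpace ℝ E]
    [AddCommGroup F] [Module ℝ F] {V W : Submodule ℝ E} (hVW : V.IsTopCompl W)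
    (f : E →ₗ[ℝ] F) (Q : E →L[ℝ] E) (hQf : ∀ u, f (Q u) = f u) (hQ : ∀ u, Q u ∈ V) :
    ∃ L : E ≃L[ℝ] E, ∀ u ∈ W, f (L u) = 0 := by
  -- `P` projects onto `W` along `V`. Since `Q` takes values in `V = ker P`, the map `T = Q P`
  -- squares to zero, so `1 - T` has inverse `1 + T`; on `W` it is `u - Q u`, which `f` kills.
  let P := W.projectionL V hVW.symm
  let T : E →L[ℝ] E := Q.comp P
  have hT : ∀ u, T (T u) = 0 := by
    intro u
    have : P (T u) = 0 := (Submodule.projectionL_apply_eq_zero_iff hVW.symm).2 (hQ _)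
    change Q (P (T u)) = 0
    rw [this, map_zero]
  refine ⟨ContinuousLinearEquiv.equivOfInverse (ContinuousLinearMap.id ℝ E - T)
    (ContinuousLinearMap.id ℝ E + T) (fun u => by simp [hT]) (fun u => by simp [hT]),
    fun u hu => ?_⟩
  have hP : P u = u := (Submodule.projectionL_eq_self_iff hVW.symm u).2 hu
  change f (u - Q (P u)) = 0
  rw [hP, map_sub, hQf, sub_self]

/-- The minimax values of a functional that is bounded below by `a‖u‖ᵖ - b S(u)^q` tend to `∞`
if the seminorm `S` is small relative to the norm on subspaces of finite codimension. -/
theorem tendsto_minimaxValue_top {E : Type*} [NormedAddCommGroup E] [NormedSpace ℝ E]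
    {I : E → ℝ} {S : Seminorm ℝ E} {a b C p q : ℝ} (ha : 0 < a) (hb : 0 < b) (hC : 0 < C)
    (hp : 0 < p) (hpq : p < q)
    (hI : ∀ u, a * ‖u‖ ^ p - b * S u ^ q ≤ I u) (hS : ∀ u, S u ≤ C * ‖u‖)
    (hsmall : ∀ ε > 0, ∃ (ι : Type) (_ : Finite ι) (f : E →L[ℝ] (ι → ℝ)),
      ∀ u, f u = 0 → S u ≤ ε * ‖u‖)
    {V W : ℕ → Submodule ℝ E} (hV : Monotone V)
    (hd : Dense (Submodule.span ℝ (⋃ m, (V m : Set E)) : Set E))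
    (hVW : ∀ m, (V m).IsTopCompl (W m)) :
    Tendsto (fun m : ℕ => minimaxValue I (W (m - 1))) atTop (𝓝 ⊤) := by
  have hq : 0 < q := hp.trans hpq
  -- Inside radius `r` the bound `S ≤ C‖·‖` alone makes the `q`-term smaller than the `p`-term.
  obtain ⟨r, hr, hrC⟩ : ∃ r : ℝ, 0 < r ∧ b * C ^ q * r ^ (q - p) ≤ a := by
    refine ⟨(a / (b * C ^ q)) ^ (q - p)⁻¹, by positivity, ?_⟩
    rw [Real.rpow_inv_rpow (by positivity) (by linarith)]
    exact (mul_div_cancel₀ _ (by positivity)).le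
  -- Outside radius `r` the `p`-term is at least `a rᵖ`, which absorbs the `q`-term as long as `S ≤
  -- σ`.
  obtain ⟨σ, hσ, hσr⟩ : ∃ σ : ℝ, 0 < σ ∧ b * σ ^ q ≤ a * r ^ p := by
    refine ⟨(a * r ^ p / b) ^ q⁻¹, by positivity, ?_⟩
    rw [Real.rpow_inv_rpow (by positivity) hq.ne']
    exact (mul_div_cancel₀ _ hb.ne').le
  have hScont : Continuous S :=
    Seminorm.continuous_of_le (q := C.toNNReal • normSeminorm ℝ E)
      (by
        have : Continuous fun u : E => (C.toNNReal : ℝ) * ‖u‖ := by fun_prop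
        exact this)
      (fun u => (hS u).trans_eq (by
        change _ = (C.toNNReal : ℝ) * ‖u‖
        rw [Real.coe_toNNReal _ hC.le]))
  have hnonneg : ∀ v, S v ≤ σ → 0 ≤ I v := by
    intro v hSv
    refine le_trans ?_ (hI v)
    rw [sub_nonneg]
    rcases le_total ‖v‖ r with hvr | hvr
    · rcases eq_or_ne v 0 with rfl | hv
      · simp [Real.zero_rpow hq.ne', Real.zero_rpow hp.ne']
      have hv' := norm_pos_iff.2 hv
      calc b * S v ^ q ≤ b * (C * ‖v‖) ^ q := by gcongr; exact hS v
        _ = b * C ^ q * ‖v‖ ^ (q - p) * ‖v‖ ^ p := by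
          rw [Real.mul_rpow hC.le hv'.le, Real.rpow_sub hv']; field_simp
        _ ≤ b * C ^ q * r ^ (q - p) * ‖v‖ ^ p := by
          gcongr
        _ ≤ a * ‖v‖ ^ p := by gcongr
    · calc b * S v ^ q ≤ b * σ ^ q := by gcongr
        _ ≤ a * r ^ p := hσr
        _ ≤ a * ‖v‖ ^ p := by gcongr
  rw [EReal.tendsto_nhds_top_iff_real]
  intro M
  obtain ⟨R, hR, hRM⟩ : ∃ R : ℝ, 0 < R ∧ M < a * R ^ p - b * σ ^ q := by
    have h1 : Tendsto (fun R : ℝ => a * R ^ p - b * σ ^ q) atTop atTop :=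
      tendsto_atTop_add_const_right _ _ ((tendsto_rpow_atTop hp).const_mul_atTop ha)
    obtain ⟨R, h⟩ := ((eventually_gt_atTop 0).and (h1.eventually_gt_atTop M)).exists
    exact ⟨R, h⟩
  obtain ⟨ι, hι, f, hf⟩ := hsmall (σ / R) (by positivity)
  obtain ⟨Q, hQf, m₀, hQ⟩ := exists_section_of_dense hV hd f
  -- The shift by one compensates for the index `m - 1` of the complement.
  filter_upwards [eventually_ge_atTop (m₀ + 1)] with m hm
  obtain ⟨L, hL⟩ := exists_equiv_mapsTo_ker (hVW (m - 1)) f.toLinearMap Q hQf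
    (hQ (m - 1) (by omega))
  let N : E → ℝ := fun v => max (‖v‖ / R) (S v / σ)
  have hhom : ∀ (c : ℝ) v, N (c • v) = |c| * N v := by
    intro c v
    simp only [N]
    rw [mul_max_of_nonneg _ _ (abs_nonneg c), norm_smul, map_smul_eq_mul, Real.norm_eq_abs,
      mul_div_assoc, mul_div_assoc]
  have hlow : ∀ v, R⁻¹ * ‖v‖ ≤ N v := fun v => by
    rw [inv_mul_eq_div]; exact le_max_left _ _
  obtain ⟨h, hh⟩ := exists_radial_homeomorph N (by fun_prop) hhom (inv_pos.2 hR) hlow L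
  -- Thus `h` sends the unit ball into `{N ≤ 1} ⊆ {S ≤ σ}`, where `I` is nonnegative.
  have hNh : ∀ u, u ≠ 0 → N (h u) = ‖u‖ := by
    intro u hu
    have hLu : L u ≠ 0 := by simpa using hu
    have h2 : 0 < N (L u) := (mul_pos (inv_pos.2 hR) (norm_pos_iff.2 hLu)).trans_le (hlow _)
    rw [hh, hhom, abs_of_nonneg (by positivity), div_mul_cancel₀ _ h2.ne']
  have hmem : h ∈ oddHomeoClass I := by
    refine ⟨by simp [hh], fun u => ?_, ?_⟩
    · have : N (-L u) = N (L u) := by simpa using hhom (-1) (L u)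
      rw [hh, hh, map_neg, norm_neg, this, smul_neg]
    · rintro _ ⟨u, hu, rfl⟩
      rw [mem_closedBall_zero_iff] at hu
      have hN1 : N (h u) ≤ 1 := by
        rcases eq_or_ne u 0 with rfl | hu0
        · simp [hh, N]
        · rw [hNh u hu0]; exact hu
      refine hnonneg (h u) ?_
      simpa [div_le_one hσ] using (le_max_right _ _).trans hN1
  refine (EReal.coe_lt_coe_iff.2 hRM).trans_le ?_
  refine le_iSup₂_of_le h hmem (le_iInf₂ fun u hu => EReal.coe_le_coe_iff.2 ?_)
  have hu1 : ‖u‖ = 1 := by simpa using hu.1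
  have hu0 : u ≠ 0 := by rw [← norm_pos_iff, hu1]; exact one_pos
  have hfh : f (h u) = 0 := by
    rw [hh, map_smul]
    have : f (L u) = 0 := hL u hu.2
    rw [this, smul_zero]
  have hSh := hf (h u) hfh
  -- On `ker f` the norm part attains the maximum defining `N`, so `N (h u) = 1` means `‖h u‖ = R`.
  have hle : S (h u) / σ ≤ ‖h u‖ / R := by
    rw [div_le_div_iff₀ hσ hR]
    have := mul_le_mul_of_nonneg_right hSh hR.le
    field_simp at this
    linarith
  have hnorm : ‖h u‖ = R := by
    have h1 := hNh u hu0
    simp only [N] at h1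
    rw [max_eq_left hle, hu1, div_eq_one_iff_eq hR.ne'] at h1
    exact h1
  refine le_trans ?_ (hI (h u))
  have hSσ : S (h u) ≤ σ := by
    rw [hnorm, div_self hR.ne', div_le_one hσ] at hle
    exact hle
  rw [hnorm]
  gcongr

/-! ### Increments and Jensen's inequality. -/

section LineEstimates

/-- Jensen's inequality for powers on a measure space of arbitrary total mass. -/
theorem lintegral_rpow_le_measure_mul {α : Type*} [MeasurableSpace α] (μ : Measure α)
    {f : α → ℝ≥0∞} (hf : AEMeasurable f μ) {p : ℝ} (hp : 1 ≤ p) :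
    (∫⁻ x, f x ∂μ) ^ p ≤ μ univ ^ (p - 1) * ∫⁻ x, f x ^ p ∂μ := by
  rcases hp.eq_or_lt with rfl | hp1
  · simp
  have hp0 : 0 < p := by linarith
  have hpq := Real.HolderConjugate.conjExponent hp1
  have h := ENNReal.lintegral_mul_le_Lp_mul_Lq μ hpq hf (g := fun _ => 1) aemeasurable_const
  simp only [Pi.mul_apply, mul_one, ENNReal.one_rpow, lintegral_const, one_mul] at h
  calc (∫⁻ x, f x ∂μ) ^ p ≤ ((∫⁻ x, f x ^ p ∂μ) ^ (1 / p) * μ univ ^ (1 / p.conjExponent)) ^ p := by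
        gcongr
    _ = _ := by
        rw [ENNReal.mul_rpow_of_nonneg _ _ hp0.le, ← ENNReal.rpow_mul, ← ENNReal.rpow_mul,
          one_div_mul_cancel hp0.ne', ENNReal.rpow_one, mul_comm]
        congr 2
        rw [Real.conjExponent]
        field_simp

/-- The `p`-th power of an increment is at most the mean of the `p`-th power of the derivative
along the segment. -/
theorem enorm_sub_rpow_le_lintegral_fderiv {E : Type*} [NormedAddCommGroup E] [NormedSpace ℝ E]
    {Φ : E → ℝ} (hΦ : ContDiff ℝ 1 Φ) (x z : E) {p : ℝ} (hp : 1 ≤ p) :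
    ‖Φ x - Φ (x + z)‖ₑ ^ p ≤ ∫⁻ t in Icc (0 : ℝ) 1, ‖fderiv ℝ Φ (x + t • z) z‖ₑ ^ p := by
  have hderiv : ∀ t : ℝ, HasDerivAt (fun t : ℝ => Φ (x + t • z))
      (fderiv ℝ Φ (x + t • z) z) t := by
    intro t
    have h1 : HasDerivAt (fun t : ℝ => x + t • z) z t := by
      simpa using ((hasDerivAt_id t).smul_const z).const_add x
    exact ((hΦ.differentiable one_ne_zero).differentiableAt.hasFDerivAt).comp_hasDerivAt t h1
  have hcont : Continuous fun t : ℝ => fderiv ℝ Φ (x + t • z) z :=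
    ((hΦ.continuous_fderiv one_ne_zero).comp (by fun_prop)).clm_apply continuous_const
  have hFTC := intervalIntegral.integral_eq_sub_of_hasDerivAt (a := 0) (b := 1)
    (fun t _ => hderiv t) (hcont.intervalIntegrable _ _)
  simp only [one_smul, zero_smul, add_zero] at hFTC
  rw [← enorm_neg, neg_sub, ← hFTC, intervalIntegral.integral_of_le zero_le_one,
    ← integral_Icc_eq_integral_Ioc]
  calc _ ≤ (∫⁻ t in Icc (0 : ℝ) 1, ‖fderiv ℝ Φ (x + t • z) z‖ₑ) ^ p := by
        gcongr; exact enorm_integral_le_lintegral_enorm _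
    _ ≤ _ := by
        refine (lintegral_rpow_le_measure_mul _
          (hcont.measurable.enorm.aemeasurable) hp).trans_eq ?_
        simp

end LineEstimates

/-! ### Poincaré inequality in linear coordinates. -/

section Coordinates

variable {n : ℕ}

/-- The density of `dx₁/x₁ dx₂/x₂ dx'` in linear coordinates. -/
noncomputable def coordDens (y : Fin (n + 2) → ℝ) : ℝ≥0∞ := ENNReal.ofReal (y 0 * y 1)⁻¹

/-- The measure `dx₁/x₁ dx₂/x₂ dx'` in linear coordinates. -/
noncomputable def coordVol (n : ℕ) : Measure (Fin (n + 2) → ℝ) := volume.withDensity coordDens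

/-- `C¹` functions with compact support in `(0,δ) × (0,δ) × [-R,R]ⁿ`. -/
structure IsCoordTest (δ R : ℝ) (Φ : (Fin (n + 2) → ℝ) → ℝ) : Prop where
  smooth : ContDiff ℝ 1 Φ
  compact : HasCompactSupport Φ
  mem_zero : ∀ y ∈ tsupport Φ, y 0 ∈ Ioo 0 δ
  mem_one : ∀ y ∈ tsupport Φ, y 1 ∈ Ioo 0 δ
  abs_le : ∀ y ∈ tsupport Φ, ∀ i, |y i| ≤ R

/-- `G` dominates every component of the corner gradient of `Φ`. -/
structure DominatesGrad (Φ : (Fin (n + 2) → ℝ) → ℝ) (G : (Fin (n + 2) → ℝ) → ℝ≥0∞) : Prop where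
  meas : Measurable G
  zero : ∀ y, ‖y 0 * fderiv ℝ Φ y (Pi.single 0 1)‖ₑ ≤ G y
  one : ∀ y, ‖y 0 * y 1 * fderiv ℝ Φ y (Pi.single 1 1)‖ₑ ≤ G y
  other : ∀ y i, i ≠ 0 → i ≠ 1 → ‖fderiv ℝ Φ y (Pi.single i 1)‖ₑ ≤ G y

theorem measurable_coordDens : Measurable (coordDens (n := n)) := by
  unfold coordDens
  fun_prop

theorem lintegral_coordVol {f : (Fin (n + 2) → ℝ) → ℝ≥0∞} (hf : Measurable f) :
    ∫⁻ y, f y ∂(coordVol n) = ∫⁻ y, coordDens y * f y := by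
  rw [coordVol, lintegral_withDensity_eq_lintegral_mul _ measurable_coordDens hf]
  rfl

/-- The Poincaré inequality in a direction `i` in which the support is bounded. -/
theorem lintegral_rpow_le_of_dominatesGrad {δ R p : ℝ} (hp : 1 ≤ p) (i : Fin (n + 2)) (h0 : i ≠ 0)
    (h1 : i ≠ 1) {Φ : (Fin (n + 2) → ℝ) → ℝ} (hΦ : IsCoordTest δ R Φ)
    {G : (Fin (n + 2) → ℝ) → ℝ≥0∞} (hG : DominatesGrad Φ G) :
    ∫⁻ y, ‖Φ y‖ₑ ^ p ∂(coordVol n) ≤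
      ENNReal.ofReal (2 * |R| + 1) ^ p * ∫⁻ y, G y ^ p ∂(coordVol n) := by
  have hp0 : 0 ≤ p := by linarith
  -- A translation by `ρ` exceeds the width of the support in direction `i`, so `Φ (y + z) = 0`
  -- wherever `Φ y ≠ 0`, and `Φ y` is an increment.
  set ρ : ℝ := 2 * |R| + 1 with hρ
  have hρ0 : 0 < ρ := by positivity
  let z : Fin (n + 2) → ℝ := ρ • Pi.single i 1
  have hz0 : z 0 = 0 := by simp [z, Pi.single_eq_of_ne h0.symm]
  have hz1 : z 1 = 0 := by simp [z, Pi.single_eq_of_ne h1.symm]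
  have hzi : z i = ρ := by simp [z]
  have hΦm : Measurable fun y => ‖Φ y‖ₑ ^ p :=
    hΦ.smooth.continuous.measurable.enorm.pow_const _
  have hDc : Continuous fun y => fderiv ℝ Φ y z :=
    (hΦ.smooth.continuous_fderiv one_ne_zero).clm_apply continuous_const
  have hDm : Measurable fun y => coordDens y * ‖fderiv ℝ Φ y z‖ₑ ^ p :=
    measurable_coordDens.mul (hDc.measurable.enorm.pow_const _)
  -- The density depends only on the first two coordinates, which is why the direction must differ
  -- from both.
  have hdens : ∀ (t : ℝ) y, coordDens (y + t • z) = coordDens y := by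
    intro t y
    simp [coordDens, hz0, hz1]
  have hpt : ∀ y, coordDens y * ‖Φ y‖ₑ ^ p ≤
      ∫⁻ t in Icc (0 : ℝ) 1, coordDens (y + t • z) * ‖fderiv ℝ Φ (y + t • z) z‖ₑ ^ p := by
    intro y
    by_cases hy : Φ y = 0
    · simp [hy, show 0 < p by linarith]
    have hyR := hΦ.abs_le y (subset_tsupport _ hy) i
    have hyz : Φ (y + z) = 0 := by
      by_contra hne
      have h2 := hΦ.abs_le (y + z) (subset_tsupport _ hne) i
      rw [Pi.add_apply, hzi] at h2
      have := le_abs_self R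
      have := abs_le.1 hyR
      have := abs_le.1 h2
      have := abs_nonneg R
      linarith
    have h := enorm_sub_rpow_le_lintegral_fderiv hΦ.smooth y z hp
    rw [hyz, sub_zero] at h
    simp only [hdens]
    rw [lintegral_const_mul _ (by
      have : Continuous fun t : ℝ => fderiv ℝ Φ (y + t • z) z := hDc.comp (by fun_prop)
      exact this.measurable.enorm.pow_const _)]
    gcongr
  calc ∫⁻ y, ‖Φ y‖ₑ ^ p ∂(coordVol n) = ∫⁻ y, coordDens y * ‖Φ y‖ₑ ^ p := lintegral_coordVol hΦm
    _ ≤ ∫⁻ y, ∫⁻ t in Icc (0 : ℝ) 1,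
          coordDens (y + t • z) * ‖fderiv ℝ Φ (y + t • z) z‖ₑ ^ p := lintegral_mono hpt
    _ = ∫⁻ t in Icc (0 : ℝ) 1, ∫⁻ y,
          coordDens (y + t • z) * ‖fderiv ℝ Φ (y + t • z) z‖ₑ ^ p :=
        lintegral_lintegral_swap
          (hDm.comp (f := fun q : (Fin (n + 2) → ℝ) × ℝ => q.1 + q.2 • z)
            (by fun_prop)).aemeasurable
    _ = ∫⁻ t in Icc (0 : ℝ) 1, ∫⁻ y, coordDens y * ‖fderiv ℝ Φ y z‖ₑ ^ p := by
        congr 1 with t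
        exact lintegral_add_right_eq_self (fun y => coordDens y * ‖fderiv ℝ Φ y z‖ₑ ^ p) (t • z)
    _ = ∫⁻ y, coordDens y * ‖fderiv ℝ Φ y z‖ₑ ^ p := by simp
    _ ≤ ∫⁻ y, ENNReal.ofReal ρ ^ p * (coordDens y * G y ^ p) := by
        refine lintegral_mono fun y => ?_
        rw [mul_left_comm, ← ENNReal.mul_rpow_of_nonneg _ _ hp0]
        gcongr
        simp only [z, map_smul, enorm_smul]
        rw [Real.enorm_of_nonneg hρ0.le]
        gcongr
        exact hG.other y i h0 h1
    _ = _ := by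
        rw [lintegral_const_mul' _ _ (ENNReal.rpow_ne_top_of_nonneg hp0 ENNReal.ofReal_ne_top),
          lintegral_coordVol (hG.meas.pow_const _)]

end Coordinates

/-! ### Gagliardo–Nirenberg estimate at exponent one, and powers of a test function. -/

section WeightedSobolev

variable {n : ℕ}

theorem coord_fderiv_eq_zero {Φ : (Fin (n + 2) → ℝ) → ℝ} {y : Fin (n + 2) → ℝ}
    (hy : y ∉ tsupport Φ) : fderiv ℝ Φ y = 0 :=
  image_eq_zero_of_notMem_tsupport fun h => hy (tsupport_fderiv_subset ℝ h)

/-- Fundamental theorem of calculus on the `i`-th coordinate line, starting where `Φ` already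
vanishes. -/
theorem enorm_le_lintegral_fderiv_update {Φ : (Fin (n + 2) → ℝ) → ℝ} (hΦ : ContDiff ℝ 1 Φ)
    (hc : HasCompactSupport Φ) (y : Fin (n + 2) → ℝ) (i : Fin (n + 2)) :
    ‖Φ y‖ₑ ≤ ∫⁻ t, ‖fderiv ℝ Φ (Function.update y i t) (Pi.single i 1)‖ₑ := by
  calc ‖Φ y‖ₑ
    _ ≤ ∫⁻ t in Iic (y i), ‖deriv (Φ ∘ Function.update y i) t‖ₑ := by
        apply le_trans (by simp) (HasCompactSupport.enorm_le_lintegral_Ici_deriv _ _ _)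
        · exact hΦ.comp (by convert! contDiff_update 1 y i)
        · exact hc.comp_isClosedEmbedding (isClosedEmbedding_update y i)
    _ ≤ ∫⁻ t, ‖deriv (Φ ∘ Function.update y i) t‖ₑ := setLIntegral_le_lintegral _ _
    _ = _ := by
        congr 1 with t
        rw [fderiv_comp_deriv _ (hΦ.differentiable one_ne_zero).differentiableAt
          (hasDerivAt_update y i t).differentiableAt, deriv_update]

/-- The Gagliardo–Nirenberg inequality for the corner gradient at the exponent `1`. -/
theorem lintegral_weighted_le_lintegral_grad {δ R : ℝ} {W : (Fin (n + 2) → ℝ) → ℝ}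
    (hW : IsCoordTest δ R W) {G : (Fin (n + 2) → ℝ) → ℝ≥0∞} (hG : DominatesGrad W G) :
    ∫⁻ y, ENNReal.ofReal (y 0) ^ (1 / ((n : ℝ) + 1)) * ‖W y‖ₑ ^ (((n : ℝ) + 2) / (n + 1))
      ∂(coordVol n) ≤ (∫⁻ y, G y ∂(coordVol n)) ^ (((n : ℝ) + 2) / (n + 1)) := by
  have hn1 : (0 : ℝ) < (n : ℝ) + 1 := by positivity
  have hWm : Measurable fun y => ‖W y‖ₑ := hW.smooth.continuous.measurable.enorm
  have hp : Real.HolderConjugate (Fintype.card (Fin (n + 2))) (((n : ℝ) + 2) / (n + 1)) := by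
    rw [Real.holderConjugate_iff]
    refine ⟨by simp; linarith, ?_⟩
    simp only [Fintype.card_fin]
    push_cast
    field_simp
    ring
  rw [lintegral_coordVol hG.meas, lintegral_coordVol (by fun_prop)]
  have hfm : Measurable fun y => coordDens y * G y := measurable_coordDens.mul hG.meas
  -- The grid-line inequality bounds the integral of a product of line integrals of `coordDens * G`.
  -- It remains to bound each line integral below by a multiple of `‖W y‖ₑ`; the coefficients of the
  -- corner gradient cancel the density factors varying along the line.
  refine le_trans ?_ (lintegral_prod_lintegral_pow_le (fun _ : Fin (n + 2) => (volume : Measure ℝ))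
    hp hfm)
  refine lintegral_mono fun y => ?_
  by_cases hy : W y = 0
  · have : (0 : ℝ) < ((n : ℝ) + 2) / (n + 1) := by positivity
    simp [hy, this]
  have hyt := subset_tsupport _ hy
  have hy0 : 0 < y 0 := (hW.mem_zero y hyt).1
  have hy1 : 0 < y 1 := (hW.mem_one y hyt).1
  -- lower bounds for the integrals along the coordinate lines
  have key0 : ENNReal.ofReal (y 1)⁻¹ * ‖W y‖ₑ ≤
      ∫⁻ t, coordDens (Function.update y 0 t) * G (Function.update y 0 t) := by
    refine (mul_le_mul_right (enorm_le_lintegral_fderiv_update hW.smooth hW.compact y 0) _).trans ?_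
    rw [← lintegral_const_mul' _ _ ENNReal.ofReal_ne_top]
    refine lintegral_mono fun t => ?_
    by_cases ht : Function.update y 0 t ∈ tsupport W
    · have ht0 : 0 < t := by simpa using (hW.mem_zero _ ht).1
      refine le_trans (le_of_eq ?_) (mul_le_mul_right (hG.zero _) _)
      simp only [coordDens, Function.update_self]
      rw [Function.update_of_ne (by simp), enorm_mul, ← mul_assoc, Real.enorm_of_nonneg ht0.le,
        ← ENNReal.ofReal_mul (by positivity)]
      congr 2
      field_simp
    · simp [coord_fderiv_eq_zero ht]
  have key1 : ‖W y‖ₑ ≤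
      ∫⁻ t, coordDens (Function.update y 1 t) * G (Function.update y 1 t) := by
    refine (enorm_le_lintegral_fderiv_update hW.smooth hW.compact y 1).trans ?_
    refine lintegral_mono fun t => ?_
    by_cases ht : Function.update y 1 t ∈ tsupport W
    · have ht0 : 0 < t := by simpa using (hW.mem_one _ ht).1
      refine le_trans (le_of_eq ?_) (mul_le_mul_right (hG.one _) _)
      simp only [coordDens, Function.update_self]
      rw [Function.update_of_ne (by simp), enorm_mul, ← mul_assoc,
        Real.enorm_of_nonneg (mul_pos hy0 ht0).le, ← ENNReal.ofReal_mul (by positivity),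
        inv_mul_cancel₀ (by positivity)]
      simp
    · simp [coord_fderiv_eq_zero ht]
  have key2 : ∀ i : Fin n, coordDens y * ‖W y‖ₑ ≤
      ∫⁻ t, coordDens (Function.update y i.succ.succ t) * G (Function.update y i.succ.succ t) := by
    intro i
    refine (mul_le_mul_right (enorm_le_lintegral_fderiv_update hW.smooth hW.compact y
      i.succ.succ) _).trans ?_
    rw [← lintegral_const_mul' (coordDens y) _ ENNReal.ofReal_ne_top]
    refine lintegral_mono fun t => ?_
    have e0 : coordDens (Function.update y i.succ.succ t) = coordDens y := by
      simp only [coordDens]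
      rw [Function.update_of_ne (Fin.succ_ne_zero _).symm, Function.update_of_ne]
      rw [← Fin.succ_zero_eq_one]
      exact fun h => Fin.succ_ne_zero _ (Fin.succ_injective _ h).symm
    rw [e0]
    gcongr
    refine hG.other _ _ (Fin.succ_ne_zero _) ?_
    rw [← Fin.succ_zero_eq_one]
    exact fun h => Fin.succ_ne_zero _ (Fin.succ_injective _ h)
  have hcard : ((Fintype.card (Fin (n + 2)) : ℝ) - 1) = (n : ℝ) + 1 := by simp; ring
  rw [hcard]
  have hr : (0 : ℝ) ≤ 1 / ((n : ℝ) + 1) := by positivity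
  rw [Fin.prod_univ_succ, Fin.prod_univ_succ]
  calc _ = (ENNReal.ofReal (y 1)⁻¹ * ‖W y‖ₑ) ^ (1 / ((n : ℝ) + 1)) *
        (‖W y‖ₑ ^ (1 / ((n : ℝ) + 1)) *
          ∏ _i : Fin n, (coordDens y * ‖W y‖ₑ) ^ (1 / ((n : ℝ) + 1))) := by
        rw [ENNReal.prod_rpow_of_nonneg hr, ← ENNReal.mul_rpow_of_nonneg _ _ hr,
          ← ENNReal.mul_rpow_of_nonneg _ _ hr, Finset.prod_const, Finset.card_univ,
          Fintype.card_fin]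
        have e1 : coordDens y = (coordDens y ^ (n + 1)) ^ (1 / ((n : ℝ) + 1)) := by
          rw [← ENNReal.rpow_natCast, ← ENNReal.rpow_mul]
          push_cast
          rw [mul_one_div_cancel hn1.ne', ENNReal.rpow_one]
        have e2 : ‖W y‖ₑ ^ (((n : ℝ) + 2) / (n + 1)) = (‖W y‖ₑ ^ (n + 2)) ^ (1 / ((n : ℝ) + 1)) := by
          rw [← ENNReal.rpow_natCast, ← ENNReal.rpow_mul]
          push_cast
          congr 1
          ring
        conv_lhs => rw [e1, e2]
        rw [← ENNReal.mul_rpow_of_nonneg _ _ hr, ← ENNReal.mul_rpow_of_nonneg _ _ hr]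
        congr 1
        -- The `n + 2` lines contribute `y₁⁻¹ · 1 · (y₀y₁)⁻ⁿ = y₀ (y₀y₁)^{-(n+1)}`. The power
        -- `1/(n+1)` returns one density and leaves the weight `y₀^{1/(n+1)}`.
        have e3 : coordDens y * ENNReal.ofReal (y 0) = ENNReal.ofReal (y 1)⁻¹ := by
          rw [coordDens, ← ENNReal.ofReal_mul (by positivity)]
          congr 1
          field_simp
        rw [← e3, mul_pow]
        ring
    _ ≤ _ := by
        gcongr
        · exact key1
        · exact key2 _

/-- Directional derivatives of `y₀ᵃ |Φ|^γ`. -/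
theorem abs_fderiv_weighted_rpow_le {Φ : (Fin (n + 2) → ℝ) → ℝ} (hΦ : ContDiff ℝ 1 Φ) {a γ : ℝ}
    (ha : 0 ≤ a) (hγ : 1 < γ) {y : Fin (n + 2) → ℝ} (hy : 0 < y 0) (c : ℝ) (v : Fin (n + 2) → ℝ)
    (hc : |c * v 0| ≤ y 0) :
    |c * fderiv ℝ (fun y => y 0 ^ a * |Φ y| ^ γ) y v| ≤
      y 0 ^ a * |Φ y| ^ (γ - 1) * (a * |Φ y| + γ * |c * fderiv ℝ Φ y v|) := by
  have h1 : HasFDerivAt (fun y : Fin (n + 2) → ℝ => y 0 ^ a)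
      ((a * y 0 ^ (a - 1)) • (ContinuousLinearMap.proj 0 : (Fin (n + 2) → ℝ) →L[ℝ] ℝ)) y :=
    HasFDerivAt.rpow_const (f := fun y : Fin (n + 2) → ℝ => y 0)
      (ContinuousLinearMap.proj 0 : (Fin (n + 2) → ℝ) →L[ℝ] ℝ).hasFDerivAt (Or.inl hy.ne')
  have h2 : HasFDerivAt (fun y => |Φ y| ^ γ)
      ((γ * |Φ y| ^ (γ - 2) * Φ y) • fderiv ℝ Φ y) y :=
    (hasDerivAt_abs_rpow (Φ y) hγ).comp_hasFDerivAt y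
      ((hΦ.differentiable one_ne_zero).differentiableAt.hasFDerivAt)
  rw [(h1.fun_mul h2).fderiv]
  simp only [add_apply, smul_apply, smul_eq_mul,
    ContinuousLinearMap.proj_apply]
  have e1 : |γ * |Φ y| ^ (γ - 2) * Φ y| = γ * |Φ y| ^ (γ - 1) := by
    rw [abs_mul, abs_of_nonneg (by positivity), mul_assoc]
    congr 1
    rcases eq_or_ne (Φ y) 0 with h | h
    · simp [h, Real.zero_rpow (show γ - 1 ≠ 0 by linarith)]
    · rw [← Real.rpow_add_one (abs_pos.2 h).ne']
      congr 1
      ring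
  have e2 : |Φ y| ^ γ = |Φ y| ^ (γ - 1) * |Φ y| := by
    rcases eq_or_ne (Φ y) 0 with h | h
    · simp [h, Real.zero_rpow (show γ ≠ 0 by linarith)]
    · rw [← Real.rpow_add_one (abs_pos.2 h).ne']
      congr 1
      ring
  have e3 : y 0 ^ a = y 0 ^ (a - 1) * y 0 := by
    rw [← Real.rpow_add_one hy.ne']
    congr 1
    ring
  calc _ = |y 0 ^ a * (γ * |Φ y| ^ (γ - 2) * Φ y) * (c * fderiv ℝ Φ y v) +
          |Φ y| ^ γ * (a * y 0 ^ (a - 1)) * (c * v 0)| := by congr 1; ring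
    _ ≤ |y 0 ^ a * (γ * |Φ y| ^ (γ - 2) * Φ y) * (c * fderiv ℝ Φ y v)| +
          |(|Φ y| ^ γ * (a * y 0 ^ (a - 1))) * (c * v 0)| := abs_add_le _ _
    _ = y 0 ^ a * (γ * |Φ y| ^ (γ - 1)) * |c * fderiv ℝ Φ y v| +
          |Φ y| ^ γ * (a * y 0 ^ (a - 1)) * |c * v 0| := by
        rw [abs_mul, abs_mul, e1, abs_of_nonneg (by positivity : 0 ≤ y 0 ^ a),
          abs_mul _ (c * v 0), abs_of_nonneg (by positivity : 0 ≤ |Φ y| ^ γ * (a * y 0 ^ (a - 1)))]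
    _ ≤ y 0 ^ a * (γ * |Φ y| ^ (γ - 1)) * |c * fderiv ℝ Φ y v| +
          |Φ y| ^ γ * (a * y 0 ^ (a - 1)) * y 0 := by gcongr
    _ = _ := by rw [e2, e3]; ring

theorem tsupport_weighted_rpow_subset {Φ : (Fin (n + 2) → ℝ) → ℝ} {a γ : ℝ} (hγ : 1 < γ) :
    tsupport (fun y : Fin (n + 2) → ℝ => y 0 ^ a * |Φ y| ^ γ) ⊆ tsupport Φ := by
  refine closure_mono fun y hy => ?_
  contrapose! hy
  simp only [Function.mem_support, not_not] at hy ⊢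
  simp [hy, Real.zero_rpow (show γ ≠ 0 by linarith)]

/-- The weight is smooth on the support, where `y₀ > 0`, and `γ > 1` makes `|Φ|^γ` of class `C¹`
across the zeros of `Φ`. -/
theorem IsCoordTest.weighted_rpow {δ R : ℝ} {Φ : (Fin (n + 2) → ℝ) → ℝ} (hΦ : IsCoordTest δ R Φ)
    {a γ : ℝ} (hγ : 1 < γ) : IsCoordTest δ R fun y => y 0 ^ a * |Φ y| ^ γ where
  smooth := by
    rw [contDiff_iff_contDiffAt]
    intro y
    by_cases hy : y ∈ tsupport Φ
    · refine ContDiffAt.mul ?_ ?_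
      · exact (contDiff_apply ℝ ℝ (0 : Fin (n + 2))).contDiffAt.rpow_const_of_ne
          (hΦ.mem_zero y hy).1.ne'
      · exact (hΦ.smooth.norm_rpow hγ).contDiffAt
    · have hev : ∀ᶠ z in 𝓝 y, z ∉ tsupport Φ :=
        (isClosed_tsupport Φ).isOpen_compl.mem_nhds hy
      refine (contDiffAt_const (c := (0 : ℝ))).congr_of_eventuallyEq ?_
      filter_upwards [hev] with z hz
      simp [image_eq_zero_of_notMem_tsupport hz, Real.zero_rpow (show γ ≠ 0 by linarith)]
  compact := hΦ.compact.mono' ((subset_tsupport _).trans (tsupport_weighted_rpow_subset hγ))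
  mem_zero y hy := hΦ.mem_zero y (tsupport_weighted_rpow_subset hγ hy)
  mem_one y hy := hΦ.mem_one y (tsupport_weighted_rpow_subset hγ hy)
  abs_le y hy := hΦ.abs_le y (tsupport_weighted_rpow_subset hγ hy)

/-- The operator `y₀∂₀` multiplies `y₀ᵃ` by `a`, and the other directions do not see it. The weight
therefore costs only a zero-order term. -/
theorem DominatesGrad.weighted_rpow {δ R : ℝ} {Φ : (Fin (n + 2) → ℝ) → ℝ}
    (hΦ : IsCoordTest δ R Φ) {G : (Fin (n + 2) → ℝ) → ℝ≥0∞} (hG : DominatesGrad Φ G)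
    {a γ : ℝ} (ha : 0 ≤ a) (hγ : 1 < γ) :
    DominatesGrad (fun y => y 0 ^ a * |Φ y| ^ γ) fun y =>
      (ENNReal.ofReal (y 0) ^ a * ‖Φ y‖ₑ ^ (γ - 1)) *
        (ENNReal.ofReal a * ‖Φ y‖ₑ + ENNReal.ofReal γ * G y) := by
  have hγ0 : 0 < γ := by linarith
  -- The condition on `c * v 0` treats all directions at once: it is an equality for `y₀∂₀`, and its
  -- left side is `0` for every other component.
  have key : ∀ (y : Fin (n + 2) → ℝ) (c : ℝ) (v : Fin (n + 2) → ℝ), |c * v 0| ≤ |y 0| →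
      ‖c * fderiv ℝ Φ y v‖ₑ ≤ G y →
      ‖c * fderiv ℝ (fun y => y 0 ^ a * |Φ y| ^ γ) y v‖ₑ ≤
      (ENNReal.ofReal (y 0) ^ a * ‖Φ y‖ₑ ^ (γ - 1)) *
        (ENNReal.ofReal a * ‖Φ y‖ₑ + ENNReal.ofReal γ * G y) := by
    intro y c v hc hle
    by_cases hy : y ∈ tsupport Φ
    · have hy0 := (hΦ.mem_zero y hy).1
      rw [abs_of_pos hy0] at hc
      have h := abs_fderiv_weighted_rpow_le hΦ.smooth ha hγ hy0 c v hc
      calc _ ≤ ENNReal.ofReal (y 0 ^ a * |Φ y| ^ (γ - 1) *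
            (a * |Φ y| + γ * |c * fderiv ℝ Φ y v|)) := by
            rw [Real.enorm_eq_ofReal_abs]; exact ENNReal.ofReal_le_ofReal h
        _ = (ENNReal.ofReal (y 0) ^ a * ‖Φ y‖ₑ ^ (γ - 1)) *
            (ENNReal.ofReal a * ‖Φ y‖ₑ + ENNReal.ofReal γ * ‖c * fderiv ℝ Φ y v‖ₑ) := by
            rw [ENNReal.ofReal_mul (by positivity), ENNReal.ofReal_mul (by positivity),
              ENNReal.ofReal_add (by positivity) (by positivity), ENNReal.ofReal_mul ha,
              ENNReal.ofReal_mul hγ0.le, ENNReal.ofReal_rpow_of_pos hy0,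
              ← ENNReal.ofReal_rpow_of_nonneg (abs_nonneg (Φ y)) (by linarith),
              Real.enorm_eq_ofReal_abs, Real.enorm_eq_ofReal_abs]
        _ ≤ _ := by gcongr
    · have : y ∉ tsupport fun y : Fin (n + 2) → ℝ => y 0 ^ a * |Φ y| ^ γ :=
        fun h => hy (tsupport_weighted_rpow_subset hγ h)
      simp [coord_fderiv_eq_zero this]
  refine ⟨?_, fun y => key y _ _ (by simp) (hG.zero y), fun y => key y _ _ (by simp) (hG.one y),
    fun y i h0 h1 => ?_⟩
  · have := hG.meas
    have := hΦ.smooth.continuous.measurable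
    fun_prop
  · have := key y 1 (Pi.single i 1) (by simp [Pi.single_eq_of_ne h0.symm])
    simp only [one_mul] at this
    exact this (hG.other y i h0 h1)

end WeightedSobolev

/-! ### The Sobolev inequality at the critical exponent. -/

section WeightedSobolev

variable {n : ℕ}

/-- The compact support stays away from `y₀ = 0` and `y₁ = 0`, so the integrand is bounded.
Finiteness is what later permits division by a power of the left side of the Sobolev inequality. -/
theorem IsCoordTest.lintegral_weighted_lt_top {δ R : ℝ} {Φ : (Fin (n + 2) → ℝ) → ℝ}
    (hΦ : IsCoordTest δ R Φ) (e : ℝ) {s : ℝ} (hs : 0 < s) :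
    ∫⁻ y, ENNReal.ofReal (y 0) ^ e * ‖Φ y‖ₑ ^ s ∂(coordVol n) < ⊤ := by
  have hm : Measurable fun y => ‖Φ y‖ₑ := hΦ.smooth.continuous.measurable.enorm
  rw [lintegral_coordVol (by fun_prop)]
  have hcont : ContinuousOn (fun y : Fin (n + 2) → ℝ => (y 0 * y 1)⁻¹ * (y 0 ^ e * |Φ y| ^ s))
      (tsupport Φ) := by
    have h0 : ContinuousOn (fun y : Fin (n + 2) → ℝ => y 0) (tsupport Φ) :=
      (continuous_apply 0).continuousOn
    have h1 : ContinuousOn (fun y : Fin (n + 2) → ℝ => y 1) (tsupport Φ) :=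
      (continuous_apply 1).continuousOn
    refine ((h0.mul h1).inv₀ fun y hy => ?_).mul ((h0.rpow_const fun y hy => Or.inl ?_).mul
      (hΦ.smooth.continuous.abs.continuousOn.rpow_const fun _ _ => Or.inr hs.le))
    · exact (mul_pos (hΦ.mem_zero y hy).1 (hΦ.mem_one y hy).1).ne'
    · exact (hΦ.mem_zero y hy).1.ne'
  obtain ⟨B, hB⟩ := IsCompact.exists_bound_of_continuousOn hΦ.compact hcont
  calc _ ≤ ∫⁻ y in tsupport Φ, ENNReal.ofReal B := by
        rw [← lintegral_indicator (isClosed_tsupport Φ).measurableSet]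
        refine lintegral_mono fun y => ?_
        by_cases hy : y ∈ tsupport Φ
        · have h0 := (hΦ.mem_zero y hy).1
          have h1 := (hΦ.mem_one y hy).1
          rw [indicator_of_mem hy]
          refine le_trans (le_of_eq ?_) (ENNReal.ofReal_le_ofReal ((le_abs_self _).trans (hB y hy)))
          rw [coordDens, Real.enorm_eq_ofReal_abs, ENNReal.ofReal_rpow_of_pos h0,
            ENNReal.ofReal_rpow_of_nonneg (abs_nonneg _) hs.le,
            ENNReal.ofReal_mul (by positivity), ENNReal.ofReal_mul (by positivity)]
        · simp [image_eq_zero_of_notMem_tsupport hy, hs]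
    _ = ENNReal.ofReal B * volume (tsupport Φ) := by simp
    _ < ⊤ := ENNReal.mul_lt_top ENNReal.ofReal_lt_top (IsCompact.measure_lt_top hΦ.compact)

/-- The Sobolev inequality for the corner gradient at the critical exponent `p* = Np/(N-p)`,
with weight `x₁^{p*/N}`. -/
theorem exists_weighted_sobolev_const {p : ℝ} (hp : 1 < p) (hpN : p < (n : ℝ) + 2) :
    ∃ C : ℝ≥0∞, C ≠ ⊤ ∧ ∀ (δ R : ℝ) (Φ : (Fin (n + 2) → ℝ) → ℝ) (G : (Fin (n + 2) → ℝ) → ℝ≥0∞),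
      IsCoordTest δ R Φ → DominatesGrad Φ G →
      ∫⁻ y, ENNReal.ofReal (y 0) ^ (p / ((n : ℝ) + 2 - p)) *
          ‖Φ y‖ₑ ^ (((n : ℝ) + 2) * p / ((n : ℝ) + 2 - p)) ∂(coordVol n) ≤
        C * (∫⁻ y, ‖Φ y‖ₑ ^ p ∂(coordVol n) + ∫⁻ y, G y ^ p ∂(coordVol n)) ^
          (((n : ℝ) + 2) / ((n : ℝ) + 2 - p)) := by
  have hp0 : 0 < p := by linarith
  obtain ⟨D, hD, hDN⟩ : ∃ D : ℝ, 0 < D ∧ (n : ℝ) + 2 - p = D := ⟨_, by linarith, rfl⟩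
  rw [hDN]
  obtain ⟨N, hN⟩ : ∃ N : ℝ, (n : ℝ) + 2 = N := ⟨_, rfl⟩
  have hN1 : (n : ℝ) + 1 = N - 1 := by linarith
  have hNpos : 1 < N := by linarith
  have hDN' : N = D + p := by linarith
  rw [hN]
  -- With `p'` the conjugate exponent of `p`, these choices give `a p' = p/D` and `(γ - 1) p' =
  -- Np/D`, and also `(1 + aN)/(N-1) = p/D` and `γN/(N-1) = Np/D`. Hence the same integral `I`
  -- appears on both sides after Hölder.
  set a : ℝ := (p - 1) / D with ha
  set γ : ℝ := p * (N - 1) / D with hγ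
  have ha0 : 0 ≤ a := div_nonneg (by linarith) hD.le
  have hγ1 : 1 < γ := by
    rw [hγ, lt_div_iff₀ hD]
    nlinarith
  have hs : 0 < N * p / D := by positivity
  refine ⟨(ENNReal.ofReal (a + γ) ^ p * 2 ^ (p - 1)) ^ (N / D), by
    refine ENNReal.rpow_ne_top_of_nonneg (by positivity) (ENNReal.mul_ne_top ?_ ?_)
    · exact ENNReal.rpow_ne_top_of_nonneg hp0.le ENNReal.ofReal_ne_top
    · exact ENNReal.rpow_ne_top_of_nonneg (by linarith) (by simp), fun δ R Φ G hΦ hG => ?_⟩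
  have hm : Measurable fun y => ‖Φ y‖ₑ := hΦ.smooth.continuous.measurable.enorm
  have hGm := hG.meas
  set I := ∫⁻ y, ENNReal.ofReal (y 0) ^ (p / D) * ‖Φ y‖ₑ ^ (N * p / D) ∂(coordVol n) with hI
  set K := ∫⁻ y, (ENNReal.ofReal a * ‖Φ y‖ₑ + ENNReal.ofReal γ * G y) ^ p ∂(coordVol n) with hK
  have hIfin : I ≠ ⊤ := (hΦ.lintegral_weighted_lt_top _ hs).ne
  -- the estimate at exponent one, applied to `y₀ᵃ |Φ|^γ`
  have h1 := lintegral_weighted_le_lintegral_grad (hΦ.weighted_rpow (a := a) hγ1)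
    (hG.weighted_rpow hΦ ha0 hγ1)
  rw [hN, hN1] at h1
  have e1 : ∫⁻ y, ENNReal.ofReal (y 0) ^ (1 / (N - 1)) *
      ‖y 0 ^ a * |Φ y| ^ γ‖ₑ ^ (N / (N - 1)) ∂(coordVol n) = I := by
    refine lintegral_congr fun y => ?_
    have hNN : 0 < N / (N - 1) := div_pos (by linarith) (by linarith)
    by_cases hy : y ∈ tsupport Φ
    · have h0 := (hΦ.mem_zero y hy).1
      rw [enorm_mul, Real.enorm_of_nonneg (by positivity), Real.enorm_of_nonneg (by positivity),
        ← ENNReal.ofReal_rpow_of_pos h0, ← ENNReal.ofReal_rpow_of_nonneg (abs_nonneg _)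
          (by linarith), ← Real.enorm_eq_ofReal_abs, ENNReal.mul_rpow_of_nonneg _ _ hNN.le,
        ← ENNReal.rpow_mul, ← ENNReal.rpow_mul, ← mul_assoc,
        ← ENNReal.rpow_add _ _ (by simpa using h0) ENNReal.ofReal_ne_top]
      have hN1' : N - 1 ≠ 0 := by linarith
      congr 2
      · rw [ha, hDN']
        rw [hDN'] at hN1'
        field_simp
        ring
      · rw [hγ]
        field_simp
    · rw [image_eq_zero_of_notMem_tsupport hy]
      simp [hNN, hs, Real.zero_rpow (show γ ≠ 0 by linarith)]
  rw [e1] at h1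
  -- Hölder's inequality
  have hpq := Real.HolderConjugate.conjExponent hp
  have h2 := ENNReal.lintegral_mul_le_Lp_mul_Lq (coordVol n) hpq.symm
    (f := fun y => ENNReal.ofReal (y 0) ^ a * ‖Φ y‖ₑ ^ (γ - 1))
    (g := fun y => ENNReal.ofReal a * ‖Φ y‖ₑ + ENNReal.ofReal γ * G y)
    (by fun_prop) (by fun_prop)
  have hp1 : p - 1 ≠ 0 := by linarith
  have e2 : ∫⁻ y, (ENNReal.ofReal (y 0) ^ a * ‖Φ y‖ₑ ^ (γ - 1)) ^ p.conjExponent ∂(coordVol n)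
      = I := by
    refine lintegral_congr fun y => ?_
    rw [ENNReal.mul_rpow_of_nonneg _ _ hpq.symm.nonneg, ← ENNReal.rpow_mul, ← ENNReal.rpow_mul]
    congr 2
    · rw [ha, Real.conjExponent]
      field_simp
    · rw [hγ, Real.conjExponent, hDN']
      field_simp
      ring
  rw [e2, ← hK] at h2
  have h3 : I ≤ (I ^ (1 / p.conjExponent) * K ^ (1 / p)) ^ (N / (N - 1)) :=
    h1.trans (ENNReal.rpow_le_rpow h2 (div_nonneg (by linarith) (by linarith)))
  -- absorption
  have h4 : I ≤ K ^ (N / D) := by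
    rcases eq_or_ne I 0 with h0 | h0
    · rw [h0]; exact zero_le
    have hNp : 0 < (N - 1) / N := div_pos (by linarith) (by linarith)
    have h5 := ENNReal.rpow_le_rpow h3 hNp.le
    have e3 : N / (N - 1) * ((N - 1) / N) = 1 := by
      have : N - 1 ≠ 0 := by linarith
      field_simp
    rw [← ENNReal.rpow_mul, e3, ENNReal.rpow_one] at h5
    -- The exponent left after cancelling is `(N-1)/N - 1/p' = 1/p - 1/N = D/(Np)`, positive because
    -- `p < N`.
    have e4 : I ^ ((N - 1) / N) = I ^ (1 / p.conjExponent) * I ^ (D / (N * p)) := by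
      rw [← ENNReal.rpow_add _ _ h0 hIfin]
      congr 1
      rw [Real.conjExponent, hDN']
      field_simp
      ring
    rw [e4] at h5
    have hne0 : I ^ (1 / p.conjExponent) ≠ 0 := by
      simp [ENNReal.rpow_eq_zero_iff, h0, hIfin]
    have hnetop : I ^ (1 / p.conjExponent) ≠ ⊤ :=
      ENNReal.rpow_ne_top_of_nonneg (one_div_nonneg.2 hpq.symm.nonneg) hIfin
    have h6 : I ^ (D / (N * p)) ≤ K ^ (1 / p) := (ENNReal.mul_le_mul_iff_right hne0 hnetop).1 h5
    have h7 := ENNReal.rpow_le_rpow h6 (show 0 ≤ N * p / D by positivity)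
    rw [← ENNReal.rpow_mul, ← ENNReal.rpow_mul] at h7
    convert h7 using 2
    · rw [show D / (N * p) * (N * p / D) = 1 by field_simp, ENNReal.rpow_one]
    · field_simp
  have h8 : K ≤ ENNReal.ofReal (a + γ) ^ p * 2 ^ (p - 1) *
      (∫⁻ y, ‖Φ y‖ₑ ^ p ∂(coordVol n) + ∫⁻ y, G y ^ p ∂(coordVol n)) := by
    rw [← lintegral_add_left (by fun_prop), ← lintegral_const_mul _ (by fun_prop)]
    refine lintegral_mono fun y => ?_
    calc (ENNReal.ofReal a * ‖Φ y‖ₑ + ENNReal.ofReal γ * G y) ^ p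
        ≤ (ENNReal.ofReal (a + γ) * ‖Φ y‖ₑ + ENNReal.ofReal (a + γ) * G y) ^ p := by
          gcongr <;> linarith
      _ = ENNReal.ofReal (a + γ) ^ p * (‖Φ y‖ₑ + G y) ^ p := by
          rw [← mul_add, ENNReal.mul_rpow_of_nonneg _ _ hp0.le]
      _ ≤ _ := by
          rw [mul_assoc]
          gcongr
          exact ENNReal.rpow_add_le_mul_rpow_add_rpow _ _ hp.le
  refine h4.trans ((ENNReal.rpow_le_rpow h8 (by positivity)).trans_eq ?_)
  rw [ENNReal.mul_rpow_of_nonneg _ _ (by positivity)]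

end WeightedSobolev

/-! ### Small `Lᵖ` norm from vanishing cube means, away from the singular faces. -/

section Cubes

variable {n : ℕ}

/-- The half-open cube of side `h` with lower corner `h k`. -/
def coordCube (h : ℝ) (k : Fin (n + 2) → ℤ) : Set (Fin (n + 2) → ℝ) :=
  univ.pi fun i => Ico (h * k i) (h * k i + h)

theorem measurableSet_coordCube (h : ℝ) (k : Fin (n + 2) → ℤ) : MeasurableSet (coordCube h k) :=
  MeasurableSet.univ_pi fun _ => measurableSet_Ico

theorem volume_coordCube (h : ℝ) (k : Fin (n + 2) → ℤ) :
    volume (coordCube h k) = ENNReal.ofReal h ^ (n + 2) := by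
  rw [coordCube, Real.volume_pi_Ico]
  simp

theorem mem_coordCube_iff {h : ℝ} (hh : 0 < h) {k : Fin (n + 2) → ℤ} {y : Fin (n + 2) → ℝ} :
    y ∈ coordCube h k ↔ ∀ i, ⌊y i / h⌋ = k i := by
  simp only [coordCube, mem_univ_pi, mem_Ico, Int.floor_eq_iff, le_div_iff₀ hh, div_lt_iff₀ hh]
  refine forall_congr' fun i => ?_
  constructor <;> rintro ⟨h1, h2⟩ <;> constructor <;> linarith

theorem norm_sub_le_of_mem_coordCube {h : ℝ} (hh : 0 < h) {k : Fin (n + 2) → ℤ}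
    {x y : Fin (n + 2) → ℝ} (hx : x ∈ coordCube h k) (hy : y ∈ coordCube h k) : ‖y - x‖ ≤ h := by
  rw [pi_norm_le_iff_of_nonneg hh.le]
  intro i
  have h1 := hx i (mem_univ i)
  have h2 := hy i (mem_univ i)
  rw [Pi.sub_apply, Real.norm_eq_abs, abs_le]
  constructor <;> linarith [h1.1, h1.2, h2.1, h2.2]

/-- A bound for the full derivative by the corner gradient away from the singular faces. -/
theorem enorm_fderiv_rpow_le {δ R p c : ℝ} (hp : 1 ≤ p) (hc : 0 < c) {Φ : (Fin (n + 2) → ℝ) → ℝ}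
    (hΦ : IsCoordTest δ R Φ) {G : (Fin (n + 2) → ℝ) → ℝ≥0∞} (hG : DominatesGrad Φ G)
    {y z : Fin (n + 2) → ℝ} {h : ℝ} (hz : ‖z‖ ≤ h) (h0 : c ≤ y 0) (h1 : c ≤ y 1) :
    ‖fderiv ℝ Φ y z‖ₑ ^ p ≤
      (ENNReal.ofReal (h * ((n + 2) * (1 + c⁻¹ + (c ^ 2)⁻¹))) ^ p * ENNReal.ofReal (δ ^ 2)) *
        (coordDens y * G y ^ p) := by
  have hp0 : 0 < p := by linarith
  by_cases hy : y ∈ tsupport Φ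
  swap
  · simp [coord_fderiv_eq_zero hy, hp0]
  have hh : 0 ≤ h := (norm_nonneg z).trans hz
  have hy0 := hΦ.mem_zero y hy
  have hy1 := hΦ.mem_one y hy
  -- One constant that dominates the inverses of all three coefficients `1`, `y₀`, `y₀y₁` when `y₀,
  -- y₁ ≥ c`.
  set B : ℝ := 1 + c⁻¹ + (c ^ 2)⁻¹ with hB
  have hB1 : 1 ≤ B := by
    have : 0 < c⁻¹ + (c ^ 2)⁻¹ := by positivity
    linarith
  have hB2 : 1 ≤ B * c := by
    have : B * c = 1 + c + c⁻¹ := by rw [hB]; field_simp; ring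
    rw [this]
    have : 0 < c⁻¹ := by positivity
    linarith
  have hB3 : 1 ≤ B * c ^ 2 := by
    have : B * c ^ 2 = 1 + c + c ^ 2 := by rw [hB]; field_simp; ring
    rw [this]
    nlinarith
  have hstep : ∀ (w d : ℝ), 1 ≤ B * w → 0 < w → ‖d‖ₑ ≤ ENNReal.ofReal B * ‖w * d‖ₑ := by
    intro w d hw hw0
    rw [enorm_mul, Real.enorm_of_nonneg hw0.le, ← mul_assoc, ← ENNReal.ofReal_mul (by linarith)]
    calc ‖d‖ₑ = 1 * ‖d‖ₑ := (one_mul _).symm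
      _ ≤ _ := by
        gcongr
        simpa using ENNReal.ofReal_le_ofReal hw
  have hcomp : ∀ i, ‖fderiv ℝ Φ y (Pi.single i 1)‖ₑ ≤ ENNReal.ofReal B * G y := by
    intro i
    by_cases hi0 : i = 0
    · subst hi0
      refine (hstep (y 0) _ ?_ hy0.1).trans (by gcongr; exact hG.zero y)
      exact hB2.trans (by gcongr)
    by_cases hi1 : i = 1
    · subst hi1
      refine (hstep (y 0 * y 1) _ ?_ (mul_pos hy0.1 hy1.1)).trans (by gcongr; exact hG.one y)
      refine hB3.trans ?_
      rw [pow_two]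
      gcongr
      exact hy0.1.le
    · refine (hstep 1 _ (by linarith) one_pos).trans ?_
      rw [one_mul]
      gcongr
      exact hG.other y i hi0 hi1
  have hsum : ‖fderiv ℝ Φ y z‖ₑ ≤ ENNReal.ofReal (h * ((n + 2) * B)) * G y := by
    have hzs : z = ∑ i, z i • (Pi.single i (1 : ℝ) : Fin (n + 2) → ℝ) := by
      ext j
      simp [Finset.sum_apply, Pi.single_apply]
    calc ‖fderiv ℝ Φ y z‖ₑ = ‖∑ i, z i • fderiv ℝ Φ y (Pi.single i 1)‖ₑ := by
          conv_lhs => rw [hzs, map_sum]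
          simp only [map_smul]
      _ ≤ ∑ i, ‖z i • fderiv ℝ Φ y (Pi.single i 1)‖ₑ := enorm_sum_le _ _
      _ ≤ ∑ _i : Fin (n + 2), ENNReal.ofReal h * (ENNReal.ofReal B * G y) := by
          gcongr with i
          rw [enorm_smul]
          gcongr
          · rw [Real.enorm_eq_ofReal_abs]
            exact ENNReal.ofReal_le_ofReal ((norm_le_pi_norm z i).trans hz)
          · exact hcomp i
      _ = _ := by
          rw [Finset.sum_const, Finset.card_univ, Fintype.card_fin, nsmul_eq_mul,
            ENNReal.ofReal_mul hh, ENNReal.ofReal_mul (by positivity),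
            show (n : ℝ) + 2 = ((n + 2 : ℕ) : ℝ) by push_cast; ring, ENNReal.ofReal_natCast]
          ring
  -- On the support `y₀y₁ < δ²`, so Lebesgue measure is at most `δ²` times the weighted one.
  have hdens : 1 ≤ ENNReal.ofReal (δ ^ 2) * coordDens y := by
    rw [coordDens, ← ENNReal.ofReal_mul (by positivity)]
    rw [← ENNReal.ofReal_one]
    refine ENNReal.ofReal_le_ofReal ?_
    rw [← div_eq_mul_inv, one_le_div (mul_pos hy0.1 hy1.1), pow_two]
    exact mul_le_mul hy0.2.le hy1.2.le hy1.1.le (hy0.1.trans hy0.2).le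
  calc ‖fderiv ℝ Φ y z‖ₑ ^ p ≤ (ENNReal.ofReal (h * ((n + 2) * B)) * G y) ^ p := by gcongr
    _ = (ENNReal.ofReal (h * ((n + 2) * B)) ^ p) * G y ^ p * 1 := by
        rw [ENNReal.mul_rpow_of_nonneg _ _ hp0.le, mul_one]
    _ ≤ (ENNReal.ofReal (h * ((n + 2) * B)) ^ p) * G y ^ p *
          (ENNReal.ofReal (δ ^ 2) * coordDens y) := by gcongr
    _ = _ := by ring

/-- The `Lᵖ` modulus of continuity under small translations, away from the singular faces. -/
theorem lintegral_enorm_sub_translate_le {δ R p c : ℝ} (hp : 1 ≤ p) (hc : 0 < c)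
    {Φ : (Fin (n + 2) → ℝ) → ℝ}
    (hΦ : IsCoordTest δ R Φ) {G : (Fin (n + 2) → ℝ) → ℝ≥0∞} (hG : DominatesGrad Φ G)
    {z : Fin (n + 2) → ℝ} {h : ℝ} (hz : ‖z‖ ≤ h) (hhc : h ≤ c) :
    ∫⁻ x in {y | 2 * c ≤ y 0 ∧ 2 * c ≤ y 1}, ‖Φ x - Φ (x + z)‖ₑ ^ p ≤
      (ENNReal.ofReal (h * ((n + 2) * (1 + c⁻¹ + (c ^ 2)⁻¹))) ^ p * ENNReal.ofReal (δ ^ 2)) *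
        ∫⁻ y, G y ^ p ∂(coordVol n) := by
  set T := ENNReal.ofReal (h * ((n + 2) * (1 + c⁻¹ + (c ^ 2)⁻¹))) ^ p * ENNReal.ofReal (δ ^ 2)
    with hT
  have hTtop : T ≠ ⊤ := ENNReal.mul_ne_top
    (ENNReal.rpow_ne_top_of_nonneg (by linarith) ENNReal.ofReal_ne_top) ENNReal.ofReal_ne_top
  let f : (Fin (n + 2) → ℝ) → ℝ≥0∞ := fun y => coordDens y * G y ^ p
  have hf : Measurable f := measurable_coordDens.mul (hG.meas.pow_const _)
  have hA : MeasurableSet {y : Fin (n + 2) → ℝ | 2 * c ≤ y 0 ∧ 2 * c ≤ y 1} :=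
    (measurableSet_le measurable_const (measurable_pi_apply 0)).inter
      (measurableSet_le measurable_const (measurable_pi_apply 1))
  calc _ ≤ ∫⁻ x in {y | 2 * c ≤ y 0 ∧ 2 * c ≤ y 1}, ∫⁻ t in Icc (0 : ℝ) 1, T * f (x + t • z) := by
        refine setLIntegral_mono' hA fun x hx => ?_
        refine (enorm_sub_rpow_le_lintegral_fderiv hΦ.smooth x z hp).trans ?_
        refine setLIntegral_mono' measurableSet_Icc fun t ht => ?_
        -- A displacement of at most `c` from the region `≥ 2c` keeps the segment in the region `≥
        -- c`.
        have hzi : ∀ i, -c ≤ t * z i := by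
          intro i
          have h1 : |z i| ≤ c := (norm_le_pi_norm z i).trans (hz.trans hhc)
          have h2 : |t * z i| ≤ c := by
            rw [abs_mul, abs_of_nonneg ht.1]
            calc t * |z i| ≤ 1 * |z i| := by gcongr; exact ht.2
              _ ≤ c := by linarith
          exact (abs_le.1 h2).1
        refine enorm_fderiv_rpow_le hp hc hΦ hG hz ?_ ?_
        · have := hzi 0
          have := hx.1
          simp only [Pi.add_apply, Pi.smul_apply, smul_eq_mul]
          linarith
        · have := hzi 1
          have := hx.2
          simp only [Pi.add_apply, Pi.smul_apply, smul_eq_mul]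
          linarith
    _ ≤ ∫⁻ x, ∫⁻ t in Icc (0 : ℝ) 1, T * f (x + t • z) := setLIntegral_le_lintegral _ _
    _ = ∫⁻ t in Icc (0 : ℝ) 1, ∫⁻ x, T * f (x + t • z) :=
        lintegral_lintegral_swap
          ((hf.const_mul T).comp (f := fun q : (Fin (n + 2) → ℝ) × ℝ => q.1 + q.2 • z)
            (by fun_prop)).aemeasurable
    _ = ∫⁻ t in Icc (0 : ℝ) 1, ∫⁻ x, T * f x := by
        congr 1 with t
        exact lintegral_add_right_eq_self (fun x => T * f x) (t • z)
    _ = T * ∫⁻ x, f x := by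
        rw [lintegral_const_mul' _ _ hTtop]
        simp
    _ = _ := by rw [lintegral_coordVol (hG.meas.pow_const _)]

/-- A function on a cube is controlled by its mean and its oscillation. -/
theorem enorm_rpow_le_of_mem_coordCube {p h : ℝ} (hp : 1 ≤ p) (hh : 0 < h)
    {Φ : (Fin (n + 2) → ℝ) → ℝ} (hΦ : Continuous Φ) (hc : HasCompactSupport Φ)
    {k : Fin (n + 2) → ℤ} {x : Fin (n + 2) → ℝ} (hx : x ∈ coordCube h k) :
    ‖Φ x‖ₑ ^ p ≤ 2 ^ (p - 1) * (((ENNReal.ofReal h ^ (n + 2))⁻¹) ^ p *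
        ‖∫ y in coordCube h k, Φ y‖ₑ ^ p +
      (ENNReal.ofReal h ^ (n + 2))⁻¹ *
        ∫⁻ z in Metric.closedBall (0 : Fin (n + 2) → ℝ) h, ‖Φ x - Φ (x + z)‖ₑ ^ p) := by
  have hp0 : 0 < p := by linarith
  set Q := coordCube h k with hQ
  set v := ENNReal.ofReal h ^ (n + 2) with hv
  have hvQ : volume Q = v := volume_coordCube h k
  have hv0 : v ≠ 0 := pow_ne_zero _ (by simpa using hh)
  have hvtop : v ≠ ⊤ := ENNReal.pow_ne_top ENNReal.ofReal_ne_top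
  have hΦint : Integrable Φ := hΦ.integrable_of_hasCompactSupport hc
  have hconst : IntegrableOn (fun _ => Φ x) Q := integrableOn_const (by rw [hvQ]; exact hvtop)
  have hm : Measurable fun y => ‖Φ x - Φ y‖ₑ := (continuous_const.sub hΦ).measurable.enorm
  -- Integrate `Φ x = Φ y + (Φ x - Φ y)` over `y ∈ Q`.
  have h1 : v * ‖Φ x‖ₑ ≤ ‖∫ y in Q, Φ y‖ₑ + ∫⁻ y in Q, ‖Φ x - Φ y‖ₑ := by
    have e1 : (∫ y in Q, Φ y) + ∫ y in Q, (Φ x - Φ y) = v.toReal * Φ x := by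
      rw [integral_sub hconst hΦint.integrableOn]
      simp [Measure.real, hvQ]
    have e2 : v * ‖Φ x‖ₑ = ‖v.toReal * Φ x‖ₑ := by
      rw [enorm_mul, Real.enorm_of_nonneg ENNReal.toReal_nonneg, ENNReal.ofReal_toReal hvtop]
    rw [e2, ← e1]
    refine (enorm_add_le _ _).trans ?_
    gcongr
    exact enorm_integral_le_lintegral_enorm _
  -- Enlarging `Q - x` to the sup-norm ball of radius `h` makes the domain of `z` independent of `x`
  -- and of the cube, so that Fubini applies to translations.
  have h2 : (∫⁻ y in Q, ‖Φ x - Φ y‖ₑ) ^ p ≤ v ^ (p - 1) *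
      ∫⁻ z in Metric.closedBall (0 : Fin (n + 2) → ℝ) h, ‖Φ x - Φ (x + z)‖ₑ ^ p := by
    refine (lintegral_rpow_le_measure_mul _ hm.aemeasurable hp).trans ?_
    rw [Measure.restrict_apply_univ, hvQ]
    refine mul_le_mul_right ?_ _
    rw [← lintegral_indicator (measurableSet_coordCube h k),
      ← lintegral_indicator Metric.isClosed_closedBall.measurableSet,
      ← lintegral_add_left_eq_self (Q.indicator fun y => ‖Φ x - Φ y‖ₑ ^ p) x]
    refine lintegral_mono fun z => ?_
    by_cases hz : x + z ∈ Q
    · have : z ∈ Metric.closedBall (0 : Fin (n + 2) → ℝ) h := by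
        rw [mem_closedBall_zero_iff]
        simpa using norm_sub_le_of_mem_coordCube hh hx hz
      rw [indicator_of_mem hz, indicator_of_mem this]
    · rw [indicator_of_notMem hz]
      exact zero_le
  have h3 : ‖Φ x‖ₑ = v⁻¹ * (v * ‖Φ x‖ₑ) := by
    rw [← mul_assoc, ENNReal.inv_mul_cancel hv0 hvtop, one_mul]
  calc ‖Φ x‖ₑ ^ p ≤ (v⁻¹ * (‖∫ y in Q, Φ y‖ₑ + ∫⁻ y in Q, ‖Φ x - Φ y‖ₑ)) ^ p := by
        conv_lhs => rw [h3]
        gcongr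
    _ = v⁻¹ ^ p * (‖∫ y in Q, Φ y‖ₑ + ∫⁻ y in Q, ‖Φ x - Φ y‖ₑ) ^ p :=
        ENNReal.mul_rpow_of_nonneg _ _ hp0.le
    _ ≤ v⁻¹ ^ p * (2 ^ (p - 1) * (‖∫ y in Q, Φ y‖ₑ ^ p +
          (∫⁻ y in Q, ‖Φ x - Φ y‖ₑ) ^ p)) := by
        gcongr
        exact ENNReal.rpow_add_le_mul_rpow_add_rpow _ _ hp
    _ ≤ v⁻¹ ^ p * (2 ^ (p - 1) * (‖∫ y in Q, Φ y‖ₑ ^ p + v ^ (p - 1) *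
      ∫⁻ z in Metric.closedBall (0 : Fin (n + 2) → ℝ) h, ‖Φ x - Φ (x + z)‖ₑ ^ p)) := by gcongr
    _ = _ := by
        have e : v⁻¹ ^ p * v ^ (p - 1) = v⁻¹ := by
          rw [ENNReal.inv_rpow, ← ENNReal.rpow_neg, ← ENNReal.rpow_add _ _ hv0 hvtop,
            ← ENNReal.rpow_neg_one]
          congr 1
          ring
        rw [mul_left_comm, mul_add, ← mul_assoc (v⁻¹ ^ p) (v ^ (p - 1)), e]

/-- Away from the singular faces the `Lᵖ` norm is controlled by a small multiple of the gradient
and finitely many integrals over cubes. -/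
theorem exists_cubes_lintegral_le {δ R p η : ℝ} (hp : 1 ≤ p) (hη : 0 < η) {ε : ℝ≥0∞}
    (hε : 0 < ε) :
    ∃ h > 0, ∃ (J : Finset (Fin (n + 2) → ℤ)) (C : ℝ≥0∞), C ≠ ⊤ ∧
      (∀ k ∈ J, ∀ y ∈ coordCube h k, η / 2 ≤ y 0 ∧ η / 2 ≤ y 1) ∧
      ∀ (Φ : (Fin (n + 2) → ℝ) → ℝ) (G : (Fin (n + 2) → ℝ) → ℝ≥0∞),
      IsCoordTest δ R Φ → DominatesGrad Φ G →
      ∫⁻ y in {y | η ≤ y 0 ∧ η ≤ y 1}, ‖Φ y‖ₑ ^ p ∂(coordVol n) ≤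
        ε * ∫⁻ y, G y ^ p ∂(coordVol n) + C * ∑ k ∈ J, ‖∫ y in coordCube h k, Φ y‖ₑ ^ p := by
  classical
  have hp0 : 0 < p := by linarith
  -- Cubes of side at most `c` that meet `{≥ η}` stay in `{≥ η/2} = {≥ 2c}`, and translates by at
  -- most `c` stay in `{≥ c}`.
  obtain ⟨c, hc⟩ : ∃ c, c = η / 4 := ⟨_, rfl⟩
  have hc0 : 0 < c := by linarith
  set D : ℝ≥0∞ := ENNReal.ofReal (η ^ 2)⁻¹ with hD
  have hDtop : D ≠ ⊤ := ENNReal.ofReal_ne_top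
  have h2top : (2 : ℝ≥0∞) ^ (p - 1) ≠ ⊤ := ENNReal.rpow_ne_top_of_nonneg (by linarith) (by simp)
  set B : ℝ := (n + 2) * (1 + c⁻¹ + (c ^ 2)⁻¹) with hB
  -- the choice of the side length
  obtain ⟨h, hh0, hhc, hhε⟩ : ∃ h : ℝ, 0 < h ∧ h ≤ c ∧
      D * (2 ^ (p - 1) * (2 ^ (n + 2) *
        (ENNReal.ofReal (h * B) ^ p * ENNReal.ofReal (δ ^ 2)))) ≤ ε := by
    have h1 : Continuous fun h : ℝ => ENNReal.ofReal (h * B) ^ p :=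
      ENNReal.continuous_rpow_const.comp (ENNReal.continuous_ofReal.comp (by fun_prop))
    have h2 : Tendsto (fun h : ℝ => D * (2 ^ (p - 1) * (2 ^ (n + 2) *
        (ENNReal.ofReal (h * B) ^ p * ENNReal.ofReal (δ ^ 2))))) (𝓝 0) (𝓝 0) := by
      have h3 := h1.tendsto 0
      simp only [zero_mul, ENNReal.ofReal_zero, ENNReal.zero_rpow_of_pos hp0] at h3
      have h4 := ENNReal.Tendsto.mul_const (b := ENNReal.ofReal (δ ^ 2)) h3
        (Or.inr ENNReal.ofReal_ne_top)
      have h5 := ENNReal.Tendsto.const_mul (a := 2 ^ (n + 2)) h4 (Or.inr (by simp))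
      have h6 := ENNReal.Tendsto.const_mul (a := 2 ^ (p - 1)) h5 (Or.inr h2top)
      have h7 := ENNReal.Tendsto.const_mul (a := D) h6 (Or.inr hDtop)
      simpa using h7
    have h3 := (h2.eventually_le_const hε).filter_mono (nhdsWithin_le_nhds (s := Ioi 0))
    have h4 : ∀ᶠ h : ℝ in 𝓝[>] 0, h ∈ Ioc 0 c := Ioc_mem_nhdsGT hc0
    obtain ⟨h, h5, h6⟩ := (h3.and h4).exists
    exact ⟨h, h6.1, h6.2, h5⟩
  set v : ℝ≥0∞ := ENNReal.ofReal h ^ (n + 2) with hv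
  have hv0 : v ≠ 0 := pow_ne_zero _ (by simpa using hh0)
  have hvtop : v ≠ ⊤ := ENNReal.pow_ne_top ENNReal.ofReal_ne_top
  -- Cubes with an index beyond `M` in absolute value contain no point where a test function is
  -- nonzero, so finitely many cubes suffice.
  obtain ⟨M, hM⟩ := exists_nat_ge (|R| / h + 1)
  let J : Finset (Fin (n + 2) → ℤ) := (Fintype.piFinset fun _ => Finset.Icc (-(M : ℤ)) M).filter
    fun k => ∀ y ∈ coordCube h k, η / 2 ≤ y 0 ∧ η / 2 ≤ y 1
  refine ⟨h, hh0, J, D * (2 ^ (p - 1) * (v * v⁻¹ ^ p)), ?_, fun k hk => (Finset.mem_filter.1 hk).2,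
    fun Φ G hΦ hG => ?_⟩
  · refine ENNReal.mul_ne_top hDtop (ENNReal.mul_ne_top h2top (ENNReal.mul_ne_top hvtop ?_))
    exact ENNReal.rpow_ne_top_of_nonneg hp0.le (by simpa using hv0)
  have hΦm : Measurable fun y => ‖Φ y‖ₑ ^ p := hΦ.smooth.continuous.measurable.enorm.pow_const _
  have hcov : ∀ y, Φ y ≠ 0 → η ≤ y 0 → η ≤ y 1 → ∃ k ∈ J, y ∈ coordCube h k := by
    intro y hy hy0 hy1
    have hmem : y ∈ coordCube h fun i => ⌊y i / h⌋ := (mem_coordCube_iff hh0).2 fun _ => rfl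
    refine ⟨fun i => ⌊y i / h⌋, Finset.mem_filter.2 ⟨?_, fun x hx => ?_⟩, hmem⟩
    · rw [Fintype.mem_piFinset]
      intro i
      have h1 : |y i / h| ≤ |R| / h := by
        rw [abs_div, abs_of_pos hh0]
        refine div_le_div_of_nonneg_right ?_ hh0.le
        exact (hΦ.abs_le y (subset_tsupport _ hy) i).trans (le_abs_self R)
      have h2 := abs_le.1 h1
      rw [Finset.mem_Icc, Int.le_floor]
      refine ⟨by push_cast; linarith, ?_⟩
      have h3 : (⌊y i / h⌋ : ℝ) ≤ M := (Int.floor_le _).trans (by linarith)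
      exact_mod_cast h3
    · have h1 := norm_sub_le_of_mem_coordCube hh0 hx hmem
      have h2 : ∀ i, y i - x i ≤ c := fun i =>
        ((le_abs_self _).trans (norm_le_pi_norm (y - x) i)).trans (h1.trans hhc)
      have := h2 0
      have := h2 1
      constructor <;> linarith
  have hdisj : Pairwise (Function.onFun Disjoint (coordCube (n := n) h)) := by
    intro k l hkl
    refine Set.disjoint_left.2 fun y hk hl => hkl ?_
    ext i
    rw [← (mem_coordCube_iff hh0).1 hk i, ← (mem_coordCube_iff hh0).1 hl i]
  have hA : MeasurableSet {y : Fin (n + 2) → ℝ | η ≤ y 0 ∧ η ≤ y 1} :=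
    (measurableSet_le measurable_const (measurable_pi_apply 0)).inter
      (measurableSet_le measurable_const (measurable_pi_apply 1))
  have hUm : MeasurableSet (⋃ k ∈ J, coordCube h k) :=
    Finset.measurableSet_biUnion _ fun k _ => measurableSet_coordCube h k
  have hUsub : (⋃ k ∈ J, coordCube h k) ⊆
      {y : Fin (n + 2) → ℝ | 2 * c ≤ y 0 ∧ 2 * c ≤ y 1} := by
    refine iUnion₂_subset fun k hk y hy => ?_
    have := (Finset.mem_filter.1 hk).2 y hy
    exact ⟨by linarith [this.1], by linarith [this.2]⟩
  have hsplit : ∀ f : (Fin (n + 2) → ℝ) → ℝ≥0∞,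
      ∫⁻ y in ⋃ k ∈ J, coordCube h k, f y = ∑ k ∈ J, ∫⁻ y in coordCube h k, f y := fun f =>
    lintegral_biUnion_finset (fun k _ l _ hkl => hdisj hkl)
      (fun k _ => measurableSet_coordCube h k) f
  -- pass to Lebesgue measure on the cubes
  have h1 : ∫⁻ y in {y | η ≤ y 0 ∧ η ≤ y 1}, ‖Φ y‖ₑ ^ p ∂(coordVol n) ≤
      D * ∑ k ∈ J, ∫⁻ y in coordCube h k, ‖Φ y‖ₑ ^ p := by
    rw [← hsplit, ← lintegral_const_mul' _ _ hDtop, ← lintegral_indicator hA,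
      ← lintegral_indicator hUm, lintegral_coordVol (hΦm.indicator hA)]
    refine lintegral_mono fun y => ?_
    by_cases hy : y ∈ {y : Fin (n + 2) → ℝ | η ≤ y 0 ∧ η ≤ y 1}
    swap
    · rw [indicator_of_notMem hy]; simp
    by_cases hΦy : Φ y = 0
    · have : ({y : Fin (n + 2) → ℝ | η ≤ y 0 ∧ η ≤ y 1}.indicator (fun y => ‖Φ y‖ₑ ^ p)) y = 0 := by
        rw [indicator_of_mem hy]; simp [hΦy, hp0]
      rw [this]; simp
    obtain ⟨k, hk, hyk⟩ := hcov y hΦy hy.1 hy.2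
    rw [indicator_of_mem hy, indicator_of_mem (mem_iUnion₂.2 ⟨k, hk, hyk⟩)]
    gcongr
    rw [coordDens, hD]
    refine ENNReal.ofReal_le_ofReal ?_
    have h1 := hy.1
    have h2 := hy.2
    rw [pow_two]
    gcongr
    exact hη.le.trans h1
  -- the estimate on the cubes
  set T := ∫⁻ y, G y ^ p ∂(coordVol n) with hT
  let F : (Fin (n + 2) → ℝ) → ℝ≥0∞ := fun x =>
    ∫⁻ z in Metric.closedBall (0 : Fin (n + 2) → ℝ) h, ‖Φ x - Φ (x + z)‖ₑ ^ p
  have hFm : Measurable (Function.uncurry fun x z : Fin (n + 2) → ℝ => ‖Φ x - Φ (x + z)‖ₑ ^ p) := by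
    have := hΦ.smooth.continuous
    have h2 : Continuous fun q : (Fin (n + 2) → ℝ) × (Fin (n + 2) → ℝ) =>
      Φ q.1 - Φ (q.1 + q.2) := by fun_prop
    exact h2.measurable.enorm.pow_const _
  -- The sup-norm ball has volume `2^(n+2) v`. This `v` cancels the `v⁻¹` from averaging, so the
  -- gradient coefficient is of order `hᵖ` however many cubes there are.
  have hF : ∫⁻ x in ⋃ k ∈ J, coordCube h k, F x ≤
      v * (2 ^ (n + 2) * (ENNReal.ofReal (h * B) ^ p * ENNReal.ofReal (δ ^ 2))) * T := by
    calc _ ≤ ∫⁻ x in {y | 2 * c ≤ y 0 ∧ 2 * c ≤ y 1}, F x := lintegral_mono_set hUsub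
      _ = ∫⁻ z in Metric.closedBall (0 : Fin (n + 2) → ℝ) h,
            ∫⁻ x in {y | 2 * c ≤ y 0 ∧ 2 * c ≤ y 1}, ‖Φ x - Φ (x + z)‖ₑ ^ p :=
          lintegral_lintegral_swap hFm.aemeasurable
      _ ≤ ∫⁻ z in Metric.closedBall (0 : Fin (n + 2) → ℝ) h,
            (ENNReal.ofReal (h * B) ^ p * ENNReal.ofReal (δ ^ 2)) * T := by
          refine setLIntegral_mono' Metric.isClosed_closedBall.measurableSet fun z hz => ?_
          exact lintegral_enorm_sub_translate_le hp hc0 hΦ hG (mem_closedBall_zero_iff.1 hz) hhc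
      _ = _ := by
          rw [lintegral_const, Measure.restrict_apply_univ, Real.volume_pi_closedBall _ hh0.le,
            Fintype.card_fin, mul_pow, ENNReal.ofReal_mul (p := (2 : ℝ) ^ (n + 2)) (by positivity),
            ENNReal.ofReal_pow hh0.le, ← hv, ENNReal.ofReal_pow zero_le_two]
          simp only [ENNReal.ofReal_ofNat]
          ring
  have h2 : ∑ k ∈ J, ∫⁻ y in coordCube h k, ‖Φ y‖ₑ ^ p ≤
      2 ^ (p - 1) * ((v * v⁻¹ ^ p) * ∑ k ∈ J, ‖∫ y in coordCube h k, Φ y‖ₑ ^ p) +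
        2 ^ (p - 1) * (2 ^ (n + 2) * (ENNReal.ofReal (h * B) ^ p * ENNReal.ofReal (δ ^ 2)) * T) := by
    have hvi : v⁻¹ ≠ ⊤ := by simpa using hv0
    calc _ ≤ ∑ k ∈ J, ∫⁻ x in coordCube h k, 2 ^ (p - 1) *
            (v⁻¹ ^ p * ‖∫ y in coordCube h k, Φ y‖ₑ ^ p + v⁻¹ * F x) := by
          refine Finset.sum_le_sum fun k _ => ?_
          exact setLIntegral_mono' (measurableSet_coordCube h k) fun x hx =>
            enorm_rpow_le_of_mem_coordCube hp hh0 hΦ.smooth.continuous hΦ.compact hx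
      _ = ∑ k ∈ J, (2 ^ (p - 1) * ((v * v⁻¹ ^ p) * ‖∫ y in coordCube h k, Φ y‖ₑ ^ p) +
            2 ^ (p - 1) * (v⁻¹ * ∫⁻ x in coordCube h k, F x)) := by
          refine Finset.sum_congr rfl fun k _ => ?_
          rw [lintegral_const_mul' _ _ h2top, lintegral_add_left measurable_const,
            lintegral_const, Measure.restrict_apply_univ, volume_coordCube,
            lintegral_const_mul' _ _ hvi, ← hv]
          ring
      _ = 2 ^ (p - 1) * ((v * v⁻¹ ^ p) * ∑ k ∈ J, ‖∫ y in coordCube h k, Φ y‖ₑ ^ p) +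
            2 ^ (p - 1) * (v⁻¹ * ∫⁻ x in ⋃ k ∈ J, coordCube h k, F x) := by
          rw [Finset.sum_add_distrib, ← Finset.mul_sum, ← Finset.mul_sum, ← Finset.mul_sum,
            ← Finset.mul_sum, hsplit]
      _ ≤ 2 ^ (p - 1) * ((v * v⁻¹ ^ p) * ∑ k ∈ J, ‖∫ y in coordCube h k, Φ y‖ₑ ^ p) +
            2 ^ (p - 1) * (v⁻¹ * (v * (2 ^ (n + 2) *
              (ENNReal.ofReal (h * B) ^ p * ENNReal.ofReal (δ ^ 2))) * T)) := by gcongr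
      _ = _ := by
          have e : ∀ b : ℝ≥0∞, v⁻¹ * (v * b * T) = b * T := fun b => by
            rw [mul_assoc v, ← mul_assoc v⁻¹ v, ENNReal.inv_mul_cancel hv0 hvtop, one_mul]
          rw [e]
  calc _ ≤ D * (2 ^ (p - 1) * ((v * v⁻¹ ^ p) * ∑ k ∈ J, ‖∫ y in coordCube h k, Φ y‖ₑ ^ p) +
        2 ^ (p - 1) * (2 ^ (n + 2) * (ENNReal.ofReal (h * B) ^ p * ENNReal.ofReal (δ ^ 2)) * T)) :=
        h1.trans (by gcongr)
    _ = D * (2 ^ (p - 1) * (2 ^ (n + 2) *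
          (ENNReal.ofReal (h * B) ^ p * ENNReal.ofReal (δ ^ 2)))) * T +
        D * (2 ^ (p - 1) * (v * v⁻¹ ^ p)) * ∑ k ∈ J, ‖∫ y in coordCube h k, Φ y‖ₑ ^ p := by ring
    _ ≤ _ := by gcongr

end Cubes

/-! ### Transfer from linear coordinates to the corner. -/

section Transfer

variable {n : ℕ}

/-- Linear coordinates on the corner space. -/
noncomputable def cornerOfCoord (n : ℕ) : (Fin (n + 2) → ℝ) ≃L[ℝ] CornerPt n :=
  LinearEquiv.toContinuousLinearEquiv
    { toFun := fun y => (y 0, y 1, WithLp.toLp 2 fun i => y i.succ.succ)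
      map_add' := fun _ _ => rfl
      map_smul' := fun _ _ => rfl
      invFun := fun x => Fin.cons x.1 (Fin.cons x.2.1 fun i => x.2.2 i)
      left_inv := fun y => by
        ext i
        refine Fin.cases rfl (fun j => Fin.cases rfl (fun k => rfl) j) i
      right_inv := fun x => rfl }

theorem cornerOfCoord_apply (y : Fin (n + 2) → ℝ) :
    cornerOfCoord n y = (y 0, y 1, WithLp.toLp 2 fun i => y i.succ.succ) := rfl

theorem measurePreserving_cornerOfCoord (n : ℕ) : MeasurePreserving (cornerOfCoord n) := by
  have h1 := volume_preserving_piFinSuccAbove (fun _ : Fin (n + 2) => ℝ) 0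
  have h2 := volume_preserving_piFinSuccAbove (fun _ : Fin (n + 1) => ℝ) 0
  have h3 := PiLp.volume_preserving_toLp (Fin n)
  exact ((MeasurePreserving.id volume).prod (((MeasurePreserving.id volume).prod h3).comp h2)).comp
    h1

theorem cornerOfCoord_single (i : Fin (n + 2)) :
    cornerOfCoord n (Pi.single i 1) = cornerDir n i := by
  rw [cornerOfCoord_apply]
  refine Fin.cases ?_ (fun j => Fin.cases ?_ (fun k => ?_) j) i
  · refine Prod.ext ?_ (Prod.ext ?_ ?_)
    · simp [cornerDir]
    · simp [cornerDir]
    · ext l; simp [cornerDir]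
  · refine Prod.ext ?_ (Prod.ext ?_ ?_)
    · simp [cornerDir]
    · simp [cornerDir]
    · ext l
      have : l.succ.succ ≠ (1 : Fin (n + 2)) := by
        rw [← Fin.succ_zero_eq_one]
        exact fun h => Fin.succ_ne_zero _ (Fin.succ_injective _ h)
      simp [cornerDir, this]
  · have h1 : (1 : Fin (n + 2)) ≠ k.succ.succ := by
      rw [← Fin.succ_zero_eq_one]
      exact fun h => Fin.succ_ne_zero _ (Fin.succ_injective _ h).symm
    refine Prod.ext ?_ (Prod.ext ?_ ?_)
    · simp [cornerDir, (Fin.succ_ne_zero k.succ).symm]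
    · simp [cornerDir, h1]
    · ext l
      simp [cornerDir, Pi.single_apply]

/-- The measure `x₁ dσ = dx₁/x₁ dx₂/x₂ dx'` of the space `𝓗_{p,0}^{1,((N-1)/p, N/p)}(𝕄)`. -/
noncomputable abbrev cornerNu (δ : ℝ) (X : Set (EuclideanSpace ℝ (Fin n))) (p : ℝ) :
    Measure (CornerPt n) :=
  weightedVol δ X p ((((n : ℝ) + 2) - 1) / p) (((n : ℝ) + 2) / p)

theorem measurableSet_cornerSet {δ : ℝ} {X : Set (EuclideanSpace ℝ (Fin n))} (hX : IsOpen X) :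
    MeasurableSet (cornerSet δ X) :=
  (isOpen_Ioo.prod (isOpen_Ioo.prod hX)).measurableSet

/-- For these `γ₁, γ₂` the exponents `N/p - γ₁` and `N/p - γ₂` are `1/p` and `0`, so the `p`-th
power of the weight is `x₁`. -/
theorem cornerNu_eq_cornerVol {δ p : ℝ} {X : Set (EuclideanSpace ℝ (Fin n))} (hX : IsOpen X)
    (hp : 0 < p) :
    cornerNu δ X p = (cornerVol δ X).withDensity fun x => ENNReal.ofReal x.1 := by
  refine withDensity_congr_ae ?_
  have hac : cornerVol δ X ≪ volume.restrict (cornerSet δ X) := withDensity_absolutelyContinuous _ _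
  refine hac.ae_le ?_
  filter_upwards [ae_restrict_mem (measurableSet_cornerSet hX)] with x hx
  have h1 : 0 < x.1 := hx.1.1
  have e1 : ((n : ℝ) + 2) / p - ((n : ℝ) + 2 - 1) / p = p⁻¹ := by field_simp; ring
  rw [e1, sub_self, Real.rpow_zero, mul_one, Real.rpow_inv_rpow h1.le hp.ne']

theorem cornerNu_eq {δ p : ℝ} {X : Set (EuclideanSpace ℝ (Fin n))} (hX : IsOpen X) (hp : 0 < p) :
    cornerNu δ X p = (volume.restrict (cornerSet δ X)).withDensity
      fun x => ENNReal.ofReal (x.1 * x.2.1)⁻¹ := by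
  rw [cornerNu_eq_cornerVol hX hp, cornerVol, ← withDensity_mul _ (by fun_prop) (by fun_prop)]
  refine withDensity_congr_ae ?_
  filter_upwards [ae_restrict_mem (measurableSet_cornerSet hX)] with x hx
  have h1 : 0 < x.1 := hx.1.1
  have h2 : 0 < x.2.1 := hx.2.1.1
  rw [Pi.mul_apply, ← ENNReal.ofReal_mul (by positivity)]
  congr 1
  field_simp

/-- `coordVol` is not restricted to the corner; vanishing of `f` outside makes up for that. -/
theorem lintegral_cornerNu_eq {δ p : ℝ} {X : Set (EuclideanSpace ℝ (Fin n))} (hX : IsOpen X)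
    (hp : 0 < p) {f : CornerPt n → ℝ≥0∞} (hf : Measurable f) (h0 : ∀ x ∉ cornerSet δ X, f x = 0) :
    ∫⁻ x, f x ∂(cornerNu δ X p) = ∫⁻ y, f (cornerOfCoord n y) ∂(coordVol n) := by
  rw [cornerNu_eq hX hp, lintegral_withDensity_eq_lintegral_mul _ (by fun_prop) hf,
    lintegral_coordVol (f := fun y => f (cornerOfCoord n y))
      (hf.comp (cornerOfCoord n).continuous.measurable),
    ← lintegral_indicator (measurableSet_cornerSet hX),
    ← (measurePreserving_cornerOfCoord n).lintegral_comp
      (((by fun_prop : Measurable fun x : CornerPt n => ENNReal.ofReal (x.1 * x.2.1)⁻¹).mul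
        hf).indicator (measurableSet_cornerSet hX))]
  refine lintegral_congr fun y => ?_
  by_cases hy : cornerOfCoord n y ∈ cornerSet δ X
  · rw [indicator_of_mem hy]
    rfl
  · rw [indicator_of_notMem hy, h0 _ hy, mul_zero]

theorem IsCornerTest.isCoordTest {δ R : ℝ} {X : Set (EuclideanSpace ℝ (Fin n))}
    (hδR : δ ≤ R) (hXR : ∀ x ∈ X, ‖x‖ ≤ R) {φ : CornerPt n → ℝ} (hφ : IsCornerTest δ X φ) :
    IsCoordTest δ R fun y => φ (cornerOfCoord n y) := by
  have hsub : ∀ y ∈ tsupport fun y => φ (cornerOfCoord n y), cornerOfCoord n y ∈ cornerSet δ X := by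
    intro y hy
    refine hφ.subset ?_
    exact tsupport_comp_subset_preimage φ (cornerOfCoord n).continuous hy
  refine ⟨(hφ.smooth.of_le (by simp)).comp (cornerOfCoord n).contDiff,
    hφ.compact.comp_homeomorph (cornerOfCoord n).toHomeomorph, fun y hy => (hsub y hy).1,
    fun y hy => (hsub y hy).2.1, fun y hy i => ?_⟩
  have h := hsub y hy
  refine Fin.cases ?_ (fun j => Fin.cases ?_ (fun k => ?_) j) i
  · have h0 : y 0 ∈ Ioo 0 δ := h.1
    rw [abs_of_pos h0.1]
    exact h0.2.le.trans hδR
  · have h0 : y 1 ∈ Ioo 0 δ := h.2.1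
    change |y 1| ≤ R
    rw [abs_of_pos h0.1]
    exact h0.2.le.trans hδR
  · refine le_trans ?_ (hXR _ h.2.2)
    exact PiLp.norm_apply_le (WithLp.toLp 2 fun i : Fin n => y i.succ.succ) k

theorem measurable_cornerGrad {φ : CornerPt n → ℝ} (hφ : ContDiff ℝ ∞ φ) :
    Measurable (cornerGrad φ) := by
  have : Continuous (cornerGrad φ) := by
    refine (PiLp.continuous_toLp 2 _).comp (continuous_pi fun i => ?_)
    exact (continuous_cornerCoef i).mul
      ((hφ.continuous_fderiv (by simp)).clm_apply continuous_const)
  exact this.measurable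

theorem cornerGrad_eq_zero {φ : CornerPt n → ℝ} {x : CornerPt n} (hx : x ∉ tsupport φ) :
    cornerGrad φ x = 0 := by
  ext i
  simp [cornerGrad, fderiv_eq_zero_of_notMem_tsupport hx]

theorem IsCornerTest.dominatesGrad {δ : ℝ} {X : Set (EuclideanSpace ℝ (Fin n))}
    {φ : CornerPt n → ℝ} (hφ : IsCornerTest δ X φ) :
    DominatesGrad (fun y => φ (cornerOfCoord n y))
      fun y => ‖cornerGrad φ (cornerOfCoord n y)‖ₑ := by
  have hfd : ∀ y i, fderiv ℝ (fun y => φ (cornerOfCoord n y)) y (Pi.single i 1) =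
      fderiv ℝ φ (cornerOfCoord n y) (cornerDir n i) := by
    intro y i
    have h1 : HasFDerivAt φ (fderiv ℝ φ (cornerOfCoord n y)) (cornerOfCoord n y) :=
      (hφ.smooth.differentiable (by simp)).differentiableAt.hasFDerivAt
    have h2 := h1.comp y (cornerOfCoord n).hasFDerivAt
    have h3 : fderiv ℝ (fun y => φ (cornerOfCoord n y)) y = _ := h2.fderiv
    rw [h3, ← cornerOfCoord_single]
    rfl
  have hle : ∀ y i, ‖cornerCoef (cornerOfCoord n y) i *
      fderiv ℝ φ (cornerOfCoord n y) (cornerDir n i)‖ₑ ≤ ‖cornerGrad φ (cornerOfCoord n y)‖ₑ := by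
    intro y i
    rw [enorm_le_iff_norm_le]
    exact PiLp.norm_apply_le (cornerGrad φ (cornerOfCoord n y)) i
  refine ⟨((measurable_cornerGrad hφ.smooth).comp (cornerOfCoord n).continuous.measurable).enorm,
    fun y => ?_, fun y => ?_, fun y i h0 h1 => ?_⟩
  · rw [hfd]; exact hle y 0
  · rw [hfd]; exact hle y 1
  · rw [hfd]
    have h2 := hle y i
    obtain ⟨j, rfl⟩ := Fin.exists_succ_eq.2 h0
    obtain ⟨k, rfl⟩ := Fin.exists_succ_eq.2
      (show j ≠ 0 by rintro rfl; exact h1 rfl)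
    have h3 : cornerCoef (cornerOfCoord n y) k.succ.succ = 1 := rfl
    rwa [h3, one_mul] at h2

variable {δ p : ℝ} {X : Set (EuclideanSpace ℝ (Fin n))}

theorem IsCornerTest.lintegral_rpow_eq (hX : IsOpen X) (hp : 0 < p) {φ : CornerPt n → ℝ}
    (hφ : IsCornerTest δ X φ) :
    ∫⁻ x, ‖φ x‖ₑ ^ p ∂(cornerNu δ X p) =
      ∫⁻ y, ‖φ (cornerOfCoord n y)‖ₑ ^ p ∂(coordVol n) := by
  refine lintegral_cornerNu_eq hX hp (hφ.smooth.continuous.measurable.enorm.pow_const _)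
    fun x hx => ?_
  simp [image_eq_zero_of_notMem_tsupport fun h => hx (hφ.subset h), hp]

theorem IsCornerTest.lintegral_grad_rpow_eq (hX : IsOpen X) (hp : 0 < p) {φ : CornerPt n → ℝ}
    (hφ : IsCornerTest δ X φ) :
    ∫⁻ x, ‖cornerGrad φ x‖ₑ ^ p ∂(cornerNu δ X p) =
      ∫⁻ y, ‖cornerGrad φ (cornerOfCoord n y)‖ₑ ^ p ∂(coordVol n) := by
  refine lintegral_cornerNu_eq hX hp ((measurable_cornerGrad hφ.smooth).enorm.pow_const _)
    fun x hx => ?_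
  simp [cornerGrad_eq_zero fun h => hx (hφ.subset h), hp]

/-- The Poincaré inequality for test functions. -/
theorem exists_poincare_test (hXo : IsOpen X) (hXb : Bornology.IsBounded X)
    (hn : 0 < n) (hp : 1 ≤ p) :
    ∃ C : ℝ≥0∞, C ≠ ⊤ ∧ ∀ φ : CornerPt n → ℝ, IsCornerTest δ X φ →
      ∫⁻ x, ‖φ x‖ₑ ^ p ∂(cornerNu δ X p) ≤
        C * ∫⁻ x, ‖cornerGrad φ x‖ₑ ^ p ∂(cornerNu δ X p) := by
  obtain ⟨R, hR⟩ := hXb.exists_norm_le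
  have hp0 : 0 < p := by linarith
  refine ⟨ENNReal.ofReal (2 * |max δ R| + 1) ^ p, ?_, fun φ hφ => ?_⟩
  swap
  · rw [hφ.lintegral_rpow_eq hXo hp0, hφ.lintegral_grad_rpow_eq hXo hp0]
    -- The direction used is `x'₁`, available since `n > 0`.
    refine lintegral_rpow_le_of_dominatesGrad hp (Fin.succ (Fin.succ ⟨0, hn⟩)) (Fin.succ_ne_zero _)
      ?_ (hφ.isCoordTest (R := max δ R) (le_max_left _ _)
        fun x hx => (hR x hx).trans (le_max_right _ _)) hφ.dominatesGrad
    rw [← Fin.succ_zero_eq_one]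
    exact fun h => Fin.succ_ne_zero _ (Fin.succ_injective _ h)
  · exact ENNReal.rpow_ne_top_of_nonneg hp0.le ENNReal.ofReal_ne_top

/-- The weighted Sobolev inequality for test functions. -/
theorem exists_sobolev_test (hXo : IsOpen X) (hXb : Bornology.IsBounded X) (hp : 1 < p)
    (hpN : p < (n : ℝ) + 2) :
    ∃ C : ℝ≥0∞, C ≠ ⊤ ∧ ∀ φ : CornerPt n → ℝ, IsCornerTest δ X φ →
      ∫⁻ x, ENNReal.ofReal x.1 ^ (p / ((n : ℝ) + 2 - p)) *
          ‖φ x‖ₑ ^ (((n : ℝ) + 2) * p / ((n : ℝ) + 2 - p)) ∂(cornerNu δ X p) ≤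
        C * (∫⁻ x, ‖φ x‖ₑ ^ p ∂(cornerNu δ X p) +
          ∫⁻ x, ‖cornerGrad φ x‖ₑ ^ p ∂(cornerNu δ X p)) ^
            (((n : ℝ) + 2) / ((n : ℝ) + 2 - p)) := by
  obtain ⟨R, hR⟩ := hXb.exists_norm_le
  have hp0 : 0 < p := by linarith
  obtain ⟨C, hC, h⟩ := exists_weighted_sobolev_const (n := n) hp hpN
  refine ⟨C, hC, fun φ hφ => ?_⟩
  have hs : 0 < ((n : ℝ) + 2) * p / ((n : ℝ) + 2 - p) := div_pos (by positivity) (by linarith)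
  have hm : Measurable fun x => ‖φ x‖ₑ := hφ.smooth.continuous.measurable.enorm
  rw [hφ.lintegral_rpow_eq hXo hp0, hφ.lintegral_grad_rpow_eq hXo hp0,
    lintegral_cornerNu_eq hXo hp0 (by fun_prop) fun x hx => by
      simp [image_eq_zero_of_notMem_tsupport fun h => hx (hφ.subset h), hs]]
  exact h δ (max δ R) _ _ (hφ.isCoordTest (le_max_left _ _)
        fun x hx => (hR x hx).trans (le_max_right _ _)) hφ.dominatesGrad

end Transfer

/-! ### Cube integrals as bounded functionals. -/

section Functionals

variable {n : ℕ} {δ p : ℝ} {X : Set (EuclideanSpace ℝ (Fin n))}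

/-- Integration over a set away from the singular faces is a bounded functional on the weighted
`Lᵖ` space. -/
theorem exists_setIntegral_functional (hXo : IsOpen X) (hXb : Bornology.IsBounded X)
    [Fact (1 ≤ p)] (hp : 1 < p) {c : ℝ} (hc : 0 < c) {Q : Set (CornerPt n)} (hQ : MeasurableSet Q)
    (hQc : ∀ x ∈ Q, c ≤ x.1 ∧ c ≤ x.2.1) :
    ∃ F : Lp ℝ (ENNReal.ofReal p) (cornerNu δ X p) →L[ℝ] ℝ,
      ∀ (f : Lp ℝ (ENNReal.ofReal p) (cornerNu δ X p)) (φ : CornerPt n → ℝ),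
        IsCornerTest δ X φ → f =ᵐ[cornerNu δ X p] φ → F f = ∫ x in Q, φ x := by
  have hp0 : 0 < p := by linarith
  set M := cornerSet δ X with hM
  have hMm : MeasurableSet M := measurableSet_cornerSet hXo
  have hpq := Real.HolderConjugate.conjExponent hp
  have : ENNReal.HolderConjugate (ENNReal.ofReal p) (ENNReal.ofReal p.conjExponent) :=
    hpq.ennrealOfReal
  have : Fact (1 ≤ p.conjExponent) := ⟨hpq.symm.lt.le⟩
  have hMfin : volume M < ⊤ := by
    have hb : Bornology.IsBounded M :=
      (Metric.isBounded_Ioo 0 δ).prod ((Metric.isBounded_Ioo 0 δ).prod hXb)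
    exact hb.measure_lt_top
  have hfin : cornerNu δ X p (Q ∩ M) < ⊤ := by
    rw [cornerNu_eq hXo hp0, withDensity_apply _ (hQ.inter hMm)]
    calc _ ≤ ∫⁻ _ in Q ∩ M, ENNReal.ofReal (c * c)⁻¹ ∂(volume.restrict M) := by
          refine setLIntegral_mono' (hQ.inter hMm) fun x hx => ENNReal.ofReal_le_ofReal ?_
          have := hQc x hx.1
          have h0 : 0 < x.1 := hc.trans_le this.1
          gcongr
          · exact this.1
          · exact this.2
      _ ≤ ENNReal.ofReal (c * c)⁻¹ * volume M := by
          rw [lintegral_const, Measure.restrict_apply_univ, Measure.restrict_apply (hQ.inter hMm)]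
          gcongr
          exact inter_subset_right
      _ < ⊤ := ENNReal.mul_lt_top ENNReal.ofReal_lt_top hMfin
  -- The factor `x₁x₂` cancels the density of `cornerNu`, so pairing with `g` is Lebesgue
  -- integration over `Q ∩ M`; `g` is bounded on a set of finite measure, hence lies in the dual
  -- space.
  let g : CornerPt n → ℝ := (Q ∩ M).indicator fun x => x.1 * x.2.1
  have hg : MemLp g (ENNReal.ofReal p.conjExponent) (cornerNu δ X p) := by
    rw [memLp_indicator_iff_restrict (hQ.inter hMm)]
    have : IsFiniteMeasure ((cornerNu δ X p).restrict (Q ∩ M)) := ⟨by simpa using hfin⟩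
    refine MemLp.of_bound (by fun_prop) (δ * δ) ?_
    filter_upwards [ae_restrict_mem (hQ.inter hMm)] with x hx
    have h1 : x.1 ∈ Ioo 0 δ := hx.2.1
    have h2 : x.2.1 ∈ Ioo 0 δ := hx.2.2.1
    rw [norm_mul, Real.norm_of_nonneg h1.1.le, Real.norm_of_nonneg h2.1.le]
    exact mul_le_mul h1.2.le h2.2.le h2.1.le (h1.1.trans h1.2).le
  refine ⟨((ContinuousLinearMap.mul ℝ ℝ).lpPairing (cornerNu δ X p) (ENNReal.ofReal p)
    (ENNReal.ofReal p.conjExponent)).flip (hg.toLp g), fun f φ hφ hfφ => ?_⟩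
  rw [ContinuousLinearMap.flip_apply, ContinuousLinearMap.lpPairing_eq_integral]
  have e1 : ∫ x, ContinuousLinearMap.mul ℝ ℝ (f x) (hg.toLp g x) ∂(cornerNu δ X p) =
      ∫ x, φ x * g x ∂(cornerNu δ X p) := by
    refine integral_congr_ae ?_
    filter_upwards [hfφ, hg.coeFn_toLp] with x h1 h2
    rw [h1, h2]
    rfl
  rw [e1, cornerNu_eq hXo hp0, integral_withDensity_eq_integral_toReal_smul (by fun_prop)
    (by simp)]
  have e2 : ∫ x in M, (ENNReal.ofReal (x.1 * x.2.1)⁻¹).toReal • (φ x * g x) =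
      ∫ x in M, Q.indicator φ x := by
    refine setIntegral_congr_fun hMm fun x hx => ?_
    by_cases hxQ : x ∈ Q
    · have h1 : 0 < x.1 := hx.1.1
      have h2 : 0 < x.2.1 := hx.2.1.1
      simp only [g]
      rw [indicator_of_mem (show x ∈ Q ∩ M from ⟨hxQ, hx⟩), indicator_of_mem hxQ,
        ENNReal.toReal_ofReal (by positivity), smul_eq_mul]
      field_simp
    · simp only [g]
      rw [indicator_of_notMem (fun h => hxQ h.1), indicator_of_notMem hxQ]
      simp
  rw [e2, setIntegral_indicator hQ]
  refine (setIntegral_eq_of_subset_of_forall_sdiff_eq_zero hQ inter_subset_right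
    fun x hx => ?_).symm
  exact image_eq_zero_of_notMem_tsupport fun h => hx.2 ⟨hφ.subset h, hx.1⟩

/-- Away from the singular faces the `Lᵖ` norm of a test function is controlled by a small
multiple of its gradient and finitely many bounded functionals. -/
theorem exists_functionals_test (hXo : IsOpen X) (hXb : Bornology.IsBounded X)
    [Fact (1 ≤ p)] (hp : 1 < p) {η : ℝ} (hη : 0 < η) {ε : ℝ≥0∞} (hε : 0 < ε) :
    ∃ (ι : Type) (_ : Fintype ι) (F : ι → Lp ℝ (ENNReal.ofReal p) (cornerNu δ X p) →L[ℝ] ℝ)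
      (C : ℝ≥0∞), C ≠ ⊤ ∧
      ∀ (f : Lp ℝ (ENNReal.ofReal p) (cornerNu δ X p)) (φ : CornerPt n → ℝ),
        IsCornerTest δ X φ → f =ᵐ[cornerNu δ X p] φ →
        ∫⁻ x in {x | η ≤ x.1 ∧ η ≤ x.2.1}, ‖φ x‖ₑ ^ p ∂(cornerNu δ X p) ≤
          ε * ∫⁻ x, ‖cornerGrad φ x‖ₑ ^ p ∂(cornerNu δ X p) + C * ∑ k, ‖F k f‖ₑ ^ p := by
  have hp0 : 0 < p := by linarith
  obtain ⟨R, hR⟩ := hXb.exists_norm_le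
  obtain ⟨h, hh, J, C, hC, hJ, hle⟩ := exists_cubes_lintegral_le (n := n) (δ := δ)
    (R := max δ R) hp.le hη hε
  let e := cornerOfCoord n
  have hQ : ∀ k, MeasurableSet (e.symm ⁻¹' coordCube h k) := fun k =>
    e.symm.continuous.measurable (measurableSet_coordCube h k)
  have hpre : ∀ k, e ⁻¹' (e.symm ⁻¹' coordCube h k) = coordCube h k := fun k => by
    ext y; simp
  have hF : ∀ k : J, ∃ F : Lp ℝ (ENNReal.ofReal p) (cornerNu δ X p) →L[ℝ] ℝ,
      ∀ (f : Lp ℝ (ENNReal.ofReal p) (cornerNu δ X p)) (φ : CornerPt n → ℝ),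
        IsCornerTest δ X φ → f =ᵐ[cornerNu δ X p] φ →
          F f = ∫ x in e.symm ⁻¹' coordCube h k, φ x := fun k =>
    exists_setIntegral_functional hXo hXb hp (half_pos hη) (hQ k) fun x hx => by
      have h1 := hJ k k.2 _ hx
      have h2 : x = e (e.symm x) := (e.apply_symm_apply x).symm
      rw [h2]
      exact h1
  choose F hF using hF
  refine ⟨J, inferInstance, F, C, hC, fun f φ hφ hfφ => ?_⟩
  have hA : MeasurableSet {x : CornerPt n | η ≤ x.1 ∧ η ≤ x.2.1} :=
    (measurableSet_le measurable_const measurable_fst).inter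
      (measurableSet_le measurable_const (measurable_fst.comp measurable_snd))
  have hm : Measurable fun x => ‖φ x‖ₑ ^ p := hφ.smooth.continuous.measurable.enorm.pow_const _
  have e1 : ∫⁻ x in {x | η ≤ x.1 ∧ η ≤ x.2.1}, ‖φ x‖ₑ ^ p ∂(cornerNu δ X p) =
      ∫⁻ y in {y | η ≤ y 0 ∧ η ≤ y 1}, ‖φ (e y)‖ₑ ^ p ∂(coordVol n) := by
    rw [← lintegral_indicator hA, lintegral_cornerNu_eq hXo hp0 (hm.indicator hA),
      ← lintegral_indicator]
    · rfl
    · exact (measurableSet_le measurable_const (measurable_pi_apply 0)).inter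
        (measurableSet_le measurable_const (measurable_pi_apply 1))
    · intro x hx
      rw [indicator_apply_eq_zero]
      intro _
      simp [image_eq_zero_of_notMem_tsupport fun h => hx (hφ.subset h), hp0]
  have e2 : ∀ k : J, F k f = ∫ y in coordCube h k, φ (e y) := by
    intro k
    rw [hF k f φ hφ hfφ, ← (measurePreserving_cornerOfCoord n).setIntegral_preimage_emb
      e.toHomeomorph.measurableEmbedding, hpre]
  rw [e1, hφ.lintegral_grad_rpow_eq hXo hp0]
  simp only [e2]
  rw [Finset.sum_coe_sort J fun k => ‖∫ y in coordCube h k, φ (e y)‖ₑ ^ p]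
  exact hle _ _ (hφ.isCoordTest (le_max_left _ _)
    fun x hx => (hR x hx).trans (le_max_right _ _)) hφ.dominatesGrad

end Functionals

/-! ### Passage from test functions to their closure. -/

section Density

variable {n : ℕ} {δ p γ₁ γ₂ : ℝ} {X : Set (EuclideanSpace ℝ (Fin n))}

theorem IsCornerTest.zero : IsCornerTest δ X (0 : CornerPt n → ℝ) where
  smooth := contDiff_const
  compact := HasCompactSupport.zero
  subset := by simp

theorem IsCornerTest.add {φ ψ : CornerPt n → ℝ} (hφ : IsCornerTest δ X φ)
    (hψ : IsCornerTest δ X ψ) : IsCornerTest δ X (φ + ψ) where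
  smooth := hφ.smooth.add hψ.smooth
  compact := hφ.compact.add hψ.compact
  subset := (tsupport_add φ ψ).trans (union_subset hφ.subset hψ.subset)

theorem IsCornerTest.smul {φ : CornerPt n → ℝ} (hφ : IsCornerTest δ X φ) (c : ℝ) :
    IsCornerTest δ X (c • φ) where
  smooth := hφ.smooth.const_smul c
  compact := hφ.compact.smul_left (f := fun _ => c)
  subset := (tsupport_smul_subset_right (fun _ => c) φ).trans hφ.subset

theorem cornerGrad_zero : cornerGrad (0 : CornerPt n → ℝ) = 0 := by
  funext x
  ext i
  simp [cornerGrad]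

theorem cornerGrad_add {φ ψ : CornerPt n → ℝ} (hφ : Differentiable ℝ φ)
    (hψ : Differentiable ℝ ψ) : cornerGrad (φ + ψ) = cornerGrad φ + cornerGrad ψ := by
  funext x
  ext i
  simp [cornerGrad, fderiv_add hφ.differentiableAt hψ.differentiableAt, mul_add]

theorem cornerGrad_smul {φ : CornerPt n → ℝ} (hφ : Differentiable ℝ φ) (c : ℝ) :
    cornerGrad (c • φ) = c • cornerGrad φ := by
  funext x
  ext i
  simp [cornerGrad, fderiv_const_smul hφ.differentiableAt]
  ring

/-- The span in `cornerSobolevZero` adds nothing, so every element is a limit of test functions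
themselves. -/
theorem span_cornerTestSet_subset [Fact (1 ≤ p)] :
    (Submodule.span ℝ (cornerTestSet δ X p γ₁ γ₂) : Set (cornerSobolev δ X p γ₁ γ₂)) ⊆
      cornerTestSet δ X p γ₁ γ₂ := by
  intro w hw
  induction hw using Submodule.span_induction with
  | mem w hw => exact hw
  | zero =>
    refine ⟨0, IsCornerTest.zero, Lp.coeFn_zero _ _ _, ?_⟩
    rw [cornerGrad_zero]
    exact Lp.coeFn_zero _ _ _
  | add v w _ _ hv hw =>
    obtain ⟨φ, hφ, h1, h2⟩ := hv
    obtain ⟨ψ, hψ, h3, h4⟩ := hw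
    refine ⟨φ + ψ, hφ.add hψ, (Lp.coeFn_add _ _).trans (h1.add h3), ?_⟩
    rw [cornerGrad_add (hφ.smooth.differentiable (by simp)) (hψ.smooth.differentiable (by simp))]
    exact (Lp.coeFn_add _ _).trans (h2.add h4)
  | smul c w _ hw =>
    obtain ⟨φ, hφ, h1, h2⟩ := hw
    refine ⟨c • φ, hφ.smul c, (Lp.coeFn_smul _ _).trans (h1.const_smul c), ?_⟩
    rw [cornerGrad_smul (hφ.smooth.differentiable (by simp))]
    exact (Lp.coeFn_smul _ _).trans (h2.const_smul c)

/-- A closed condition that holds for test functions holds on `𝓗_{p,0}^{1,((N-1)/p, N/p)}(𝕄)`. -/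
theorem CornerH.mem_of_isClosed [Fact (1 ≤ p)]
    {Z : Set (CornerPair δ X p ((((n : ℝ) + 2) - 1) / p) (((n : ℝ) + 2) / p))} (hZ : IsClosed Z)
    (htest : ∀ (w : CornerPair δ X p ((((n : ℝ) + 2) - 1) / p) (((n : ℝ) + 2) / p))
      (φ : CornerPt n → ℝ), IsCornerTest δ X φ → w.fst =ᵐ[cornerNu δ X p] φ →
      w.snd =ᵐ[cornerNu δ X p] cornerGrad φ → w ∈ Z) (u : CornerH δ X p) : u.1.1 ∈ Z := by
  have h1 : u.1 ∈ closure (Submodule.span ℝ (cornerTestSet δ X p ((((n : ℝ) + 2) - 1) / p)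
    (((n : ℝ) + 2) / p)) : Set (cornerSobolev δ X p _ _)) := u.2
  have h2 : IsClosed (Subtype.val ⁻¹' Z : Set (cornerSobolev δ X p ((((n : ℝ) + 2) - 1) / p)
    (((n : ℝ) + 2) / p))) := hZ.preimage continuous_subtype_val
  refine closure_minimal (fun w hw => ?_) h2 h1
  obtain ⟨φ, hφ, h3, h4⟩ := span_cornerTestSet_subset hw
  exact htest w.1 φ hφ h3 h4

theorem Lp_enorm_rpow_eq_lintegral {α F : Type*} [MeasurableSpace α] {μ : Measure α}
    [NormedAddCommGroup F] (hp : 0 < p) (f : Lp F (ENNReal.ofReal p) μ) :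
    ‖f‖ₑ ^ p = ∫⁻ x, ‖f x‖ₑ ^ p ∂μ := by
  rw [Lp.enorm_def, eLpNorm_eq_lintegral_rpow_enorm_toReal (by simpa using hp) (by simp),
    ENNReal.toReal_ofReal hp.le, ← ENNReal.rpow_mul, one_div_mul_cancel hp.ne', ENNReal.rpow_one]

theorem CornerPair.enorm_rpow [Fact (1 ≤ p)] (w : CornerPair δ X p γ₁ γ₂) :
    ‖w‖ₑ ^ p = ‖w.fst‖ₑ ^ p + ‖w.snd‖ₑ ^ p := by
  have hp1 : 1 ≤ p := Fact.out
  have hp : 0 < p := by linarith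
  have h := WithLp.prod_norm_eq_add (by rw [ENNReal.toReal_ofReal hp.le]; exact hp) w
  rw [ENNReal.toReal_ofReal hp.le] at h
  have h2 : ‖w‖ ^ p = ‖w.fst‖ ^ p + ‖w.snd‖ ^ p := by
    rw [h, ← Real.rpow_mul (by positivity), one_div_mul_cancel hp.ne', Real.rpow_one]
  rw [← ofReal_norm, ← ofReal_norm, ← ofReal_norm, ENNReal.ofReal_rpow_of_nonneg (norm_nonneg _) hp.le,
    ENNReal.ofReal_rpow_of_nonneg (norm_nonneg _) hp.le,
    ENNReal.ofReal_rpow_of_nonneg (norm_nonneg _) hp.le, h2,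
    ENNReal.ofReal_add (by positivity) (by positivity)]

theorem lintegral_enorm_rpow_congr {α F : Type*} [MeasurableSpace α] {μ : Measure α}
    [NormedAddCommGroup F] {f g : α → F} (h : f =ᵐ[μ] g) (w : α → ℝ≥0∞) (s : ℝ) :
    ∫⁻ x, w x * ‖f x‖ₑ ^ s ∂μ = ∫⁻ x, w x * ‖g x‖ₑ ^ s ∂μ :=
  lintegral_congr_ae (by filter_upwards [h] with x hx; rw [hx])

theorem CornerPair.enorm_fst_rpow [Fact (1 ≤ p)] {w : CornerPair δ X p γ₁ γ₂}
    {φ : CornerPt n → ℝ} (h : w.fst =ᵐ[weightedVol δ X p γ₁ γ₂] φ) :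
    ‖w.fst‖ₑ ^ p = ∫⁻ x, ‖φ x‖ₑ ^ p ∂(weightedVol δ X p γ₁ γ₂) := by
  have hp : (1 : ℝ) ≤ p := Fact.out
  rw [Lp_enorm_rpow_eq_lintegral (by linarith)]
  simpa using lintegral_enorm_rpow_congr h 1 p

theorem CornerPair.enorm_snd_rpow [Fact (1 ≤ p)] {w : CornerPair δ X p γ₁ γ₂}
    {φ : CornerPt n → ℝ} (h : w.snd =ᵐ[weightedVol δ X p γ₁ γ₂] cornerGrad φ) :
    ‖w.snd‖ₑ ^ p = ∫⁻ x, ‖cornerGrad φ x‖ₑ ^ p ∂(weightedVol δ X p γ₁ γ₂) := by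
  have hp : (1 : ℝ) ≤ p := Fact.out
  rw [Lp_enorm_rpow_eq_lintegral (by linarith)]
  simpa using lintegral_enorm_rpow_congr h 1 p

theorem CornerPair.continuous_fst [Fact (1 ≤ p)] :
    Continuous fun w : CornerPair δ X p γ₁ γ₂ => w.fst :=
  (WithLp.prod_continuous_ofLp _ _ _).fst

theorem CornerPair.continuous_snd [Fact (1 ≤ p)] :
    Continuous fun w : CornerPair δ X p γ₁ γ₂ => w.snd :=
  (WithLp.prod_continuous_ofLp _ _ _).snd

/-- The Poincaré inequality. -/
theorem CornerH.exists_poincare [Fact (1 ≤ p)] (hXo : IsOpen X) (hXb : Bornology.IsBounded X)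
    (hn : 0 < n) :
    ∃ C : ℝ≥0∞, C ≠ ⊤ ∧ ∀ u : CornerH δ X p, ‖u.1.1.fst‖ₑ ^ p ≤ C * ‖u.1.1.snd‖ₑ ^ p := by
  have hp : (1 : ℝ) ≤ p := Fact.out
  obtain ⟨C, hC, h⟩ := exists_poincare_test (δ := δ) hXo hXb hn hp
  refine ⟨C, hC, CornerH.mem_of_isClosed (Z := {w | ‖w.fst‖ₑ ^ p ≤ C * ‖w.snd‖ₑ ^ p}) ?_ ?_⟩
  · refine isClosed_le ?_ ?_
    · exact ENNReal.continuous_rpow_const.comp CornerPair.continuous_fst.enorm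
    · exact (ENNReal.continuous_const_mul hC).comp
        (ENNReal.continuous_rpow_const.comp CornerPair.continuous_snd.enorm)
  · intro w φ hφ h1 h2
    rw [mem_ofPred_eq, CornerPair.enorm_fst_rpow h1, CornerPair.enorm_snd_rpow h2]
    exact h φ hφ

/-- The weighted Sobolev inequality at the critical exponent. -/
theorem CornerH.exists_sobolev [Fact (1 ≤ p)] (hXo : IsOpen X) (hXb : Bornology.IsBounded X)
    (hp : 1 < p) (hpN : p < (n : ℝ) + 2) :
    ∃ C : ℝ≥0∞, C ≠ ⊤ ∧ ∀ u : CornerH δ X p,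
      ∫⁻ x, ENNReal.ofReal x.1 ^ (p / ((n : ℝ) + 2 - p)) *
          ‖u.1.1.fst x‖ₑ ^ (((n : ℝ) + 2) * p / ((n : ℝ) + 2 - p)) ∂(cornerNu δ X p) ≤
        C * ‖u.1.1‖ₑ ^ (((n : ℝ) + 2) * p / ((n : ℝ) + 2 - p)) := by
  have hp0 : 0 < p := by linarith
  obtain ⟨C, hC, h⟩ := exists_sobolev_test (δ := δ) hXo hXb hp hpN
  set s := ((n : ℝ) + 2) * p / ((n : ℝ) + 2 - p) with hs
  set e := p / ((n : ℝ) + 2 - p) with he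
  have hs0 : 0 < s := div_pos (by positivity) (by linarith)
  have he0 : 0 < e := div_pos hp0 (by linarith)
  refine ⟨C, hC, CornerH.mem_of_isClosed (Z := {w |
    ∫⁻ x, ENNReal.ofReal x.1 ^ e * ‖w.fst x‖ₑ ^ s ∂(cornerNu δ X p) ≤ C * ‖w‖ₑ ^ s}) ?_ ?_⟩
  -- The left side is not known to be continuous in the `Lᵖ` topology; Fatou's lemma along an almost
  -- everywhere convergent subsequence gives the lower semicontinuity that closedness needs.
  · refine IsSeqClosed.isClosed fun w w₀ hw hlim => ?_
    have hfst : Tendsto (fun k => (w k).fst) atTop (𝓝 w₀.fst) :=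
      (CornerPair.continuous_fst.tendsto w₀).comp hlim
    obtain ⟨φ, hφ, hae⟩ := (tendstoInMeasure_of_tendsto_Lp hfst).exists_seq_tendsto_ae
    have hrhs : Tendsto (fun k => C * ‖w (φ k)‖ₑ ^ s) atTop (𝓝 (C * ‖w₀‖ₑ ^ s)) := by
      have h1 : Continuous fun w : CornerPair δ X p ((((n : ℝ) + 2) - 1) / p)
          (((n : ℝ) + 2) / p) => C * ‖w‖ₑ ^ s :=
        (ENNReal.continuous_const_mul hC).comp (ENNReal.continuous_rpow_const.comp continuous_enorm)
      exact (h1.tendsto w₀).comp (hlim.comp hφ.tendsto_atTop)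
    have hmeas : ∀ k, AEMeasurable
        (fun x : CornerPt n => ENNReal.ofReal x.1 ^ e * ‖(w (φ k)).fst x‖ₑ ^ s)
        (cornerNu δ X p) := fun k =>
      (by fun_prop : Measurable fun x : CornerPt n => ENNReal.ofReal x.1 ^ e).aemeasurable.mul
        ((Lp.aestronglyMeasurable _).enorm.pow_const s)
    calc _ = ∫⁻ x, liminf (fun k => ENNReal.ofReal x.1 ^ e * ‖(w (φ k)).fst x‖ₑ ^ s) atTop
          ∂(cornerNu δ X p) := by
          refine lintegral_congr_ae ?_
          filter_upwards [hae] with x hx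
          refine (Tendsto.liminf_eq ?_).symm
          have h2 : Continuous fun t : ℝ => ENNReal.ofReal x.1 ^ e * ‖t‖ₑ ^ s :=
            (ENNReal.continuous_const_mul (ENNReal.rpow_ne_top_of_nonneg he0.le
              ENNReal.ofReal_ne_top)).comp (ENNReal.continuous_rpow_const.comp continuous_enorm)
          exact (h2.tendsto _).comp hx
      _ ≤ liminf (fun k => ∫⁻ x, ENNReal.ofReal x.1 ^ e * ‖(w (φ k)).fst x‖ₑ ^ s
            ∂(cornerNu δ X p)) atTop := lintegral_liminf_le' hmeas
      _ ≤ liminf (fun k => C * ‖w (φ k)‖ₑ ^ s) atTop :=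
          liminf_le_liminf (Eventually.of_forall fun k => hw (φ k))
      _ = _ := hrhs.liminf_eq
  · intro w φ hφ h1 h2
    have h3 := h φ hφ
    rw [mem_ofPred_eq, lintegral_enorm_rpow_congr h1]
    refine h3.trans_eq ?_
    rw [← CornerPair.enorm_fst_rpow h1, ← CornerPair.enorm_snd_rpow h2, ← CornerPair.enorm_rpow,
      ← ENNReal.rpow_mul]
    congr 2
    rw [hs]
    ring

/-- Away from the singular faces the `Lᵖ` norm is controlled by a small multiple of the norm and
finitely many bounded functionals. -/
theorem CornerH.exists_functionals [Fact (1 ≤ p)] (hXo : IsOpen X) (hXb : Bornology.IsBounded X)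
    (hp : 1 < p) {η : ℝ} (hη : 0 < η) {ε : ℝ≥0∞} (hε : 0 < ε) (hε' : ε ≠ ⊤) :
    ∃ (ι : Type) (_ : Fintype ι) (F : ι → Lp ℝ (ENNReal.ofReal p) (cornerNu δ X p) →L[ℝ] ℝ)
      (C : ℝ≥0∞), C ≠ ⊤ ∧ ∀ u : CornerH δ X p,
        ∫⁻ x in {x | η ≤ x.1 ∧ η ≤ x.2.1}, ‖u.1.1.fst x‖ₑ ^ p ∂(cornerNu δ X p) ≤
          ε * ‖u.1.1‖ₑ ^ p + C * ∑ k, ‖F k u.1.1.fst‖ₑ ^ p := by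
  have hp0 : 0 < p := by linarith
  obtain ⟨ι, hι, F, C, hC, h⟩ := exists_functionals_test (δ := δ) hXo hXb hp hη hε
  set A : Set (CornerPt n) := {x | η ≤ x.1 ∧ η ≤ x.2.1} with hA
  -- Writing the local integral as the norm of a restriction operator makes both sides of the
  -- estimate continuous.
  let P := LpToLpRestrictCLM (CornerPt n) ℝ ℝ (cornerNu δ X p) (ENNReal.ofReal p) A
  have hP : ∀ f : Lp ℝ (ENNReal.ofReal p) (cornerNu δ X p),
      ∫⁻ x in A, ‖f x‖ₑ ^ p ∂(cornerNu δ X p) = ‖P f‖ₑ ^ p := by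
    intro f
    rw [Lp_enorm_rpow_eq_lintegral hp0]
    have := lintegral_enorm_rpow_congr
      (LpToLpRestrictCLM_coeFn (μ := cornerNu δ X p) (p := ENNReal.ofReal p) ℝ A f) 1 p
    simpa using this.symm
  refine ⟨ι, hι, F, C, hC, CornerH.mem_of_isClosed (Z := {w |
    ∫⁻ x in A, ‖w.fst x‖ₑ ^ p ∂(cornerNu δ X p) ≤
      ε * ‖w‖ₑ ^ p + C * ∑ k, ‖F k w.fst‖ₑ ^ p}) ?_ ?_⟩
  · simp only [hP]
    refine isClosed_le ?_ (Continuous.add ?_ ?_)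
    · exact ENNReal.continuous_rpow_const.comp (P.continuous.comp CornerPair.continuous_fst).enorm
    · exact (ENNReal.continuous_const_mul hε').comp
        (ENNReal.continuous_rpow_const.comp continuous_enorm)
    · refine (ENNReal.continuous_const_mul hC).comp (continuous_finsetSum _ fun k _ => ?_)
      exact ENNReal.continuous_rpow_const.comp
        ((F k).continuous.comp CornerPair.continuous_fst).enorm
  · intro w φ hφ h1 h2
    have h3 := h w.fst φ hφ h1
    rw [mem_ofPred_eq]
    have h4 : ∫⁻ x in A, ‖w.fst x‖ₑ ^ p ∂(cornerNu δ X p) =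
        ∫⁻ x in A, ‖φ x‖ₑ ^ p ∂(cornerNu δ X p) := by
      simpa using lintegral_enorm_rpow_congr (ae_restrict_of_ae (s := A) h1) 1 p
    rw [h4]
    refine h3.trans ?_
    rw [← CornerPair.enorm_snd_rpow h2, CornerPair.enorm_rpow]
    gcongr
    exact le_add_self

end Density

/-! ### The embedding into weighted `L^q` and its smallness on finite codimension. -/

section Embedding

variable {n : ℕ} {δ p q : ℝ} {X : Set (EuclideanSpace ℝ (Fin n))}

/-- Interpolation between `Lᵖ` and the weighted `L^{p*}` space. -/
theorem lintegral_interpolation_le (hXo : IsOpen X) (hp : 1 < p) (hpN : p < (n : ℝ) + 2)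
    (hpq : p < q) (hqN : q < ((n : ℝ) + 2) * p / (((n : ℝ) + 2) - p)) {θ : ℝ}
    (hθ : θ = (q - p) / (((n : ℝ) + 2) * p / (((n : ℝ) + 2) - p) - p))
    {f : CornerPt n → ℝ} (hf : AEStronglyMeasurable f (cornerNu δ X p)) :
    ∫⁻ x, ENNReal.ofReal ((x.1 * x.2.1) ^ p) * ‖f x‖ₑ ^ q ∂(cornerNu δ X p) ≤
      (∫⁻ x, ENNReal.ofReal x.1 ^ (p / ((n : ℝ) + 2 - p)) *
        ‖f x‖ₑ ^ (((n : ℝ) + 2) * p / ((n : ℝ) + 2 - p)) ∂(cornerNu δ X p)) ^ θ *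
      (∫⁻ x, (ENNReal.ofReal x.1 ^ (p - (q - p) / p) * ENNReal.ofReal x.2.1 ^ p) ^ (1 / (1 - θ)) *
        ‖f x‖ₑ ^ p ∂(cornerNu δ X p)) ^ (1 - θ) := by
  have hp0 : 0 < p := by linarith
  obtain ⟨D, hD, hDN⟩ : ∃ D : ℝ, 0 < D ∧ (n : ℝ) + 2 - p = D := ⟨_, by linarith, rfl⟩
  rw [hDN] at hqN hθ ⊢
  have hN : (n : ℝ) + 2 = D + p := by linarith
  rw [hN] at hqN hθ ⊢
  set s : ℝ := (D + p) * p / D with hs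
  have hsp : s - p = p ^ 2 / D := by rw [hs]; field_simp; ring
  have hsp0 : 0 < s - p := by linarith
  have hθ0 : 0 < θ := by rw [hθ]; exact div_pos (by linarith) hsp0
  have hθ1 : θ < 1 := by rw [hθ, div_lt_one hsp0]; linarith
  have h1θ : 0 < 1 - θ := by linarith
  have hq : s * θ + p * (1 - θ) = q := by
    have : (s - p) * θ = q - p := by rw [hθ]; field_simp
    linarith
  -- This power of `x₁` is consumed by the Sobolev factor; out of the available `x₁ᵖ`, the power `p
  -- - (q-p)/p` remains for the `Lᵖ` factor.
  have he : p / D * θ = (q - p) / p := by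
    rw [hθ, hsp]
    field_simp
  have hs0 : 0 < s := by positivity
  refine le_trans (lintegral_mono_ae ?_) (ENNReal.lintegral_mul_norm_pow_le
    ((by fun_prop : Measurable fun x : CornerPt n =>
      ENNReal.ofReal x.1 ^ (p / D)).aemeasurable.mul (hf.enorm.pow_const s))
    ((by fun_prop : Measurable fun x : CornerPt n =>
      (ENNReal.ofReal x.1 ^ (p - (q - p) / p) * ENNReal.ofReal x.2.1 ^ p) ^
        (1 / (1 - θ))).aemeasurable.mul (hf.enorm.pow_const p)) hθ0.le h1θ.le (by ring))
  rw [cornerNu_eq hXo hp0]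
  refine (withDensity_absolutelyContinuous _ _).ae_le ?_
  filter_upwards [ae_restrict_mem (measurableSet_cornerSet hXo)] with x hx
  have h1 : 0 < x.1 := hx.1.1
  have h2 : 0 < x.2.1 := hx.2.1.1
  have h1' : ENNReal.ofReal x.1 ≠ 0 := by simpa using h1
  refine le_of_eq ?_
  simp only [Pi.mul_apply]
  rw [ENNReal.mul_rpow_of_nonneg _ _ hθ0.le, ENNReal.mul_rpow_of_nonneg _ _ h1θ.le,
    ← ENNReal.rpow_mul, ← ENNReal.rpow_mul, ← ENNReal.rpow_mul, ← ENNReal.rpow_mul,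
    one_div_mul_cancel h1θ.ne', ENNReal.rpow_one, he, Real.mul_rpow h1.le h2.le,
    ENNReal.ofReal_mul (by positivity), ← ENNReal.ofReal_rpow_of_pos h1,
    ← ENNReal.ofReal_rpow_of_pos h2]
  have e1 : ENNReal.ofReal x.1 ^ p =
      ENNReal.ofReal x.1 ^ ((q - p) / p) * ENNReal.ofReal x.1 ^ (p - (q - p) / p) := by
    rw [← ENNReal.rpow_add _ _ h1' ENNReal.ofReal_ne_top]
    congr 1
    ring
  have e2 : ‖f x‖ₑ ^ q = ‖f x‖ₑ ^ (s * θ) * ‖f x‖ₑ ^ (p * (1 - θ)) := by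
    rw [← ENNReal.rpow_add_of_nonneg _ _ (by positivity) (by positivity), hq]
  rw [e1, e2]
  ring

/-- The interpolation weight is bounded, and small near the singular faces. -/
theorem exists_weight_bound {β r : ℝ} (hβ : 0 < β) (hp : 0 < p) (hr : 0 < r) :
    ∃ B : ℝ≥0∞, B ≠ ⊤ ∧ (∀ x ∈ cornerSet δ X,
        (ENNReal.ofReal x.1 ^ β * ENNReal.ofReal x.2.1 ^ p) ^ r ≤ B) ∧
      ∀ κ : ℝ≥0∞, 0 < κ → ∃ η > 0, ∀ x ∈ cornerSet δ X, ¬(η ≤ x.1 ∧ η ≤ x.2.1) →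
        (ENNReal.ofReal x.1 ^ β * ENNReal.ofReal x.2.1 ^ p) ^ r ≤ κ := by
  have hδtop : ∀ t : ℝ, 0 < t → ENNReal.ofReal δ ^ t ≠ ⊤ := fun t ht =>
    ENNReal.rpow_ne_top_of_nonneg ht.le ENNReal.ofReal_ne_top
  refine ⟨(ENNReal.ofReal δ ^ β * ENNReal.ofReal δ ^ p) ^ r,
    ENNReal.rpow_ne_top_of_nonneg hr.le (ENNReal.mul_ne_top (hδtop β hβ) (hδtop p hp)),
    fun x hx => ?_, fun κ hκ => ?_⟩
  · have h1 := hx.1.2.le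
    have h2 := hx.2.1.2.le
    gcongr
  · have hrpow : ∀ t : ℝ, 0 < t →
        Tendsto (fun η : ℝ => ENNReal.ofReal η ^ t) (𝓝 0) (𝓝 0) := by
      intro t ht
      have : Continuous fun η : ℝ => ENNReal.ofReal η ^ t :=
        ENNReal.continuous_rpow_const.comp ENNReal.continuous_ofReal
      simpa [ht] using this.tendsto 0
    have hr0 : Tendsto (fun t : ℝ≥0∞ => t ^ r) (𝓝 0) (𝓝 0) := by
      have := (ENNReal.continuous_rpow_const (y := r)).tendsto 0
      simpa [hr] using this
    have t1 : Tendsto (fun η : ℝ => (ENNReal.ofReal η ^ β * ENNReal.ofReal δ ^ p) ^ r)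
        (𝓝 0) (𝓝 0) := by
      refine hr0.comp ?_
      simpa using ENNReal.Tendsto.mul_const (hrpow β hβ) (Or.inr (hδtop p hp))
    have t2 : Tendsto (fun η : ℝ => (ENNReal.ofReal δ ^ β * ENNReal.ofReal η ^ p) ^ r)
        (𝓝 0) (𝓝 0) := by
      refine hr0.comp ?_
      simpa using ENNReal.Tendsto.const_mul (hrpow p hp) (Or.inr (hδtop β hβ))
    have hev : ∀ᶠ η : ℝ in 𝓝[>] 0,
        (ENNReal.ofReal η ^ β * ENNReal.ofReal δ ^ p) ^ r ≤ κ ∧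
        (ENNReal.ofReal δ ^ β * ENNReal.ofReal η ^ p) ^ r ≤ κ :=
      ((t1.eventually_le_const hκ).and (t2.eventually_le_const hκ)).filter_mono nhdsWithin_le_nhds
    obtain ⟨η, ⟨h1, h2⟩, hη⟩ := (hev.and self_mem_nhdsWithin).exists
    refine ⟨η, hη, fun x hx hnot => ?_⟩
    have h3 := hx.1.2.le
    have h4 := hx.2.1.2.le
    rw [not_and_or, not_le, not_le] at hnot
    rcases hnot with h | h
    · refine le_trans ?_ h1
      have := h.le
      gcongr
    · refine le_trans ?_ h2
      have := h.le
      gcongr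

set_option maxHeartbeats 1000000 in
/-- The compact embedding into the weighted `L^q` space: the weighted `L^q` norm is bounded, and
it is small on subspaces of finite codimension. -/
theorem CornerH.exists_embedding [Fact (1 ≤ p)] (hXo : IsOpen X) (hXb : Bornology.IsBounded X)
    (hp : 1 < p) (hpN : p < (n : ℝ) + 2) (hpq : p < q)
    (hqN : q < ((n : ℝ) + 2) * p / (((n : ℝ) + 2) - p)) (hqp : q < p * (p + 1)) :
    (∃ C : ℝ≥0∞, C ≠ ⊤ ∧ ∀ u : CornerH δ X p,
      ∫⁻ x, ENNReal.ofReal ((x.1 * x.2.1) ^ p) * ‖u.1.1.fst x‖ₑ ^ q ∂(cornerNu δ X p) ≤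
        C * ‖u.1.1‖ₑ ^ q) ∧
    ∀ ε : ℝ≥0∞, 0 < ε → ∃ (ι : Type) (_ : Fintype ι)
      (F : ι → Lp ℝ (ENNReal.ofReal p) (cornerNu δ X p) →L[ℝ] ℝ), ∀ u : CornerH δ X p,
        (∀ k, F k u.1.1.fst = 0) →
      ∫⁻ x, ENNReal.ofReal ((x.1 * x.2.1) ^ p) * ‖u.1.1.fst x‖ₑ ^ q ∂(cornerNu δ X p) ≤
        ε * ‖u.1.1‖ₑ ^ q := by
  have hp0 : 0 < p := by linarith
  obtain ⟨C, hC, hsob⟩ := CornerH.exists_sobolev (δ := δ) hXo hXb hp hpN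
  obtain ⟨θ, hθ⟩ : ∃ θ, θ = (q - p) / (((n : ℝ) + 2) * p / (((n : ℝ) + 2) - p) - p) := ⟨_, rfl⟩
  set s : ℝ := ((n : ℝ) + 2) * p / ((n : ℝ) + 2 - p) with hs
  have hsp0 : 0 < s - p := by linarith
  have hθ0 : 0 < θ := by rw [hθ]; exact div_pos (by linarith) hsp0
  have hθ1 : θ < 1 := by rw [hθ, div_lt_one hsp0]; linarith
  have h1θ : 0 < 1 - θ := by linarith
  have hs0 : 0 < s := by linarith
  have hqs : s * θ + p * (1 - θ) = q := by
    have : (s - p) * θ = q - p := by rw [hθ]; field_simp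
    linarith
  set β : ℝ := p - (q - p) / p with hβ
  -- Positivity of the remaining power of `x₁` is exactly the condition `q < p(p+1)`; it makes the
  -- weight vanish at `x₁ = 0`.
  have hβ0 : 0 < β := by
    have : (q - p) / p < p := by rw [div_lt_iff₀ hp0]; nlinarith
    linarith
  obtain ⟨B, hB, hbound, hsmall⟩ := exists_weight_bound (δ := δ) (X := X) hβ0 hp0
    (show 0 < 1 / (1 - θ) by positivity)
  let wt : CornerPt n → ℝ≥0∞ := fun x =>
    (ENNReal.ofReal x.1 ^ β * ENNReal.ofReal x.2.1 ^ p) ^ (1 / (1 - θ))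
  have hmem : ∀ᵐ x ∂(cornerNu δ X p), x ∈ cornerSet δ X := by
    rw [cornerNu_eq hXo hp0]
    exact (withDensity_absolutelyContinuous _ _).ae_le
      (ae_restrict_mem (measurableSet_cornerSet hXo))
  have hnorm : ∀ u : CornerH δ X p,
      ∫⁻ x, ‖u.1.1.fst x‖ₑ ^ p ∂(cornerNu δ X p) ≤ ‖u.1.1‖ₑ ^ p := by
    intro u
    rw [← Lp_enorm_rpow_eq_lintegral hp0, CornerPair.enorm_rpow]
    exact le_self_add
  -- a bound for the `Lᵖ` part yields a bound for the weighted `L^q` norm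
  have hmain : ∀ (u : CornerH δ X p) (τ : ℝ≥0∞),
      ∫⁻ x, wt x * ‖u.1.1.fst x‖ₑ ^ p ∂(cornerNu δ X p) ≤ τ * ‖u.1.1‖ₑ ^ p →
      ∫⁻ x, ENNReal.ofReal ((x.1 * x.2.1) ^ p) * ‖u.1.1.fst x‖ₑ ^ q ∂(cornerNu δ X p) ≤
        C ^ θ * τ ^ (1 - θ) * ‖u.1.1‖ₑ ^ q := by
    intro u τ hτ
    calc _ ≤ (C * ‖u.1.1‖ₑ ^ s) ^ θ * (τ * ‖u.1.1‖ₑ ^ p) ^ (1 - θ) := by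
          refine (lintegral_interpolation_le hXo hp hpN hpq hqN hθ
            (Lp.aestronglyMeasurable _)).trans ?_
          exact mul_le_mul' (ENNReal.rpow_le_rpow (hsob u) hθ0.le)
            (ENNReal.rpow_le_rpow hτ h1θ.le)
      _ = _ := by
          rw [ENNReal.mul_rpow_of_nonneg _ _ hθ0.le, ENNReal.mul_rpow_of_nonneg _ _ h1θ.le,
            ← ENNReal.rpow_mul, ← ENNReal.rpow_mul, ← hqs,
            ENNReal.rpow_add_of_nonneg _ _ (by positivity) (by positivity)]
          ring
  have hCθ : C ^ θ ≠ ⊤ := ENNReal.rpow_ne_top_of_nonneg hθ0.le hC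
  refine ⟨⟨C ^ θ * B ^ (1 - θ), ENNReal.mul_ne_top hCθ
    (ENNReal.rpow_ne_top_of_nonneg h1θ.le hB), fun u => hmain u B ?_⟩, fun ε hε => ?_⟩
  · refine le_trans ?_ (mul_le_mul_right (hnorm u) B)
    rw [← lintegral_const_mul' _ _ hB]
    refine lintegral_mono_ae ?_
    filter_upwards [hmem] with x hx
    exact mul_le_mul_left (hbound x hx) _
  obtain ⟨τ, hτ0, hτtop, hτε⟩ : ∃ τ : ℝ≥0∞, 0 < τ ∧ τ ≠ ⊤ ∧ C ^ θ * τ ^ (1 - θ) ≤ ε := by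
    have h1 : Tendsto (fun t : ℝ => C ^ θ * ENNReal.ofReal t ^ (1 - θ)) (𝓝 0) (𝓝 0) := by
      have : Continuous fun t : ℝ => C ^ θ * ENNReal.ofReal t ^ (1 - θ) :=
        (ENNReal.continuous_const_mul hCθ).comp
          (ENNReal.continuous_rpow_const.comp ENNReal.continuous_ofReal)
      simpa [hθ1] using this.tendsto 0
    have h2 := (h1.eventually_le_const hε).filter_mono (nhdsWithin_le_nhds (s := Ioi 0))
    obtain ⟨t, h3, h4⟩ := (h2.and self_mem_nhdsWithin).exists
    exact ⟨ENNReal.ofReal t, by simpa using h4, ENNReal.ofReal_ne_top, h3⟩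
  have hτ2 : 0 < τ / 2 := ENNReal.half_pos hτ0.ne'
  -- Near the faces the weight is at most `τ/2`. Elsewhere it is at most `B`, and the local estimate
  -- is used with `(τ/2)/(B+1)`, where the `+ 1` avoids division by zero.
  obtain ⟨η, hη, hηsmall⟩ := hsmall (τ / 2) hτ2
  have hB1 : B + 1 ≠ ⊤ := by simpa using hB
  have hε' : 0 < τ / 2 / (B + 1) := ENNReal.div_pos hτ2.ne' hB1
  obtain ⟨ι, hι, F, C', -, hF⟩ := CornerH.exists_functionals (δ := δ) hXo hXb hp hη hε'
    (ENNReal.div_ne_top (ENNReal.div_ne_top hτtop (by simp)) (by simp))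
  refine ⟨ι, hι, F, fun u hu => (hmain u τ ?_).trans (mul_le_mul_left hτε _)⟩
  have hFu := hF u
  simp only [hu, enorm_zero, ENNReal.zero_rpow_of_pos hp0, Finset.sum_const_zero, mul_zero,
    add_zero] at hFu
  set A : Set (CornerPt n) := {x | η ≤ x.1 ∧ η ≤ x.2.1} with hA
  have hAm : MeasurableSet A :=
    (measurableSet_le measurable_const measurable_fst).inter
      (measurableSet_le measurable_const (measurable_fst.comp measurable_snd))
  calc _ ≤ ∫⁻ x, (τ / 2 * ‖u.1.1.fst x‖ₑ ^ p + A.indicator (fun x => B * ‖u.1.1.fst x‖ₑ ^ p) x)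
        ∂(cornerNu δ X p) := by
        refine lintegral_mono_ae ?_
        filter_upwards [hmem] with x hx
        by_cases hxA : x ∈ A
        · rw [indicator_of_mem hxA]
          exact le_add_left (mul_le_mul_left (hbound x hx) _)
        · rw [indicator_of_notMem hxA, add_zero]
          exact mul_le_mul_left (hηsmall x hx hxA) _
    _ = τ / 2 * ∫⁻ x, ‖u.1.1.fst x‖ₑ ^ p ∂(cornerNu δ X p) +
          B * ∫⁻ x in A, ‖u.1.1.fst x‖ₑ ^ p ∂(cornerNu δ X p) := by
        rw [lintegral_add_left' (((Lp.aestronglyMeasurable _).enorm.pow_const p).const_mul _),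
          lintegral_const_mul' _ _ (ENNReal.div_ne_top hτtop (by simp)), lintegral_indicator hAm,
          lintegral_const_mul' _ _ hB]
    _ ≤ τ / 2 * ‖u.1.1‖ₑ ^ p + (B + 1) * (τ / 2 / (B + 1) * ‖u.1.1‖ₑ ^ p) := by
        refine add_le_add (mul_le_mul_right (hnorm u) _) (mul_le_mul' le_self_add hFu)
    _ = τ * ‖u.1.1‖ₑ ^ p := by
        rw [← mul_assoc, ENNReal.mul_div_cancel (by simp) hB1, ← add_mul, ENNReal.add_halves]

end Embedding

/-! ### The energy in terms of the norm and the weighted `L^q` seminorm. -/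

section Energy

variable {n : ℕ} {δ p q : ℝ} {X : Set (EuclideanSpace ℝ (Fin n))}

/-- The measure `(x₁ x₂)ᵖ x₁ dσ`. -/
noncomputable def cornerRho (δ : ℝ) (X : Set (EuclideanSpace ℝ (Fin n))) (p : ℝ) :
    Measure (CornerPt n) :=
  (cornerNu δ X p).withDensity fun x => ENNReal.ofReal ((x.1 * x.2.1) ^ p)

theorem cornerRho_absolutelyContinuous : cornerRho δ X p ≪ cornerNu δ X p :=
  withDensity_absolutelyContinuous _ _

theorem lintegral_cornerRho {f : CornerPt n → ℝ≥0∞} (hf : Measurable f) :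
    ∫⁻ x, f x ∂(cornerRho δ X p) =
      ∫⁻ x, ENNReal.ofReal ((x.1 * x.2.1) ^ p) * f x ∂(cornerNu δ X p) := by
  rw [cornerRho, lintegral_withDensity_eq_lintegral_mul _ (by fun_prop) hf]
  rfl

variable [Fact (1 ≤ p)]

theorem CornerH.measurable_toFun (u : CornerH δ X p) : Measurable u.toFun :=
  (Lp.stronglyMeasurable _).measurable

theorem CornerH.measurable_grad (u : CornerH δ X p) : Measurable u.grad :=
  (Lp.stronglyMeasurable _).measurable

theorem CornerH.eLpNorm_rpow (hq : 0 < q) (u : CornerH δ X p) :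
    eLpNorm u.toFun (ENNReal.ofReal q) (cornerRho δ X p) ^ q =
      ∫⁻ x, ENNReal.ofReal ((x.1 * x.2.1) ^ p) * ‖u.toFun x‖ₑ ^ q ∂(cornerNu δ X p) := by
  rw [eLpNorm_eq_lintegral_rpow_enorm_toReal (by simpa using hq) (by simp),
    ENNReal.toReal_ofReal hq.le, ← ENNReal.rpow_mul, one_div_mul_cancel hq.ne', ENNReal.rpow_one,
    lintegral_cornerRho (u.measurable_toFun.enorm.pow_const q)]

theorem CornerH.toFun_add (u v : CornerH δ X p) :
    (u + v).toFun =ᵐ[cornerNu δ X p] u.toFun + v.toFun :=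
  Lp.coeFn_add u.1.1.fst v.1.1.fst

theorem CornerH.toFun_smul (c : ℝ) (u : CornerH δ X p) :
    (c • u).toFun =ᵐ[cornerNu δ X p] c • u.toFun :=
  Lp.coeFn_smul c u.1.1.fst

/-- The norm of the space `L^q` with respect to `(x₁ x₂)ᵖ x₁ dσ`, as a seminorm. -/
noncomputable def cornerSeminorm (hq : 1 ≤ q)
    (hfin : ∀ u : CornerH δ X p, eLpNorm u.toFun (ENNReal.ofReal q) (cornerRho δ X p) ≠ ⊤) :
    Seminorm ℝ (CornerH δ X p) :=
  Seminorm.of (fun u => (eLpNorm u.toFun (ENNReal.ofReal q) (cornerRho δ X p)).toReal)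
    (fun u v => by
      rw [← ENNReal.toReal_add (hfin u) (hfin v), eLpNorm_congr_ae
        (cornerRho_absolutelyContinuous.ae_le (CornerH.toFun_add u v))]
      refine ENNReal.toReal_mono (ENNReal.add_ne_top.2 ⟨hfin u, hfin v⟩) ?_
      exact eLpNorm_add_le u.measurable_toFun.aestronglyMeasurable
        v.measurable_toFun.aestronglyMeasurable (by simpa using ENNReal.ofReal_le_ofReal hq))
    (fun c u => by
      rw [eLpNorm_congr_ae (cornerRho_absolutelyContinuous.ae_le (CornerH.toFun_smul c u)),
        eLpNorm_const_smul, ENNReal.toReal_mul, toReal_enorm])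

theorem CornerH.integral_grad_eq (hXo : IsOpen X) (u : CornerH δ X p) :
    ∫ x, x.1 * ‖u.grad x‖ ^ p ∂(cornerVol δ X) = ‖u.1.1.snd‖ ^ p := by
  have hp1 : (1 : ℝ) ≤ p := Fact.out
  have hp : 0 < p := by linarith
  have hgm := u.measurable_grad
  have hmem : ∀ᵐ x ∂(cornerVol δ X), x ∈ cornerSet δ X :=
    (withDensity_absolutelyContinuous _ _).ae_le (ae_restrict_mem (measurableSet_cornerSet hXo))
  rw [integral_eq_lintegral_of_nonneg_ae]
  · have h1 : ∫⁻ x, ENNReal.ofReal (x.1 * ‖u.grad x‖ ^ p) ∂(cornerVol δ X) =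
        ‖u.1.1.snd‖ₑ ^ p := by
      have h2 : ‖u.1.1.snd‖ₑ ^ p = ∫⁻ x, ‖u.grad x‖ₑ ^ p ∂(cornerNu δ X p) :=
        Lp_enorm_rpow_eq_lintegral hp _
      rw [h2, cornerNu_eq_cornerVol hXo hp,
        lintegral_withDensity_eq_lintegral_mul _ (by fun_prop) (hgm.enorm.pow_const p)]
      refine lintegral_congr_ae ?_
      filter_upwards [hmem] with x hx
      rw [ENNReal.ofReal_mul hx.1.1.le, Pi.mul_apply, ← ofReal_norm,
        ENNReal.ofReal_rpow_of_nonneg (norm_nonneg _) hp.le]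
    rw [h1, ← ENNReal.toReal_rpow, toReal_enorm]
  · filter_upwards [hmem] with x hx
    have := hx.1.1.le
    simp only [Pi.zero_apply]
    positivity
  · exact (by fun_prop : Measurable fun x : CornerPt n => x.1 * ‖u.grad x‖ ^ p).aestronglyMeasurable

/-- The extra factor `x₁` in the energy is the density of `cornerNu` relative to `cornerVol`, which
makes the nonlinear term a power of `cornerSeminorm`. -/
theorem CornerH.integral_toFun_eq (hXo : IsOpen X) (hq : 0 < q) (u : CornerH δ X p) :
    ∫ x, x.1 * (x.1 * x.2.1) ^ p * |u.toFun x| ^ q ∂(cornerVol δ X) =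
      (eLpNorm u.toFun (ENNReal.ofReal q) (cornerRho δ X p)).toReal ^ q := by
  have hp1 : (1 : ℝ) ≤ p := Fact.out
  have hp : 0 < p := by linarith
  have hm := u.measurable_toFun
  have hmem : ∀ᵐ x ∂(cornerVol δ X), x ∈ cornerSet δ X :=
    (withDensity_absolutelyContinuous _ _).ae_le (ae_restrict_mem (measurableSet_cornerSet hXo))
  rw [integral_eq_lintegral_of_nonneg_ae]
  · rw [ENNReal.toReal_rpow, CornerH.eLpNorm_rpow hq, cornerNu_eq_cornerVol hXo hp,
      lintegral_withDensity_eq_lintegral_mul _ (by fun_prop) (by fun_prop)]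
    congr 1
    refine lintegral_congr_ae ?_
    filter_upwards [hmem] with x hx
    have h1 : 0 < x.1 := hx.1.1
    have h2 : 0 < x.2.1 := hx.2.1.1
    rw [ENNReal.ofReal_mul (by positivity), ENNReal.ofReal_mul h1.le, Pi.mul_apply,
      Real.enorm_eq_ofReal_abs, ENNReal.ofReal_rpow_of_nonneg (abs_nonneg _) hq.le, mul_assoc]
  · filter_upwards [hmem] with x hx
    have h1 : 0 < x.1 := hx.1.1
    have h2 : 0 < x.2.1 := hx.2.1.1
    simp only [Pi.zero_apply]
    positivity
  · exact (by fun_prop : Measurable fun x : CornerPt n =>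
      x.1 * (x.1 * x.2.1) ^ p * |u.toFun x| ^ q).aestronglyMeasurable

/-- The gradient controls the full norm. -/
theorem CornerH.exists_norm_rpow_le (hXo : IsOpen X) (hXb : Bornology.IsBounded X) (hn : 0 < n) :
    ∃ C : ℝ, 0 < C ∧ ∀ u : CornerH δ X p, ‖u‖ ^ p ≤ C * ‖u.1.1.snd‖ ^ p := by
  have hp1 : (1 : ℝ) ≤ p := Fact.out
  have hp : 0 < p := by linarith
  obtain ⟨C, hC, h⟩ := CornerH.exists_poincare (δ := δ) (p := p) hXo hXb hn
  refine ⟨C.toReal + 1, by positivity, fun u => ?_⟩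
  have h1 : ‖u.1.1‖ₑ ^ p ≤ (C + 1) * ‖u.1.1.snd‖ₑ ^ p := by
    rw [CornerPair.enorm_rpow, add_mul, one_mul]
    exact add_le_add_left (h u) _
  have h2 := ENNReal.toReal_mono (ENNReal.mul_ne_top (by simpa using hC)
    (ENNReal.rpow_ne_top_of_nonneg hp.le enorm_ne_top)) h1
  rw [ENNReal.toReal_mul, ← ENNReal.toReal_rpow, ← ENNReal.toReal_rpow, toReal_enorm, toReal_enorm,
    ENNReal.toReal_add hC (by simp), ENNReal.toReal_one] at h2
  exact h2

/-- The function part of an element, as a continuous linear map. -/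
noncomputable def CornerH.fstL :
    CornerH δ X p →L[ℝ] Lp ℝ (ENNReal.ofReal p) (cornerNu δ X p) where
  toFun u := u.1.1.fst
  map_add' _ _ := rfl
  map_smul' _ _ := rfl
  cont := CornerPair.continuous_fst.comp (continuous_subtype_val.comp continuous_subtype_val)

theorem le_mul_norm_of_rpow_le {E : Type*} [NormedAddCommGroup E] {a b : ℝ≥0∞} (u : E)
    (hq : 0 < q) (hb : b ≠ ⊤) (h : a ^ q ≤ b * ‖u‖ₑ ^ q) :
    a.toReal ≤ (b ^ (1 / q)).toReal * ‖u‖ := by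
  have h1 : a ≤ b ^ (1 / q) * ‖u‖ₑ := by
    have h2 := ENNReal.rpow_le_rpow h (show 0 ≤ 1 / q by positivity)
    rwa [ENNReal.mul_rpow_of_nonneg _ _ (by positivity), ← ENNReal.rpow_mul, ← ENNReal.rpow_mul,
      mul_one_div_cancel hq.ne', ENNReal.rpow_one, ENNReal.rpow_one] at h2
  have h2 := ENNReal.toReal_mono (ENNReal.mul_ne_top
    (ENNReal.rpow_ne_top_of_nonneg (by positivity) hb) enorm_ne_top) h1
  rwa [ENNReal.toReal_mul, toReal_enorm] at h2

end Energy

/-! ### Application of the abstract result to the corner energy. -/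

theorem theorem1p2 {n : ℕ} (δ : ℝ) (hδ : 0 < δ)
    (X : Set (EuclideanSpace ℝ (Fin n))) (hXo : IsOpen X) (hXb : Bornology.IsBounded X)
    (p q μ : ℝ) [Fact (1 ≤ p)] (hp : 2 < p) (hpN : p < (n : ℝ) + 2) (hpq : p < q)
    (hqN : q < ((n : ℝ) + 2) * p / (((n : ℝ) + 2) - p)) (hqp : q < p * (p + 1)) (hμ : 0 < μ)
    (E Ec : ℕ → Submodule ℝ (CornerH δ X p))
    (hdim : ∀ m, Module.rank ℝ (E m) = m) (hmono : ∀ m, E m ≤ E (m + 1))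
    (hdense : Dense (Submodule.span ℝ (⋃ m, (E m : Set (CornerH δ X p))) : Set (CornerH δ X p)))
    (hcompl : ∀ m, (E m).IsTopCompl (Ec m)) :
    Tendsto (fun m : ℕ => minimaxValue (cornerEnergy q μ) (Ec (m - 1))) atTop (𝓝 ⊤) := by
  have hp0 : 0 < p := by linarith
  have hq0 : 0 < q := by linarith
  -- For `n = 0` the bounds `2 < p < n + 2` are contradictory; the Poincaré inequality needs an `x'`
  -- direction.
  have hn : 0 < n := by
    rw [Nat.pos_iff_ne_zero]
    rintro rfl
    simp only [Nat.cast_zero] at hpN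
    linarith
  obtain ⟨⟨C, hC, hbound⟩, hsmall⟩ := CornerH.exists_embedding (δ := δ) (q := q) hXo hXb
    (by linarith) hpN hpq hqN hqp
  obtain ⟨K, hK, hnorm⟩ := CornerH.exists_norm_rpow_le (δ := δ) (p := p) hXo hXb hn
  have hle : ∀ (u : CornerH δ X p) (b : ℝ≥0∞), b ≠ ⊤ →
      ∫⁻ x, ENNReal.ofReal ((x.1 * x.2.1) ^ p) * ‖u.1.1.fst x‖ₑ ^ q ∂(cornerNu δ X p) ≤
        b * ‖u.1.1‖ₑ ^ q →
      (eLpNorm u.toFun (ENNReal.ofReal q) (cornerRho δ X p)).toReal ≤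
        (b ^ (1 / q)).toReal * ‖u‖ := by
    intro u b hb h
    refine le_mul_norm_of_rpow_le u hq0 hb ?_
    rw [CornerH.eLpNorm_rpow hq0]
    exact h
  have hfin : ∀ u : CornerH δ X p,
      eLpNorm u.toFun (ENNReal.ofReal q) (cornerRho δ X p) ≠ ⊤ := by
    intro u htop
    have h1 := CornerH.eLpNorm_rpow hq0 u
    have h2 := hbound u
    rw [htop, ENNReal.top_rpow_of_pos hq0] at h1
    have h3 : (⊤ : ℝ≥0∞) ≤ C * ‖u.1.1‖ₑ ^ q := h1.le.trans h2
    exact ENNReal.mul_ne_top hC (ENNReal.rpow_ne_top_of_nonneg hq0.le enorm_ne_top)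
      (top_le_iff.1 h3)
  refine tendsto_minimaxValue_top (S := cornerSeminorm (by linarith) hfin)
    -- The factor `1/K` pays for replacing the gradient norm by the full norm; the `+ 1` only keeps
    -- the embedding constant positive.
    (a := 1 / (p * K)) (b := μ / q) (C := (C ^ (1 / q)).toReal + 1) (p := p) (q := q)
    (by positivity) (by positivity) (by positivity) hp0 hpq (fun u => ?_) (fun u => ?_)
    (fun ε hε => ?_) (monotone_nat_of_le_succ hmono) hdense hcompl
  · rw [cornerEnergy, CornerH.integral_grad_eq hXo, CornerH.integral_toFun_eq hXo hq0]
    refine sub_le_sub_right ?_ _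
    calc 1 / (p * K) * ‖u‖ ^ p ≤ 1 / (p * K) * (K * ‖u.1.1.snd‖ ^ p) := by
          gcongr
          exact hnorm u
      _ = 1 / p * ‖u.1.1.snd‖ ^ p := by field_simp
  · refine (hle u C hC (hbound u)).trans ?_
    gcongr
    linarith
  -- The embedding bounds the `q`-th power of the seminorm, so the tolerance `ε^q` becomes `ε` after
  -- taking the root.
  · obtain ⟨ι, hι, F, hF⟩ := hsmall (ENNReal.ofReal (ε ^ q)) (by simpa using by positivity)
    refine ⟨ι, inferInstance, ContinuousLinearMap.pi fun k => (F k).comp CornerH.fstL,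
      fun u hu => ?_⟩
    refine (hle u _ ENNReal.ofReal_ne_top (hF u fun k => congrFun hu k)).trans_eq ?_
    rw [ENNReal.ofReal_rpow_of_nonneg (by positivity) (by positivity),
      ENNReal.toReal_ofReal (by positivity), ← Real.rpow_mul hε.le, mul_one_div_cancel hq0.ne',
      Real.rpow_one]
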